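/- Let $\mathbb{R}^{4,2}$ be $\mathbb{R}^6$ with an inner product $(\,,)$ of signature $(4,2)$, and identify $\wedge^2\mathbb{R}^{4,2}$ with $\mathfrak{o}(4,2)$ by $(a\wedge b)c=(a,c)b-(b,c)a$. Let $\Sigma$ be a simply connected smooth surface (all bundles, sections and forms below are smooth, and sections may be local). *Legendre maps.* A Legendre map $f$ is a null rank $2$ subbundle of the trivial bundle $\Sigma\times\mathbb{R}^{4,2}$ such that $d_X\sigma\perp f$ for all sections $\sigma$ of $f$ and all tangent vectors $X$, and such that $X\in T_x\Sigma$ is zero whenever $d_X\sigma\in f(x)$ for all sections $\sigma$ of $f$. A line $s(x)\le f(x)$ is a curvature sphere if its curvature space $T_{s}(x)=\{X\in T_x\Sigma : d_X\sigma\in f(x)\text{ for all sections }\sigma\text{ of }f\text{ with }\sigma(x)\in s(x)\}$ is non-zero. $f$ is umbilic-free if there are two rank $1$ subbundles $s_1,s_2\le f$ consisting of curvature spheres, with $s_1\cap s_2=\{0\}$; put $T_i=T_{s_i}$. It is regular if $s_1$ and $s_2$ are immersions into the projective light cone, i.e. $X\in T_x\Sigma$ is zero whenever $d_X\sigma\in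 s_i(x)$ for all sections $\sigma$ of $s_i$. *Spherical curvature lines.* A subbundle $V$ is constant along the leaves of $T_i$ if $d_X\sigma\in V$ for all sections $\sigma$ of $V$ and all $X\in T_i$. The leaves of $T_i$ are spherical curvature lines of $f$ if, for some timelike $\mathfrak{p}\in\mathbb{R}^{4,2}$, there is a null rank $1$ subbundle $\nu$ of $\Sigma\times\mathbb{R}^{4,2}$ that is constant along the leaves of $T_i$, is orthogonal to $f\cap\langle\mathfrak{p}\rangle^\perp$ and satisfies $\nu\cap f^\perp=\{0\}$. *Osculating complexes.* For a splitting of the trivial bundle into subbundles, write $d=\mathcal{D}+\mathcal{N}$, where $\mathcal{D}$ is the sum of the induced connections on the two summands. Let $S_1$ be the span of $\sigma_1,d_Y\sigma_1,d_Yd_Y\sigma_1$ for sections $\sigma_1$ of $s_1$ and $Y$ of $T_2$, and $S_2$ the span of $\sigma_2,d_X\sigma_2,d_Xd_X\sigma_2$ for sections $\sigma_2$ of $s_2$ and $X$ of $T_1$. For the splitting $S_1\oplus S_2$ of the trivial bundle, the osculating complexes are $L_i=\ker\mathcal{N}(T_i)\cap S_i\cap f^\perp$. **Proposition.** Suppose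 that $f$ is a regular umbilic-free Legendre map on $\Sigma$ and that the leaves of $T_1$ and the leaves of $T_2$ are both spherical curvature lines of $f$. Then: 1. $W=(L_1\oplus L_2)^\perp$ is a curved flat in the Grassmannian of $(2,2)$-planes in $\mathbb{R}^{4,2}$: it is a rank $4$ subbundle with fibres of signature $(2,2)$, and for the splitting $W\oplus W^\perp$ one has $[\mathcal{N}^W\wedge\mathcal{N}^W]=0$, i.e. $\mathcal{N}^W(X)$ and $\mathcal{N}^W(Y)$ commute for all $X,Y\in T_x\Sigma$. 2. $f$ is Lie applicable: there is a one-form $\eta$ with values in $f\wedge f^\perp$ such that $d\eta=[\eta\wedge\eta]=0$ and such that the quadratic differential $q(X,Y)=\operatorname{tr}(f\to f:\sigma\mapsto\eta(X)d_Y\sigma)$ is not identically zero. -/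

import Mathlib

open scoped Manifold ContDiff

noncomputable section

namespace LieSphere

/-! ### The space `ℝ^{4,2}` -/

/-- The vector space underlying `ℝ^{4,2}`. -/
abbrev R42 : Type := Fin 6 → ℝ

/-- The inner product of signature `(4,2)`. -/
def B : LinearMap.BilinForm ℝ R42 :=
  LinearMap.mk₂ ℝ
    (fun x y => x 0 * y 0 + x 1 * y 1 + x 2 * y 2 + x 3 * y 3 - x 4 * y 4 - x 5 * y 5)
    (by intros; simp only [Pi.add_apply]; ring)
    (by intros; simp only [Pi.smul_apply, smul_eq_mul]; ring)
    (by intros; simp only [Pi.add_apply]; ring)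
    (by intros; simp only [Pi.smul_apply, smul_eq_mul]; ring)

/-- The orthogonal complement `V^⊥` with respect to the inner product of signature `(4,2)`. -/
def perp (V : Submodule ℝ R42) : Submodule ℝ R42 where
  carrier := {w | ∀ v ∈ V, B v w = 0}
  zero_mem' := fun v _ => by simp
  add_mem' := fun ha hb v hv => by rw [map_add, ha v hv, hb v hv, add_zero]
  smul_mem' := fun c w hw v hv => by rw [map_smul, hw v hv, smul_zero]

/-- `a ∧ b` as an element of `𝔬(4,2)`, acting by `(a ∧ b) c = (a, c) b - (b, c) a`. -/
def wedge (a b : R42) : R42 →L[ℝ] R42 :=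
  LinearMap.toContinuousLinearMap ((B a).smulRight b - (B b).smulRight a)

/-- For subspaces `V`, `W`, the subspace `V ∧ W` of `𝔬(4,2)`. -/
def wedgeSpace (V W : Submodule ℝ R42) : Submodule ℝ (R42 →L[ℝ] R42) :=
  Submodule.span ℝ {A | ∃ a ∈ V, ∃ b ∈ W, A = wedge a b}

/-- `V` is a `(2,2)`-plane: it has an orthonormal basis with two spacelike and two timelike
members. -/
def IsPlane22 (V : Submodule ℝ R42) : Prop :=
  ∃ e : Fin 4 → R42, V = Submodule.span ℝ (Set.range e) ∧
    ∀ i j, B (e i) (e j) = if i = j then (if i < 2 then 1 else -1) else 0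

/-! ### Maps, bundles and forms on a surface -/

/-- The model space of a surface. -/
abbrev E2 : Type := EuclideanSpace ℝ (Fin 2)

variable {M : Type*} [TopologicalSpace M] [ChartedSpace E2 M]

/-- The differential `d_X g` at `x` of a map from the surface to a normed space. -/
def dd {F : Type*} [NormedAddCommGroup F] [NormedSpace ℝ F] (g : M → F) (x : M) :
    TangentSpace (𝓡 2) x →L[ℝ] F :=
  mfderiv (𝓡 2) 𝓘(ℝ, F) g x

/-- A family of subspaces of the trivial bundle with fibre `ℝ^{4,2}`. -/
abbrev Family42 (M : Type*) : Type _ := M → Submodule ℝ R42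

/-- `σ` is a smooth section of `V` over `U`. -/
def IsSection (V : Family42 M) (U : Set M) (σ : M → R42) : Prop :=
  ContMDiffOn (𝓡 2) 𝓘(ℝ, R42) ∞ σ U ∧ ∀ y ∈ U, σ y ∈ V y

/-- `V` is a smooth rank `k` subbundle of the trivial bundle with fibre `ℝ^{4,2}`. -/
def IsSubbundle (k : ℕ) (V : Family42 M) : Prop :=
  ∀ x : M, ∃ U : Set M, IsOpen U ∧ x ∈ U ∧ ∃ σ : Fin k → M → R42,
    (∀ i, IsSection V U (σ i)) ∧
    ∀ y ∈ U, LinearIndependent ℝ (fun i => σ i y) ∧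
      V y = Submodule.span ℝ (Set.range fun i => σ i y)

/-- `V` is null: the inner product vanishes identically on each fibre. -/
def IsNull (V : Family42 M) : Prop :=
  ∀ x, ∀ a ∈ V x, ∀ b ∈ V x, B a b = 0

/-- A distribution on the surface: a family of subspaces of the tangent spaces. -/
abbrev Distribution (M : Type*) [TopologicalSpace M] [ChartedSpace E2 M] : Type _ :=
  ∀ x : M, Submodule ℝ (TangentSpace (𝓡 2) x)

/-- `Y` is a smooth vector field on `U` that is tangent to the distribution `T`. -/
def IsVectorFieldIn [IsManifold (𝓡 2) ∞ M] (T : Distribution M) (U : Set M)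
    (Y : ∀ x : M, TangentSpace (𝓡 2) x) : Prop :=
  ContMDiffOn (𝓡 2) (𝓡 2).tangent ∞ (fun y => (⟨y, Y y⟩ : TangentBundle (𝓡 2) M)) U ∧
    ∀ y ∈ U, Y y ∈ T y

/-- `V` is constant along the leaves of `T`: sections of `V` have derivatives along `T` in `V`. -/
def ConstantAlong (V : Family42 M) (T : Distribution M) : Prop :=
  ∀ (x : M) (U : Set M) (σ : M → R42), IsOpen U → x ∈ U → IsSection V U σ →
    ∀ X ∈ T x, dd σ x X ∈ V x

/-- A one-form on the surface with values in a normed space. -/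
abbrev OneForm (M : Type*) [TopologicalSpace M] [ChartedSpace E2 M]
    (F : Type*) [NormedAddCommGroup F] [NormedSpace ℝ F] : Type _ :=
  ∀ x : M, TangentSpace (𝓡 2) x →L[ℝ] F

section Forms

variable {F : Type*} [NormedAddCommGroup F] [NormedSpace ℝ F]

/-- The expression of a one-form in the chart at `x₀`: its pull-back by the inverse chart. -/
def OneForm.inChart (η : OneForm M F) (x₀ : M) (y : E2) : E2 →L[ℝ] F :=
  (η ((extChartAt (𝓡 2) x₀).symm y)).comp
    (mfderiv 𝓘(ℝ, E2) (𝓡 2) (extChartAt (𝓡 2) x₀).symm y)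

/-- A one-form is smooth if its expression in every preferred chart is smooth. -/
def OneForm.IsSmooth (η : OneForm M F) : Prop :=
  ∀ x₀ : M, ContDiffOn ℝ ∞ (η.inChart x₀) (extChartAt (𝓡 2) x₀).target

/-- A one-form is closed, `dη = 0`: in every preferred chart, with expression `ω`, one has
`(dω)(a, b) = (D_a ω)(b) - (D_b ω)(a) = 0`. -/
def OneForm.IsClosed (η : OneForm M F) : Prop :=
  ∀ x₀ : M, ∀ y ∈ (extChartAt (𝓡 2) x₀).target, ∀ a b : E2,
    fderiv ℝ (η.inChart x₀) y a b - fderiv ℝ (η.inChart x₀) y b a = 0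

end Forms

/-! ### Legendre maps and their curvature spheres -/

/-- `f`, viewed as a rank two null subbundle, is a Legendre map: derivatives of sections of `f` are
orthogonal to `f`, and a tangent vector along which all sections of `f` have derivatives in `f`
is zero. -/
structure IsLegendre (f : Family42 M) : Prop where
  subbundle : IsSubbundle 2 f
  null : IsNull f
  contact : ∀ (x : M) (U : Set M) (σ : M → R42), IsOpen U → x ∈ U → IsSection f U σ →
    ∀ X, dd σ x X ∈ perp (f x)
  immersed : ∀ (x : M) (X : TangentSpace (𝓡 2) x),
    (∀ (U : Set M) (σ : M → R42), IsOpen U → x ∈ U → IsSection f U σ → dd σ x X ∈ f x) → X = 0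

/-- The space of `X ∈ T_xΣ` with `d_X σ ∈ f(x)` for all sections `σ` of `f` such that
`σ(x) ∈ s(x)`. If `s(x)` is a curvature sphere then this is its curvature space. -/
def curvatureSpace (f s : Family42 M) : Distribution M := fun x =>
  { carrier := {X | ∀ (U : Set M) (σ : M → R42), IsOpen U → x ∈ U → IsSection f U σ →
      σ x ∈ s x → dd σ x X ∈ f x}
    zero_mem' := fun U σ _ _ _ _ => by rw [map_zero]; exact zero_mem _
    add_mem' := fun ha hb U σ h1 h2 h3 h4 => by
      rw [map_add]; exact add_mem (ha U σ h1 h2 h3 h4) (hb U σ h1 h2 h3 h4)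
    smul_mem' := fun c X hX U σ h1 h2 h3 h4 => by
      rw [map_smul]; exact Submodule.smul_mem _ c (hX U σ h1 h2 h3 h4) }

/-- `s` is a curvature sphere congruence of `f`: a smooth rank one subbundle of `f` each of whose
fibres is a curvature sphere. -/
structure IsCurvatureSphereCongruence (f s : Family42 M) : Prop where
  subbundle : IsSubbundle 1 s
  le : ∀ x, s x ≤ f x
  curvature : ∀ x, curvatureSpace f s x ≠ ⊥

/-- `f` is umbilic-free with curvature sphere congruences `s₁`, `s₂`. -/
structure IsUmbilicFree (f s₁ s₂ : Family42 M) : Prop where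
  fst : IsCurvatureSphereCongruence f s₁
  snd : IsCurvatureSphereCongruence f s₂
  disjoint : ∀ x, s₁ x ⊓ s₂ x = ⊥

/-- The sphere congruence `s` is an immersion into the projective light cone: if all sections of
`s` have derivative along `X` in `s`, then `X = 0`. -/
def IsImmersedCongruence (s : Family42 M) : Prop :=
  ∀ (x : M) (X : TangentSpace (𝓡 2) x),
    (∀ (U : Set M) (σ : M → R42), IsOpen U → x ∈ U → IsSection s U σ → dd σ x X ∈ s x) → X = 0

/-- An umbilic-free `f` is regular if both of its curvature sphere congruences are immersions. -/
def IsRegularPair (s₁ s₂ : Family42 M) : Prop :=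
  IsImmersedCongruence s₁ ∧ IsImmersedCongruence s₂

/-! ### Spherical curvature lines -/

/-- The point sphere map `f ∩ ⟨p⟩^⊥` with respect to the point sphere complex `p`. -/
def pointSphereMap (f : Family42 M) (p : R42) : Family42 M :=
  fun x => f x ⊓ perp (Submodule.span ℝ {p})

/-- The curvature lines of `f` that are the leaves of `T` are spherical: for some timelike point
sphere complex `p`, the point sphere map is orthogonal to a smooth map `ν` into the projective
light cone that is constant along the leaves of `T`. As usual, the spheres `ν` are assumed
to be transversal to the surface, so `ν ∩ f^⊥ = 0`. -/
def HasSphericalCurvatureLines (f : Family42 M) (T : Distribution M) : Prop :=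
  ∃ p : R42, B p p < 0 ∧ ∃ ν : Family42 M,
    IsSubbundle 1 ν ∧ IsNull ν ∧ ConstantAlong ν T ∧
    (∀ x, pointSphereMap f p x ≤ perp (ν x)) ∧ ∀ x, ν x ⊓ perp (f x) = ⊥

/-! ### Splittings of the trivial connection -/

open Classical in
/-- The projection onto `V(x)` along `V'(x)` (zero if these are not complementary). -/
def proj (V V' : Family42 M) (x : M) : R42 →L[ℝ] R42 :=
  if h : IsCompl (V x) (V' x) then
    LinearMap.toContinuousLinearMap ((V x).projection (V' x) h)
  else 0

/-- For a splitting `V ⊕ V'` of the trivial bundle, with projections `P` and `Q`, the tensor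
`𝒩 = d - 𝒟`, where `𝒟 = P ∘ d ∘ P + Q ∘ d ∘ Q` is the sum of the induced connections. It is
evaluated on constant sections `v`, for which `d v = 0`. -/
def normalForm (V V' : Family42 M) (x : M) (X : TangentSpace (𝓡 2) x) : R42 →L[ℝ] R42 :=
  -((proj V V' x).comp (dd (proj V V') x X) + (proj V' V x).comp (dd (proj V' V) x X))

/-- `W` is a curved flat in the Grassmannian of `(2,2)`-planes: it is a smooth bundle of
`(2,2)`-planes and `𝒩^W`, the part of `d` that exchanges `W` and `W^⊥`, satisfies
`[𝒩^W ∧ 𝒩^W] = 0`. -/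
structure IsCurvedFlat22 (W : Family42 M) : Prop where
  subbundle : IsSubbundle 4 W
  signature : ∀ x, IsPlane22 (W x)
  flat : ∀ (x : M) (X Y : TangentSpace (𝓡 2) x),
    (normalForm W (fun y => perp (W y)) x X).comp (normalForm W (fun y => perp (W y)) x Y) =
    (normalForm W (fun y => perp (W y)) x Y).comp (normalForm W (fun y => perp (W y)) x X)

/-! ### Lie cyclides and osculating complexes -/

/-- For a rank one bundle `s` and a distribution `T`, the span of `σ`, `d_Y σ` and `d_Y d_Y σ`
for sections `σ` of `s` and vector fields `Y` in `T`. -/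
def secondDerived [IsManifold (𝓡 2) ∞ M] (s : Family42 M) (T : Distribution M) : Family42 M := fun x =>
  Submodule.span ℝ {w | ∃ (U : Set M) (σ : M → R42) (Y : ∀ y : M, TangentSpace (𝓡 2) y),
    IsOpen U ∧ x ∈ U ∧ IsSection s U σ ∧ IsVectorFieldIn T U Y ∧
    (w = σ x ∨ w = dd σ x (Y x) ∨ w = dd (fun y => dd σ y (Y y)) x (Y x))}

/-- For curvature sphere congruences `s`, `s'` of `f`, the Lie cyclide belonging to `s`: the span of
sections of `s` and their first and second derivatives along the curvature spaces of `s'`. -/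
def lieCyclide [IsManifold (𝓡 2) ∞ M] (f s s' : Family42 M) : Family42 M :=
  secondDerived s (curvatureSpace f s')

/-- For curvature sphere congruences `s`, `s'` of `f`, with curvature subbundles `T`, `T'` and Lie
cyclides `S`, `S'`, the osculating complex belonging to `s`: the intersection of `S`,
`f^⊥` and the kernel of `𝒩(T)`, where `𝒩` is the part of `d` that exchanges `S` and `S'`. -/
def osculatingComplex [IsManifold (𝓡 2) ∞ M] (f s s' : Family42 M) : Family42 M := fun x =>
  lieCyclide f s s' x ⊓ perp (f x) ⊓
    ⨅ X ∈ curvatureSpace f s x,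
      LinearMap.ker (normalForm (lieCyclide f s s') (lieCyclide f s' s) x X : R42 →ₗ[ℝ] R42)

/-! ### Lie applicable Legendre maps -/

/-- `q` is the quadratic differential of a form `η` with values in `f ∧ f^⊥`: `q(X, Y)` is the trace
of the endomorphism `σ ↦ η(X) d_Y σ` of `f`. -/
def IsQuadDiff (f : Family42 M) (η : OneForm M (R42 →L[ℝ] R42))
    (q : ∀ x : M, TangentSpace (𝓡 2) x → TangentSpace (𝓡 2) x → ℝ) : Prop :=
  ∀ (x : M) (X Y : TangentSpace (𝓡 2) x), ∃ A : f x →ₗ[ℝ] f x,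
    (∀ (U : Set M) (σ : M → R42), IsOpen U → x ∈ U → IsSection f U σ →
      ∀ h : σ x ∈ f x, (A ⟨σ x, h⟩ : R42) = η x X (dd σ x Y)) ∧
    q x X Y = LinearMap.trace ℝ (f x) A

/-- `η` is a gauge potential of `f`: a smooth one-form with values in `f ∧ f^⊥` such that `dη = 0` and
`[η ∧ η] = 0`, and whose quadratic differential is not identically zero. -/
structure IsGaugePotential (f : Family42 M) (η : OneForm M (R42 →L[ℝ] R42)) : Prop where
  smooth : η.IsSmooth
  mem : ∀ x X, η x X ∈ wedgeSpace (f x) (perp (f x))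
  closed : η.IsClosed
  bracket : ∀ (x : M) (X Y : TangentSpace (𝓡 2) x),
    (η x X).comp (η x Y) - (η x Y).comp (η x X) = 0
  quadDiff : ∃ q, IsQuadDiff f η q ∧ ∃ x X Y, q x X Y ≠ 0

/-- A Legendre map is Lie applicable if it has a gauge potential. -/
def IsLieApplicable (f : Family42 M) : Prop :=
  IsLegendre f ∧ ∃ η : OneForm M (R42 →L[ℝ] R42), IsGaugePotential f η

end LieSphere

end

open LieSphere

/-! Each family of spherical curvature lines is traded for a normal field of `f`. On `f` the
functionals given by `p` and by `ν` have the same kernel, so a unique section `t` of `ν` satisfies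
`t - p ⊥ f`. Put `l = t - p`. Constancy of `ν`, the contact condition and regularity force `d_X t =
0` for `X` in the curvature space, so `l` is constant along the curvature lines. It does not lie in
`f` (`notMem_of_dd_eq_zero`), and `f^⊥/f` is positive definite, so `l` can be normalised
(`HasSphericalCurvatureLines.exists_normal`).

With unit normals `l₁`, `l₂` at hand, let `X`, `Y` span `T₁`, `T₂`, and let `σ₁`, `σ₂` span the
curvature spheres. Since `d_X l₁ = 0` and `d_Y l₂ = 0`, each `dl_i` has rank one. Adding a multiple
of `σ₁` to a multiple of `d_Y l₁` gives a null vector `b₁` dual to `σ₁`, and likewise `b₂`. The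
result is a null frame `σ₁, σ₂, b₁, b₂, l₁, l₂`, unique up to scaling `σ_i` against `b_i`
(`exists_adaptedFrame`, `exists_smul_eq`). Most vanishing statements about it come from one device,
`bilin_dd_symm`: if `⟨u, dv⟩ = 0` identically, then `⟨d_Z u, d_W v⟩` is symmetric in `Z`, `W`. In
this frame `S_i = ⟨σ_i, l_i, b_i⟩` and `L_i = ⟨l_i⟩`, so `W^⊥ = ⟨l₁, l₂⟩` and `𝒩^W = l₁ ∧ dl₁ + l₂ ∧
dl₂`. Its values commute because `dl₁` and `dl₂` take values in two fixed lines at each point,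
orthogonal to each other and to the normals.

For Lie applicability write `r_i = (dl_i, b_i)` and `c_i = (dl_i, σ_i)`. The endomorphism `τ = b₁ ∧
σ₁ + b₂ ∧ σ₂` is globally defined, and `η = ½ (l₁ ∧ dl₁ + l₂ ∧ dl₂ - dτ)` is closed because each
`dl_i` has rank one. The structure equations cancel everything outside `f ∧ f^⊥`. Its quadratic
differential is non-zero wherever some `dl_i` is not null, that is, some `r_i ≠ 0`
(`isLieApplicable_of_ne`).

If both `r_i` vanish identically, then so does `(db₁, b₂)`, and `⟨b₁, b₂⟩` is a constant null plane.
For a constant vector `v`, the section `e = (b₁, v) σ₁ + (b₂, v) σ₂` of `f` then has `de` in `⟨l₁,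
l₂⟩`. With `R` the reflection that changes the sign of `l₁`, the form `e ∧ R de` is a gauge
potential (`isLieApplicable_of_eq_zero`). -/

noncomputable section

open scoped Manifold ContDiff Topology
open Set Filter
set_option linter.unusedSectionVars false

namespace LieSphere

/-! ### Calculus on a surface -/

section Calculus

variable {M : Type*} [TopologicalSpace M] [ChartedSpace E2 M]
variable {F G H : Type*} [NormedAddCommGroup F] [NormedSpace ℝ F]
  [NormedAddCommGroup G] [NormedSpace ℝ G] [NormedAddCommGroup H] [NormedSpace ℝ H]

/-- Smoothness of vector valued maps on a subset of the surface. -/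
abbrev SmoothOn (g : M → F) (U : Set M) : Prop := ContMDiffOn (𝓡 2) 𝓘(ℝ, F) ∞ g U

theorem SmoothOn.mdifferentiableAt {g : M → F} {U : Set M} (hg : SmoothOn g U) (hU : IsOpen U)
    {x : M} (hx : x ∈ U) : MDifferentiableAt (𝓡 2) 𝓘(ℝ, F) g x :=
  (hg.contMDiffAt (hU.mem_nhds hx)).mdifferentiableAt (by simp)

theorem SmoothOn.bilin (Λ : F →L[ℝ] G →L[ℝ] H) {u : M → F} {v : M → G} {U : Set M}
    (hu : SmoothOn u U) (hv : SmoothOn v U) : SmoothOn (fun y => Λ (u y) (v y)) U :=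
  (ContDiff.contMDiff (n := ∞) Λ.isBoundedBilinearMap.contDiff).comp_contMDiffOn
    (hu.prodMk_space hv)

theorem SmoothOn.linear (Λ : F →L[ℝ] G) {u : M → F} {U : Set M}
    (hu : SmoothOn u U) : SmoothOn (fun y => Λ (u y)) U :=
  (ContDiff.contMDiff (n := ∞) Λ.contDiff).comp_contMDiffOn hu

theorem dd_eq_fderiv {g : M → F} {x : M} (hg : MDifferentiableAt (𝓡 2) 𝓘(ℝ, F) g x) :
    dd g x = fderiv ℝ (g ∘ (extChartAt (𝓡 2) x).symm) (extChartAt (𝓡 2) x x) := by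
  have h : dd g x = fderivWithin ℝ (writtenInExtChartAt (𝓡 2) 𝓘(ℝ, F) x g)
      (Set.range (𝓡 2)) (extChartAt (𝓡 2) x x) := if_pos hg
  refine h.trans ?_
  simp only [writtenInExtChartAt, extChartAt_model_space_eq_id, PartialEquiv.refl_coe,
    Function.id_comp, modelWithCornersSelf_coe, Set.range_id, fderivWithin_univ]
  rfl

theorem _root_.MDifferentiableAt.differentiableAt_chart {g : M → F} {x : M}
    (hg : MDifferentiableAt (𝓡 2) 𝓘(ℝ, F) g x) :
    DifferentiableAt ℝ (g ∘ (extChartAt (𝓡 2) x).symm) (extChartAt (𝓡 2) x x) := by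
  have := ((mdifferentiableAt_iff _ _).1 hg).2
  simpa only [writtenInExtChartAt, extChartAt_model_space_eq_id, PartialEquiv.refl_coe,
    Function.id_comp, modelWithCornersSelf_coe, Set.range_id, differentiableWithinAt_univ] using this

theorem dd_congr {g h : M → F} {x : M} (e : g =ᶠ[𝓝 x] h) : dd g x = dd h x := by
  unfold dd; exact e.mfderiv_eq

theorem dd_const (c : F) (x : M) : dd (fun _ : M => c) x = 0 := by
  unfold dd; exact mfderiv_const

theorem dd_bilin (Λ : F →L[ℝ] G →L[ℝ] H) {u : M → F} {v : M → G} {x : M}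
    (hu : MDifferentiableAt (𝓡 2) 𝓘(ℝ, F) u x) (hv : MDifferentiableAt (𝓡 2) 𝓘(ℝ, G) v x)
    (Z : TangentSpace (𝓡 2) x) :
    dd (fun y => Λ (u y) (v y)) x Z = Λ (u x) (dd v x Z) + Λ (dd u x Z) (v x) := by
  have h1 := hu.differentiableAt_chart
  have h2 := hv.differentiableAt_chart
  have h := Λ.hasFDerivAt_of_bilinear h1.hasFDerivAt h2.hasFDerivAt
  have h3 : MDifferentiableAt (𝓡 2) 𝓘(ℝ, H) (fun y => Λ (u y) (v y)) x :=
    (Λ.isBoundedBilinearMap.differentiableAt (u x, v x)).mdifferentiableAt.comp x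
      (hu.prodMk_space hv)
  rw [dd_eq_fderiv h3, dd_eq_fderiv hu, dd_eq_fderiv hv]
  have h4 := h.fderiv
  simp only [Function.comp_apply, extChartAt_to_inv] at h4
  change fderiv ℝ (fun y => Λ ((u ∘ (extChartAt (𝓡 2) x).symm) y)
    ((v ∘ (extChartAt (𝓡 2) x).symm) y)) _ Z = _
  simp only [Function.comp_apply]
  rw [h4]
  rfl

theorem dd_linear (Λ : F →L[ℝ] G) {u : M → F} {x : M}
    (hu : MDifferentiableAt (𝓡 2) 𝓘(ℝ, F) u x) (Z : TangentSpace (𝓡 2) x) :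
    dd (fun y => Λ (u y)) x Z = Λ (dd u x Z) := by
  have h3 : MDifferentiableAt (𝓡 2) 𝓘(ℝ, G) (fun y => Λ (u y)) x :=
    (Λ.differentiableAt).mdifferentiableAt.comp x hu
  rw [dd_eq_fderiv h3, dd_eq_fderiv hu]
  have := (Λ.hasFDerivAt.comp _ hu.differentiableAt_chart.hasFDerivAt).fderiv
  change fderiv ℝ (Λ ∘ (u ∘ (extChartAt (𝓡 2) x).symm)) _ Z = _
  rw [this]; rfl

theorem dd_add {u v : M → F} {x : M}
    (hu : MDifferentiableAt (𝓡 2) 𝓘(ℝ, F) u x) (hv : MDifferentiableAt (𝓡 2) 𝓘(ℝ, F) v x)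
    (Z : TangentSpace (𝓡 2) x) :
    dd (fun y => u y + v y) x Z = dd u x Z + dd v x Z := by
  unfold dd
  exact congrArg (fun (T : TangentSpace (𝓡 2) x →L[ℝ] F) => T Z) (mfderiv_add hu hv)

theorem dd_sub {u v : M → F} {x : M}
    (hu : MDifferentiableAt (𝓡 2) 𝓘(ℝ, F) u x) (hv : MDifferentiableAt (𝓡 2) 𝓘(ℝ, F) v x)
    (Z : TangentSpace (𝓡 2) x) :
    dd (fun y => u y - v y) x Z = dd u x Z - dd v x Z := by
  unfold dd
  exact congrArg (fun (T : TangentSpace (𝓡 2) x →L[ℝ] F) => T Z) (mfderiv_sub hu hv)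

variable [IsManifold (𝓡 2) ∞ M]

theorem SmoothOn.dd_apply {g : M → F} {U : Set M} (hU : IsOpen U) (hg : SmoothOn g U)
    {Y : ∀ y : M, TangentSpace (𝓡 2) y}
    (hY : ContMDiffOn (𝓡 2) (𝓡 2).tangent ∞ (fun y => (⟨y, Y y⟩ : TangentBundle (𝓡 2) M)) U) :
    SmoothOn (fun y => dd g y (Y y)) U := by
  have h1 := hg.contMDiffOn_tangentMapWithin (m := ∞) (by simp) hU.uniqueMDiffOn
  have h2 := h1.comp hY (fun y hy => hy)
  have h3 := (contMDiff_snd_tangentBundle_modelSpace F 𝓘(ℝ, F) (n := ∞)).comp_contMDiffOn h2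
  refine h3.congr fun y hy => ?_
  exact congrArg (fun T : TangentSpace (𝓡 2) y →L[ℝ] F => T (Y y))
    (mfderivWithin_of_isOpen (f := g) (I := 𝓡 2) (I' := 𝓘(ℝ, F)) hU hy).symm

theorem smoothOn_chart {g : M → F} {U : Set M} (hg : SmoothOn g U) (x₀ : M) :
    ContDiffOn ℝ ∞ (g ∘ (extChartAt (𝓡 2) x₀).symm)
      ((extChartAt (𝓡 2) x₀).target ∩ (extChartAt (𝓡 2) x₀).symm ⁻¹' U) := by
  rw [← contMDiffOn_iff_contDiffOn]
  exact hg.comp ((contMDiffOn_extChartAt_symm x₀).mono inter_subset_left) (fun y hy => hy.2)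

theorem isOpen_chart_preimage {U : Set M} (hU : IsOpen U) (x₀ : M) :
    IsOpen ((extChartAt (𝓡 2) x₀).target ∩ (extChartAt (𝓡 2) x₀).symm ⁻¹' U) :=
  (continuousOn_extChartAt_symm x₀).isOpen_inter_preimage (isOpen_extChartAt_target x₀) hU

theorem fderiv_chart {g : M → F} {U : Set M} (hU : IsOpen U) (hg : SmoothOn g U) (x₀ : M) {y : E2}
    (hy : y ∈ (extChartAt (𝓡 2) x₀).target) (hyU : (extChartAt (𝓡 2) x₀).symm y ∈ U) :
    ∀ e : E2, fderiv ℝ (g ∘ (extChartAt (𝓡 2) x₀).symm) y e =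
      dd g ((extChartAt (𝓡 2) x₀).symm y)
        (mfderiv 𝓘(ℝ, E2) (𝓡 2) (extChartAt (𝓡 2) x₀).symm y e) := by
  intro e
  rw [← mfderiv_eq_fderiv]
  have h : MDifferentiableAt 𝓘(ℝ, E2) (𝓡 2) (extChartAt (𝓡 2) x₀).symm y :=
    ((contMDiffOn_extChartAt_symm (n := ∞) x₀).contMDiffAt
      ((isOpen_extChartAt_target x₀).mem_nhds hy)).mdifferentiableAt (by simp)
  exact congrArg (fun T : E2 →L[ℝ] F => T e)
    (mfderiv_comp y (hg.mdifferentiableAt hU hyU) h)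

/-- If `⟨u, dv⟩` vanishes identically, then `⟨du, dv⟩` is symmetric. -/
theorem bilin_dd_symm (Λ : F →L[ℝ] G →L[ℝ] H) {u : M → F} {v : M → G} {U : Set M} (hU : IsOpen U)
    (hu : SmoothOn u U) (hv : SmoothOn v U)
    (h : ∀ y ∈ U, ∀ Z, Λ (u y) (dd v y Z) = 0) {x : M} (hx : x ∈ U) (Z W : TangentSpace (𝓡 2) x) :
    Λ (dd u x Z) (dd v x W) = Λ (dd u x W) (dd v x Z) := by
  have hud := hu.mdifferentiableAt hU hx
  have hvd := hv.mdifferentiableAt hU hx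
  rw [dd_eq_fderiv hud, dd_eq_fderiv hvd]
  set φ := extChartAt (𝓡 2) x with hφ
  set a := φ x with ha
  have hmem : a ∈ φ.target ∩ φ.symm ⁻¹' U :=
    ⟨mem_extChartAt_target x, by simpa [ha, hφ] using hx⟩
  have hopen := isOpen_chart_preimage hU x
  have hnh := hopen.mem_nhds hmem
  have hvs := smoothOn_chart hv x
  have hdv : ContDiffAt ℝ 1 (fderiv ℝ (v ∘ φ.symm)) a :=
    (hvs.contDiffAt hnh).fderiv_right (m := 1) (by norm_cast)
  have key : ∀ e : E2, (fun y => Λ ((u ∘ φ.symm) y) (fderiv ℝ (v ∘ φ.symm) y e)) =ᶠ[𝓝 a]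
      fun _ => (0 : H) := by
    intro e
    filter_upwards [hnh] with y hy
    rw [fderiv_chart hU hv x hy.1 hy.2]
    exact h _ hy.2 _
  -- This is the product rule applied to `⟨u, dv⟩ = 0` in a chart. The term with the second
  -- derivative of `v` is symmetric, hence so is the other one.
  have h2 : ∀ e e' : E2, Λ (u x) (fderiv ℝ (fderiv ℝ (v ∘ φ.symm)) a e' e) +
      Λ (fderiv ℝ (u ∘ φ.symm) a e') (fderiv ℝ (v ∘ φ.symm) a e) = 0 := by
    intro e e'
    have d1 := (hdv.differentiableAt (by simp)).hasFDerivAt.clm_apply (hasFDerivAt_const e a)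
    have d2 := Λ.hasFDerivAt_of_bilinear hud.differentiableAt_chart.hasFDerivAt d1
    have d3 := (d2.congr_of_eventuallyEq (key e).symm).unique (hasFDerivAt_const (0 : H) a)
    have d4 := congrArg (fun T : E2 →L[ℝ] H => T e') d3
    simpa [ContinuousLinearMap.precompR, ContinuousLinearMap.precompL, hφ, ha] using d4
  have hsymm : IsSymmSndFDerivAt ℝ (v ∘ φ.symm) a :=
    (hvs.contDiffAt hnh).isSymmSndFDerivAt (by simp [minSmoothness_of_isRCLikeNormedField]; exact WithTop.coe_le_coe.2 le_top)
  have e1 := h2 W Z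
  have e2 := h2 Z W
  rw [hsymm.eq Z W] at e1
  exact add_left_cancel (e1.trans e2.symm)

/-- A one-form that is locally of the form `Φ(db)` with `dΦ ∧ db = 0` is smooth and closed. -/
theorem OneForm.isSmooth_isClosed_of_local (η : OneForm M H)
    (h : ∀ p : M, ∃ U : Set M, IsOpen U ∧ p ∈ U ∧ ∃ (Φ : M → F →L[ℝ] H) (b : M → F),
      SmoothOn Φ U ∧ SmoothOn b U ∧ (∀ x ∈ U, ∀ Z, η x Z = Φ x (dd b x Z)) ∧
      ∀ x ∈ U, ∀ Z W, dd Φ x Z (dd b x W) = dd Φ x W (dd b x Z)) :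
    η.IsSmooth ∧ η.IsClosed := by
  have main : ∀ (x₀ : M) (y : E2), y ∈ (extChartAt (𝓡 2) x₀).target →
      ContDiffAt ℝ ∞ (η.inChart x₀) y ∧ ∀ e e' : E2,
      fderiv ℝ (η.inChart x₀) y e e' - fderiv ℝ (η.inChart x₀) y e' e = 0 := by
    intro x₀ y hy
    obtain ⟨U, hU, hpU, Φ, b, hΦ, hb, hη, hcl⟩ := h ((extChartAt (𝓡 2) x₀).symm y)
    set φ := extChartAt (𝓡 2) x₀ with hφ
    have hmem : y ∈ φ.target ∩ φ.symm ⁻¹' U := ⟨hy, hpU⟩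
    have hnh := (isOpen_chart_preimage hU x₀).mem_nhds hmem
    have hloc : η.inChart x₀ =ᶠ[𝓝 y]
        fun z => ((Φ ∘ φ.symm) z).comp (fderiv ℝ (b ∘ φ.symm) z) := by
      filter_upwards [hnh] with z hz
      ext e
      refine (hη _ hz.2 _).trans ?_
      exact congrArg _ (fderiv_chart hU hb x₀ hz.1 hz.2 e).symm
    have hbs := (smoothOn_chart hb x₀).contDiffAt hnh
    have hΦs := (smoothOn_chart hΦ x₀).contDiffAt hnh
    have hdb : ContDiffAt ℝ ∞ (fderiv ℝ (b ∘ φ.symm)) y := hbs.fderiv_right (m := ∞) (by simp)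
    refine ⟨(hΦs.clm_comp hdb).congr_of_eventuallyEq hloc, fun e e' => ?_⟩
    have hd : ∀ e e' : E2, fderiv ℝ (η.inChart x₀) y e e' =
        Φ (φ.symm y) (fderiv ℝ (fderiv ℝ (b ∘ φ.symm)) y e e') +
        fderiv ℝ (Φ ∘ φ.symm) y e (fderiv ℝ (b ∘ φ.symm) y e') := by
      intro e e'
      have h1 := (hΦs.differentiableAt (by simp)).hasFDerivAt.clm_comp
        (hdb.differentiableAt (by simp)).hasFDerivAt
      rw [hloc.fderiv_eq, h1.fderiv]
      rfl
    -- In `dη` the second derivatives of `b` cancel by symmetry, and `dΦ ∧ db` remains.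
    have hsymm : IsSymmSndFDerivAt ℝ (b ∘ φ.symm) y :=
      hbs.isSymmSndFDerivAt (by simp [minSmoothness_of_isRCLikeNormedField]; exact WithTop.coe_le_coe.2 le_top)
    rw [hd, hd, hsymm.eq e e', sub_eq_zero, fderiv_chart hU hb x₀ hy hpU,
      fderiv_chart hU hΦ x₀ hy hpU, fderiv_chart hU hb x₀ hy hpU, fderiv_chart hU hΦ x₀ hy hpU]
    exact congrArg _ (hcl _ hpU _ _)
  exact ⟨fun x₀ y hy => (main x₀ y hy).1.contDiffWithinAt, fun x₀ y hy => (main x₀ y hy).2⟩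

end Calculus

/-! ### Linear algebra in `ℝ^{4,2}` -/

theorem B_apply (x y : R42) : B x y =
    x 0 * y 0 + x 1 * y 1 + x 2 * y 2 + x 3 * y 3 - x 4 * y 4 - x 5 * y 5 := rfl

theorem B_comm (x y : R42) : B x y = B y x := by
  rw [B_apply, B_apply]; ring

/-- The inner product as a continuous bilinear map. -/
def Bc : R42 →L[ℝ] R42 →L[ℝ] ℝ := LinearMap.toContinuousBilinearMap B

theorem Bc_apply (x y : R42) : Bc x y = B x y := rfl

theorem wedge_apply (a b c : R42) : wedge a b c = B a c • b - B b c • a := rfl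

/-- The map `(a, b) ↦ a ∧ b` as a continuous bilinear map. -/
def wedgeC : R42 →L[ℝ] R42 →L[ℝ] (R42 →L[ℝ] R42) :=
  LinearMap.toContinuousBilinearMap (LinearMap.mk₂ ℝ wedge
    (fun a b c => by ext1 v; simp only [wedge_apply, add_apply, map_add,
      LinearMap.add_apply]; module)
    (fun t a b => by ext1 v; simp only [wedge_apply, smul_apply, map_smul,
      LinearMap.smul_apply, smul_eq_mul]; module)
    (fun a b c => by ext1 v; simp only [wedge_apply, add_apply, map_add,
      LinearMap.add_apply]; module)
    (fun t a b => by ext1 v; simp only [wedge_apply, smul_apply, map_smul,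
      LinearMap.smul_apply, smul_eq_mul]; module))

theorem mem_perp {V : Submodule ℝ R42} {w : R42} : w ∈ perp V ↔ ∀ v ∈ V, B v w = 0 := Iff.rfl

theorem mem_perp_span_pair {a b w : R42} :
    w ∈ perp (Submodule.span ℝ {a, b}) ↔ B w a = 0 ∧ B w b = 0 := by
  rw [mem_perp]
  constructor
  · intro h
    exact ⟨by rw [B_comm]; exact h a (Submodule.subset_span (by simp)),
      by rw [B_comm]; exact h b (Submodule.subset_span (by simp))⟩
  · rintro ⟨h1, h2⟩ v hv
    obtain ⟨c, d, rfl⟩ := Submodule.mem_span_pair.1 hv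
    rw [B_comm, map_add, map_smul, map_smul, h1, h2]; simp

theorem mem_perp_span_singleton {a w : R42} :
    w ∈ perp (Submodule.span ℝ {a}) ↔ B w a = 0 := by
  have := mem_perp_span_pair (a := a) (b := a) (w := w)
  simpa using this

/-- Used to push a combination of given vectors into a definite coordinate subspace, where the sign
of its square forces it to vanish. -/
theorem exists_combination_eq_zero {n k : ℕ} (h : k < n) (e : Fin n → R42) (g : Fin k → Fin 6) :
    ∃ c : Fin n → ℝ, c ≠ 0 ∧ ∀ j, (∑ i, c i • e i) (g j) = 0 := by
  let T : (Fin n → ℝ) →ₗ[ℝ] (Fin k → ℝ) :=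
    (LinearMap.funLeft ℝ ℝ g) ∘ₗ (Fintype.linearCombination ℝ e)
  have hT : LinearMap.ker T ≠ ⊥ := T.ker_ne_bot_of_finrank_lt (by simpa using h)
  obtain ⟨c, hc, hc0⟩ := Submodule.exists_mem_ne_zero_of_ne_bot hT
  refine ⟨c, hc0, fun j => ?_⟩
  have := congrFun (LinearMap.mem_ker.1 hc) j
  simpa [T, Fintype.linearCombination_apply, LinearMap.funLeft] using this

/-! ### The positive definite plane `f^⊥/f` -/

section Null

variable {a b : R42} (ha : B a a = 0) (hb : B b b = 0) (hab : B a b = 0)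
  (hind : ∀ s t : ℝ, s • a + t • b = 0 → s = 0 ∧ t = 0)
include ha hb hab hind

/-- `f^⊥ / f` is positive definite for a null plane `f`. -/
theorem pos_of_mem_perp_null {v : R42} (hva : B v a = 0) (hvb : B v b = 0)
    (hv : v ∉ Submodule.span ℝ {a, b}) : 0 < B v v := by
  by_contra hneg
  -- Coordinates 4 and 5 are the timelike ones: the combination lies in the spacelike `ℝ⁴`, yet its
  -- square is `c₂² (v, v) ≤ 0`, so it is zero.
  obtain ⟨c, hc, h⟩ := exists_combination_eq_zero (k := 2) (by norm_num) ![a, b, v] ![4, 5]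
  have h4 := h 0
  have h5 := h 1
  set w := ∑ i, c i • ![a, b, v] i with hw
  have hw' : w = c 0 • a + c 1 • b + c 2 • v := by simp [hw, Fin.sum_univ_three]
  have hBw : B w w = c 2 ^ 2 * B v v := by
    rw [hw']
    simp only [map_add, map_smul, LinearMap.add_apply, LinearMap.smul_apply, smul_eq_mul, ha, hb,
      hab, hva, hvb, B_comm a v, B_comm b v, B_comm b a]
    ring
  have hBw' := B_apply w w
  simp only [Matrix.cons_val_zero, Matrix.cons_val_one] at h4 h5
  rw [h4, h5, hBw] at hBw'
  have h6 : c 2 ^ 2 * B v v ≤ 0 := mul_nonpos_of_nonneg_of_nonpos (sq_nonneg _) (not_lt.1 hneg)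
  have w0 : w 0 = 0 := by nlinarith [sq_nonneg (w 0), sq_nonneg (w 1), sq_nonneg (w 2), sq_nonneg (w 3)]
  have w1 : w 1 = 0 := by nlinarith [sq_nonneg (w 0), sq_nonneg (w 1), sq_nonneg (w 2), sq_nonneg (w 3)]
  have w2 : w 2 = 0 := by nlinarith [sq_nonneg (w 0), sq_nonneg (w 1), sq_nonneg (w 2), sq_nonneg (w 3)]
  have w3 : w 3 = 0 := by nlinarith [sq_nonneg (w 0), sq_nonneg (w 1), sq_nonneg (w 2), sq_nonneg (w 3)]
  have hw0 : w = 0 := by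
    ext i; fin_cases i <;> assumption
  by_cases hc2 : c 2 = 0
  · have := hind (c 0) (c 1) (by rw [← hw0, hw', hc2]; simp)
    exact hc (by ext i; fin_cases i; exacts [this.1, this.2, hc2])
  · apply hv
    rw [Submodule.mem_span_pair]
    refine ⟨-(c 0 / c 2), -(c 1 / c 2), ?_⟩
    have : c 2 • v = -(c 0 • a + c 1 • b) := by
      rw [eq_neg_iff_add_eq_zero, add_comm, ← hw', hw0]
    have h8 : v = (c 2)⁻¹ • (c 2 • v) := by rw [smul_smul, inv_mul_cancel₀ hc2, one_smul]
    rw [h8, this, div_eq_inv_mul, div_eq_inv_mul]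
    module

/-- `f^⊥ / f` has dimension at most two for a null plane `f`. -/
theorem mem_of_orthogonal_pair {l m v : R42} (hla : B l a = 0) (hlb : B l b = 0) (hma : B m a = 0)
    (hmb : B m b = 0) (hva : B v a = 0) (hvb : B v b = 0) (hl : 0 < B l l) (hm : 0 < B m m)
    (hlm : B l m = 0) (hvl : B v l = 0) (hvm : B v m = 0) : v ∈ Submodule.span ℝ {a, b} := by
  by_contra hv
  have hvv := pos_of_mem_perp_null ha hb hab hind hva hvb hv
  -- Five vectors and four spacelike coordinates: the combination is timelike or zero, while
  -- orthogonality makes its square a sum of non-negative terms.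
  obtain ⟨c, hc, h⟩ := exists_combination_eq_zero (k := 4) (by norm_num) ![a, b, l, m, v]
    ![0, 1, 2, 3]
  have h0 := h 0
  have h1 := h 1
  have h2 := h 2
  have h3 := h 3
  set w := ∑ i, c i • ![a, b, l, m, v] i with hw
  have hw' : w = c 0 • a + c 1 • b + c 2 • l + c 3 • m + c 4 • v := by
    simp [hw, Fin.sum_univ_five]
  have hBw : B w w = c 2 ^ 2 * B l l + c 3 ^ 2 * B m m + c 4 ^ 2 * B v v := by
    rw [hw']
    simp only [map_add, map_smul, LinearMap.add_apply, LinearMap.smul_apply, smul_eq_mul, ha, hb,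
      hab, hva, hvb, hla, hlb, hma, hmb, hlm, hvl, hvm, B_comm a v, B_comm b v, B_comm b a,
      B_comm a l, B_comm b l, B_comm a m, B_comm b m, B_comm l v, B_comm m v, B_comm m l]
    ring
  have hBw' := B_apply w w
  simp only [Matrix.cons_val_zero, Matrix.cons_val_one, Matrix.cons_val] at h0 h1 h2 h3
  rw [h0, h1, h2, h3, hBw] at hBw'
  have q2 := mul_nonneg (sq_nonneg (c 2)) hl.le
  have q3 := mul_nonneg (sq_nonneg (c 3)) hm.le
  have q4 := mul_nonneg (sq_nonneg (c 4)) hvv.le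
  have w4 : w 4 = 0 := by nlinarith [sq_nonneg (w 4), sq_nonneg (w 5)]
  have w5 : w 5 = 0 := by nlinarith [sq_nonneg (w 4), sq_nonneg (w 5)]
  rw [w4, w5] at hBw'
  have c2 : c 2 = 0 := by
    have : c 2 ^ 2 * B l l = 0 := by linarith
    simpa [hl.ne'] using this
  have c3 : c 3 = 0 := by
    have : c 3 ^ 2 * B m m = 0 := by linarith
    simpa [hm.ne'] using this
  have c4 : c 4 = 0 := by
    have : c 4 ^ 2 * B v v = 0 := by linarith
    simpa [hvv.ne'] using this
  have hw0 : w = 0 := by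
    ext i; fin_cases i <;> assumption
  have := hind (c 0) (c 1) (by rw [← hw0, hw', c2, c3, c4]; simp)
  exact hc (by ext i; fin_cases i; exacts [this.1, this.2, c2, c3, c4])

end Null

/-- The six vectors form a basis of `ℝ^{4,2}` consisting of two dual pairs `(a₁, b₁)`, `(a₂, b₂)`
of null vectors and two unit vectors `l₁`, `l₂`. -/
structure IsNullFrame (a₁ a₂ b₁ b₂ l₁ l₂ : R42) : Prop where
  a₁a₁ : B a₁ a₁ = 0
  a₁a₂ : B a₁ a₂ = 0
  a₂a₂ : B a₂ a₂ = 0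
  b₁b₁ : B b₁ b₁ = 0
  b₁b₂ : B b₁ b₂ = 0
  b₂b₂ : B b₂ b₂ = 0
  a₁b₁ : B a₁ b₁ = 1
  a₁b₂ : B a₁ b₂ = 0
  a₂b₁ : B a₂ b₁ = 0
  a₂b₂ : B a₂ b₂ = 1
  a₁l₁ : B a₁ l₁ = 0
  a₁l₂ : B a₁ l₂ = 0
  a₂l₁ : B a₂ l₁ = 0
  a₂l₂ : B a₂ l₂ = 0
  b₁l₁ : B b₁ l₁ = 0
  b₁l₂ : B b₁ l₂ = 0
  b₂l₁ : B b₂ l₁ = 0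
  b₂l₂ : B b₂ l₂ = 0
  l₁l₁ : B l₁ l₁ = 1
  l₁l₂ : B l₁ l₂ = 0
  l₂l₂ : B l₂ l₂ = 1

namespace IsNullFrame

variable {a₁ a₂ b₁ b₂ l₁ l₂ : R42} (h : IsNullFrame a₁ a₂ b₁ b₂ l₁ l₂)
include h

theorem swap : IsNullFrame a₂ a₁ b₂ b₁ l₂ l₁ :=
  ⟨h.a₂a₂, by rw [B_comm, h.a₁a₂], h.a₁a₁, h.b₂b₂, by rw [B_comm, h.b₁b₂], h.b₁b₁, h.a₂b₂, h.a₂b₁,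
    h.a₁b₂, h.a₁b₁, h.a₂l₂, h.a₂l₁, h.a₁l₂, h.a₁l₁, h.b₂l₂, h.b₂l₁, h.b₁l₂, h.b₁l₁, h.l₂l₂,
    by rw [B_comm, h.l₁l₂], h.l₁l₁⟩

theorem table : B a₁ a₁ = 0 ∧ B a₁ a₂ = 0 ∧ B a₂ a₂ = 0 ∧ B b₁ b₁ = 0 ∧ B b₁ b₂ = 0 ∧ B b₂ b₂ = 0 ∧
    B a₁ b₁ = 1 ∧ B a₁ b₂ = 0 ∧ B a₂ b₁ = 0 ∧ B a₂ b₂ = 1 ∧ B a₁ l₁ = 0 ∧ B a₁ l₂ = 0 ∧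
    B a₂ l₁ = 0 ∧ B a₂ l₂ = 0 ∧ B b₁ l₁ = 0 ∧ B b₁ l₂ = 0 ∧ B b₂ l₁ = 0 ∧ B b₂ l₂ = 0 ∧
    B l₁ l₁ = 1 ∧ B l₁ l₂ = 0 ∧ B l₂ l₂ = 1 ∧
    B a₂ a₁ = 0 ∧ B b₂ b₁ = 0 ∧ B b₁ a₁ = 1 ∧ B b₂ a₁ = 0 ∧ B b₁ a₂ = 0 ∧ B b₂ a₂ = 1 ∧
    B l₁ a₁ = 0 ∧ B l₂ a₁ = 0 ∧ B l₁ a₂ = 0 ∧ B l₂ a₂ = 0 ∧ B l₁ b₁ = 0 ∧ B l₂ b₁ = 0 ∧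
    B l₁ b₂ = 0 ∧ B l₂ b₂ = 0 ∧ B l₂ l₁ = 0 := by
  refine ⟨h.a₁a₁, h.a₁a₂, h.a₂a₂, h.b₁b₁, h.b₁b₂, h.b₂b₂, h.a₁b₁, h.a₁b₂, h.a₂b₁, h.a₂b₂, h.a₁l₁,
    h.a₁l₂, h.a₂l₁, h.a₂l₂, h.b₁l₁, h.b₁l₂, h.b₂l₁, h.b₂l₂, h.l₁l₁, h.l₁l₂, h.l₂l₂, ?_⟩
  refine ⟨?_, ?_, ?_, ?_, ?_, ?_, ?_, ?_, ?_, ?_, ?_, ?_, ?_, ?_, ?_⟩ <;> rw [B_comm]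
  exacts [h.a₁a₂, h.b₁b₂, h.a₁b₁, h.a₁b₂, h.a₂b₁, h.a₂b₂, h.a₁l₁,
    h.a₁l₂, h.a₂l₁, h.a₂l₂, h.b₁l₁, h.b₁l₂, h.b₂l₁, h.b₂l₂, h.l₁l₂]

theorem linearIndependent : LinearIndependent ℝ ![a₁, a₂, b₁, b₂, l₁, l₂] := by
  rw [Fintype.linearIndependent_iff]
  intro g hg
  have hg' : g 0 • a₁ + g 1 • a₂ + g 2 • b₁ + g 3 • b₂ + g 4 • l₁ + g 5 • l₂ = 0 := by
    simpa [Fin.sum_univ_six] using hg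
  have key : ∀ w, g 0 * B w a₁ + g 1 * B w a₂ + g 2 * B w b₁ + g 3 * B w b₂ + g 4 * B w l₁ +
      g 5 * B w l₂ = 0 := by
    intro w
    have := congrArg (B w) hg'
    simpa only [map_add, map_smul, smul_eq_mul, map_zero] using this
  have t := h.table
  intro i
  fin_cases i
  · simpa [t] using key b₁
  · simpa [t] using key b₂
  · simpa [t] using key a₁
  · simpa [t] using key a₂
  · simpa [t] using key l₁
  · simpa [t] using key l₂

theorem expand (v : R42) : v = B v b₁ • a₁ + B v b₂ • a₂ + B v a₁ • b₁ + B v a₂ • b₂ +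
    B v l₁ • l₁ + B v l₂ • l₂ := by
  have hs := h.linearIndependent.span_eq_top_of_card_eq_finrank (by simp)
  let T : R42 →ₗ[ℝ] R42 := (B.flip b₁).smulRight a₁ + (B.flip b₂).smulRight a₂ +
    (B.flip a₁).smulRight b₁ + (B.flip a₂).smulRight b₂ + (B.flip l₁).smulRight l₁ +
    (B.flip l₂).smulRight l₂
  have hT : LinearMap.id = T := by
    refine LinearMap.ext_on hs ?_
    rintro _ ⟨i, rfl⟩
    have t := h.table
    fin_cases i <;> simp [T, t]
  exact LinearMap.congr_fun hT v

theorem mem_plane {v : R42} : v ∈ Submodule.span ℝ {a₁, a₂} ↔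
    B v a₁ = 0 ∧ B v a₂ = 0 ∧ B v l₁ = 0 ∧ B v l₂ = 0 := by
  have t := h.table
  rw [Submodule.mem_span_pair]
  constructor
  · rintro ⟨c, d, rfl⟩
    simp [t]
  · rintro ⟨h1, h2, h3, h4⟩
    exact ⟨B v b₁, B v b₂, by conv_rhs => rw [h.expand v, h1, h2, h3, h4]
                              simp⟩

end IsNullFrame

/-! ### Product rule for the inner product -/

section

variable {M : Type*} [TopologicalSpace M] [ChartedSpace E2 M]

theorem dd_B {u v : M → R42} {x : M} (hu : MDifferentiableAt (𝓡 2) 𝓘(ℝ, R42) u x)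
    (hv : MDifferentiableAt (𝓡 2) 𝓘(ℝ, R42) v x) (Z : TangentSpace (𝓡 2) x) :
    dd (fun y => B (u y) (v y)) x Z = B (u x) (dd v x Z) + B (dd u x Z) (v x) :=
  dd_bilin Bc hu hv Z

/-- Differentiation of a constant inner product. -/
theorem B_dd_eq {u v : M → R42} {x : M} {U : Set M} (hU : IsOpen U) (hx : x ∈ U)
    (hu : SmoothOn u U) (hv : SmoothOn v U) {c : ℝ} (h : ∀ y ∈ U, B (u y) (v y) = c)
    (Z : TangentSpace (𝓡 2) x) : B (dd u x Z) (v x) = -B (u x) (dd v x Z) := by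
  have h1 := dd_B (hu.mdifferentiableAt hU hx) (hv.mdifferentiableAt hU hx) Z
  rw [dd_congr (h := fun _ => c) (by filter_upwards [hU.mem_nhds hx] with y hy using h y hy),
    dd_const] at h1
  have h2 : (0 : ℝ) = B (u x) (dd v x Z) + B (dd u x Z) (v x) := h1
  linarith

theorem SmoothOn.B {u v : M → R42} {U : Set M} (hu : SmoothOn u U) (hv : SmoothOn v U) :
    SmoothOn (fun y => LieSphere.B (u y) (v y)) U := hu.bilin Bc hv

end

/-! ### Curvature line frames -/

section

variable {M : Type*} [TopologicalSpace M] [ChartedSpace E2 M]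

theorem IsUmbilicFree.swap {f s₁ s₂ : Family42 M} (h : IsUmbilicFree f s₁ s₂) :
    IsUmbilicFree f s₂ s₁ :=
  ⟨h.snd, h.fst, fun x => by rw [inf_comm]; exact h.disjoint x⟩

theorem IsRegularPair.swap {s₁ s₂ : Family42 M} (h : IsRegularPair s₁ s₂) :
    IsRegularPair s₂ s₁ := ⟨h.2, h.1⟩

theorem IsSection.mono {V : Family42 M} {U U' : Set M} {σ : M → R42} (h : IsSection V U σ)
    (hU : U' ⊆ U) : IsSection V U' σ := ⟨h.1.mono hU, fun y hy => h.2 y (hU hy)⟩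

theorem IsSection.sub_const_smul {V : Family42 M} {U : Set M} {σ τ : M → R42}
    (hσ : IsSection V U σ) (hτ : IsSection V U τ) (c : ℝ) :
    IsSection V U (fun y => σ y - c • τ y) :=
  ⟨ContMDiffOn.sub hσ.1 (SmoothOn.linear (c • ContinuousLinearMap.id ℝ R42) hτ.1),
    fun y hy => (V y).sub_mem (hσ.2 y hy) ((V y).smul_mem c (hτ.2 y hy))⟩

theorem dd_sub_const_smul {U : Set M} (hU : IsOpen U) {σ τ : M → R42} (hσ : SmoothOn σ U)
    (hτ : SmoothOn τ U) (c : ℝ) {x : M} (hx : x ∈ U) (Z : TangentSpace (𝓡 2) x) :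
    dd (fun y => σ y - c • τ y) x Z = dd σ x Z - c • dd τ x Z := by
  have h2 := hτ.mdifferentiableAt hU hx
  have h3 : SmoothOn (fun y => c • τ y) U := SmoothOn.linear (c • ContinuousLinearMap.id ℝ R42) hτ
  rw [dd_sub (hσ.mdifferentiableAt hU hx) (h3.mdifferentiableAt hU hx)]
  congr 1
  exact dd_linear (c • ContinuousLinearMap.id ℝ R42) h2 Z

theorem exists_section_span {s : Family42 M} (hs : IsSubbundle 1 s) (x : M) :
    ∃ U : Set M, IsOpen U ∧ x ∈ U ∧ ∃ σ : M → R42, IsSection s U σ ∧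
      ∀ y ∈ U, σ y ≠ 0 ∧ s y = Submodule.span ℝ {σ y} := by
  obtain ⟨U, hU, hx, σ, hσ, h⟩ := hs x
  refine ⟨U, hU, hx, σ 0, hσ 0, fun y hy => ⟨(h y hy).1.ne_zero 0, ?_⟩⟩
  rw [(h y hy).2]
  congr 1
  ext v
  simp [Set.mem_range, Fin.exists_fin_one, eq_comm]

theorem IsSubbundle.finrank_eq {k : ℕ} {V : Family42 M} (hV : IsSubbundle k V) (x : M) :
    Module.finrank ℝ (V x) = k := by
  obtain ⟨U, hU, hx, σ, hσ, h⟩ := hV x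
  rw [(h x hx).2, finrank_span_eq_card (h x hx).1, Fintype.card_fin]

/-- Smoothness of a vector field on a subset. -/
abbrev SmoothField [IsManifold (𝓡 2) ∞ M] (Y : ∀ y : M, TangentSpace (𝓡 2) y) (U : Set M) : Prop :=
  ContMDiffOn (𝓡 2) (𝓡 2).tangent ∞ (fun y => (⟨y, Y y⟩ : TangentBundle (𝓡 2) M)) U

theorem eq_smul_add_smul_of_linearIndependent {x : M} {X Y : TangentSpace (𝓡 2) x}
    (h : LinearIndependent ℝ ![X, Y]) (Z : TangentSpace (𝓡 2) x) : ∃ a b : ℝ, Z = a • X + b • Y := by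
  have : FiniteDimensional ℝ (TangentSpace (𝓡 2) x) := inferInstanceAs (FiniteDimensional ℝ E2)
  have hd : Module.finrank ℝ (TangentSpace (𝓡 2) x) = 2 := finrank_euclideanSpace_fin (𝕜 := ℝ)
  have h1 := h.span_eq_top_of_card_eq_finrank (by rw [hd]; simp)
  have h2 : Z ∈ Submodule.span ℝ (Set.range ![X, Y]) := by rw [h1]; trivial
  rw [Matrix.range_cons_cons_empty, Submodule.mem_span_pair] at h2
  obtain ⟨a, b, h⟩ := h2
  exact ⟨a, b, h.symm⟩

variable [IsManifold (𝓡 2) ∞ M]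

theorem exists_local_frame (x : M) : ∃ (U : Set M) (E₁ E₂ : ∀ y : M, TangentSpace (𝓡 2) y),
    IsOpen U ∧ x ∈ U ∧ SmoothField E₁ U ∧ SmoothField E₂ U ∧
    ∀ y ∈ U, LinearIndependent ℝ ![E₁ y, E₂ y] := by
  have : IsManifold (𝓡 2) (∞ + 1) M := by simpa
  have : ContMDiffVectorBundle ∞ E2 (TangentSpace (𝓡 2) : M → Type _) (𝓡 2) :=
    TangentBundle.contMDiffVectorBundle
  let e := trivializationAt E2 (TangentSpace (𝓡 2) : M → Type _) x
  let b := (EuclideanSpace.basisFun (Fin 2) ℝ).toBasis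
  have h := e.isLocalFrameOn_localFrame_baseSet (𝓡 2) ∞ b
  refine ⟨e.baseSet, e.localFrame b 0, e.localFrame b 1, e.open_baseSet,
    FiberBundle.mem_baseSet_trivializationAt' x, h.contMDiffOn 0, h.contMDiffOn 1, fun y hy => ?_⟩
  have h1 := h.linearIndependent hy
  have e2 : (fun i => e.localFrame b i y) = ![e.localFrame b 0 y, e.localFrame b 1 y] := by
    ext i : 1
    fin_cases i <;> rfl
  rwa [e2] at h1

theorem SmoothField.comb {E₁ E₂ : ∀ y : M, TangentSpace (𝓡 2) y} {U : Set M}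
    (h₁ : SmoothField E₁ U) (h₂ : SmoothField E₂ U) {g₁ g₂ : M → ℝ} (hg₁ : SmoothOn g₁ U)
    (hg₂ : SmoothOn g₂ U) : SmoothField (fun y => g₁ y • E₁ y - g₂ y • E₂ y) U := by
  have : IsManifold (𝓡 2) (∞ + 1) M := by simpa
  have : ContMDiffVectorBundle ∞ E2 (TangentSpace (𝓡 2) : M → Type _) (𝓡 2) :=
    TangentBundle.contMDiffVectorBundle
  exact (hg₁.smul_section h₁).sub_section (hg₂.smul_section h₂)

theorem exists_field_extending (x : M) (Z : TangentSpace (𝓡 2) x) :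
    ∃ (U : Set M) (Y : ∀ y : M, TangentSpace (𝓡 2) y), IsOpen U ∧ x ∈ U ∧ SmoothField Y U ∧
      Y x = Z := by
  obtain ⟨U, E₁, E₂, hU, hx, h₁, h₂, hind⟩ := exists_local_frame x
  obtain ⟨a, b, rfl⟩ := eq_smul_add_smul_of_linearIndependent (hind x hx) Z
  refine ⟨U, fun y => a • E₁ y - (-b) • E₂ y, hU, hx,
    h₁.comb h₂ (g₁ := fun _ => a) (g₂ := fun _ => -b) contMDiffOn_const contMDiffOn_const, ?_⟩
  simp

theorem IsSubbundle.exists_two {f : Family42 M} (hf : IsSubbundle 2 f) (x : M) :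
    ∃ a b : R42, f x = Submodule.span ℝ {a, b} ∧ ∀ s t : ℝ, s • a + t • b = 0 → s = 0 ∧ t = 0 := by
  obtain ⟨U, hU, hx, σ, hσ, h⟩ := hf x
  refine ⟨σ 0 x, σ 1 x, ?_, ?_⟩
  · rw [(h x hx).2]
    congr 1
    ext v
    simp [Set.mem_range, Fin.exists_fin_two, eq_comm]
  · rw [← LinearIndependent.pair_iff]
    have h1 := (h x hx).1
    have e2 : (fun i => σ i x) = ![σ 0 x, σ 1 x] := by
      ext i : 1
      fin_cases i <;> rfl
    rwa [e2] at h1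

theorem IsLegendre.pos {f : Family42 M} (hf : IsLegendre f) {x : M} {v : R42}
    (hv : v ∈ perp (f x)) (hvf : v ∉ f x) : 0 < B v v := by
  obtain ⟨a, b, hab, hind⟩ := hf.subbundle.exists_two x
  have ha : a ∈ f x := by rw [hab]; exact Submodule.subset_span (by simp)
  have hb : b ∈ f x := by rw [hab]; exact Submodule.subset_span (by simp)
  rw [hab] at hvf
  exact pos_of_mem_perp_null (hf.null x a ha a ha) (hf.null x b hb b hb) (hf.null x a ha b hb) hind
    (by rw [B_comm]; exact hv a ha) (by rw [B_comm]; exact hv b hb) hvf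

/-- A section of a Legendre map that vanishes at a point has its differential there in `f`. -/
theorem IsLegendre.dd_mem_of_eq_zero {f : Family42 M} (hf : IsLegendre f) {U : Set M} (hU : IsOpen U)
    {x : M} (hx : x ∈ U) {τ : M → R42} (hτ : IsSection f U τ) (h0 : τ x = 0)
    (Z : TangentSpace (𝓡 2) x) : dd τ x Z ∈ f x := by
  by_contra hcon
  obtain ⟨U', Y, hU', hx', hY, rfl⟩ := exists_field_extending x Z
  have hpos := hf.pos (hf.contact x U τ hU hx hτ (Y x)) hcon
  have hV := hU.inter hU'
  have h1 : SmoothOn τ (U ∩ U') := hτ.1.mono inter_subset_left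
  have h2 := h1.dd_apply hV (hY.mono inter_subset_right)
  -- Differentiating `(τ, d_Y τ) = 0` along `Y` gives `(d_Y τ, d_Y τ) = -(τ, d_Y d_Y τ)`, which
  -- vanishes where `τ` does. This contradicts positivity on `f^⊥/f`.
  have h3 := B_dd_eq hV ⟨hx, hx'⟩ h1 h2 (c := 0)
    (fun y hy => hf.contact y U τ hU hy.1 hτ (Y y) _ (hτ.2 y hy.1)) (Y x)
  rw [h3, h0] at hpos
  simp at hpos

/-- Two sections of `f` with proportional values at `x` differ, after scaling by a constant, by one
that vanishes at `x`, and the differential of the latter lies in `f`. So a single generator tests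
the curvature condition. -/
theorem IsCurvatureSphereCongruence.mem_curvatureSpace_iff {f s : Family42 M} (hf : IsLegendre f)
    {U : Set M} (hU : IsOpen U) {x : M} (hx : x ∈ U) {σ : M → R42} (hσ : IsSection f U σ)
    (hs : s x = Submodule.span ℝ {σ x}) (Z : TangentSpace (𝓡 2) x) :
    Z ∈ curvatureSpace f s x ↔ dd σ x Z ∈ f x := by
  constructor
  · intro h
    exact h U σ hU hx hσ (by rw [hs]; exact Submodule.mem_span_singleton_self _)
  · intro h U' τ hU' hx' hτ hτs
    rw [hs, Submodule.mem_span_singleton] at hτs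
    obtain ⟨c, hc⟩ := hτs
    have hV := hU.inter hU'
    have h1 := hσ.mono (U' := U ∩ U') inter_subset_left
    have h2 := hτ.mono (U' := U ∩ U') inter_subset_right
    have h3 := hf.dd_mem_of_eq_zero hV ⟨hx, hx'⟩ (h2.sub_const_smul h1 c) (by simp [hc]) Z
    rw [dd_sub_const_smul hV h2.1 h1.1 c ⟨hx, hx'⟩ Z] at h3
    have := (f x).add_mem h3 ((f x).smul_mem c h)
    simpa using this

/-- Subtracting a constant multiple of a section of `s₂` brings the value at `x` of any section of
`f` into `s₁`. A common curvature direction therefore maps all sections of `f` into `f`, which the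
immersion condition excludes. -/
theorem curvatureSpace_inf_eq_bot {f s₁ s₂ : Family42 M} (hf : IsLegendre f) {x : M}
    (h2 : IsSubbundle 1 s₂) (hsup : f x ≤ s₁ x ⊔ s₂ x)
    (hs : ∀ x, s₂ x ≤ f x)
    {Z : TangentSpace (𝓡 2) x} (hZ₁ : Z ∈ curvatureSpace f s₁ x) (hZ₂ : Z ∈ curvatureSpace f s₂ x) :
    Z = 0 := by
  refine hf.immersed x Z fun U σ hU hx hσ => ?_
  obtain ⟨U', hU', hx', τ, hτ, hτs⟩ := exists_section_span h2 x
  obtain ⟨a, ha, b, hb, hab⟩ := Submodule.mem_sup.1 (hsup (hσ.2 x hx))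
  rw [(hτs x hx').2, Submodule.mem_span_singleton] at hb
  obtain ⟨c, hc⟩ := hb
  have hV := hU.inter hU'
  have h1 := hσ.mono (U' := U ∩ U') inter_subset_left
  have hτf : IsSection f U' τ := ⟨hτ.1, fun y hy => hs y (hτ.2 y hy)⟩
  have h2 := hτf.mono (U' := U ∩ U') inter_subset_right
  have h3 := hZ₁ (U ∩ U') _ hV ⟨hx, hx'⟩ (h1.sub_const_smul h2 c)
    (by rw [hc, ← hab, add_sub_cancel_right]; exact ha)
  rw [dd_sub_const_smul hV h1.1 h2.1 c ⟨hx, hx'⟩ Z] at h3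
  have h4 := hZ₂ U' τ hU' hx' hτf (hτ.2 x hx')
  have := (f x).add_mem h3 ((f x).smul_mem c h4)
  simpa using this

theorem IsUmbilicFree.eq_sup {f s₁ s₂ : Family42 M} (hf : IsLegendre f) (h : IsUmbilicFree f s₁ s₂)
    (x : M) : f x = s₁ x ⊔ s₂ x := by
  symm
  apply Submodule.eq_of_le_of_finrank_eq (sup_le (h.fst.le x) (h.snd.le x))
  have h1 := Submodule.finrank_sup_add_finrank_inf_eq (s₁ x) (s₂ x)
  rw [h.disjoint x, finrank_bot, h.fst.subbundle.finrank_eq, h.snd.subbundle.finrank_eq] at h1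
  rw [hf.subbundle.finrank_eq]
  exact h1

theorem IsUmbilicFree.inf_curvatureSpace {f s₁ s₂ : Family42 M} (hf : IsLegendre f)
    (h : IsUmbilicFree f s₁ s₂) {x : M} {Z : TangentSpace (𝓡 2) x}
    (hZ₁ : Z ∈ curvatureSpace f s₁ x) (hZ₂ : Z ∈ curvatureSpace f s₂ x) : Z = 0 :=
  curvatureSpace_inf_eq_bot hf h.snd.subbundle (h.eq_sup hf x).le h.snd.le hZ₁ hZ₂

/-- The curvature spaces are locally spanned by smooth vector fields. -/
theorem IsUmbilicFree.exists_field {f s₁ s₂ : Family42 M} (hf : IsLegendre f)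
    (h : IsUmbilicFree f s₁ s₂) (x : M) :
    ∃ (U : Set M) (X : ∀ y : M, TangentSpace (𝓡 2) y), IsOpen U ∧ x ∈ U ∧ SmoothField X U ∧
      ∀ y ∈ U, X y ≠ 0 ∧ curvatureSpace f s₁ y = Submodule.span ℝ {X y} := by
  obtain ⟨U₁, hU₁, hx₁, σ, hσ, hσs⟩ := exists_section_span h.fst.subbundle x
  have hσf : IsSection f U₁ σ := ⟨hσ.1, fun y hy => h.fst.le y (hσ.2 y hy)⟩
  obtain ⟨Y₀, hY₀, hY₀0⟩ := Submodule.exists_mem_ne_zero_of_ne_bot (h.snd.curvature x)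
  obtain ⟨U₂, Y, hU₂, hx₂, hY, hYx⟩ := exists_field_extending x Y₀
  obtain ⟨U₃, E₁, E₂, hU₃, hx₃, hE₁, hE₂, hind⟩ := exists_local_frame x
  have hV := (hU₁.inter hU₂).inter hU₃
  set V := U₁ ∩ U₂ ∩ U₃
  have hVx : x ∈ V := ⟨⟨hx₁, hx₂⟩, hx₃⟩
  have hσV : SmoothOn σ V := hσ.1.mono (fun y hy => hy.1.1)
  have hYV : SmoothField Y V := hY.mono (fun y hy => hy.1.2)
  have hE₁V : SmoothField E₁ V := hE₁.mono (fun y hy => hy.2)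
  have hE₂V : SmoothField E₂ V := hE₂.mono (fun y hy => hy.2)
  have hn := hσV.dd_apply hV hYV
  have hnn := hn.B hn
  have hpos : 0 < B (dd σ x (Y x)) (dd σ x (Y x)) := by
    apply hf.pos (hf.contact x U₁ σ hU₁ hx₁ hσf _)
    intro hcon
    rw [← IsCurvatureSphereCongruence.mem_curvatureSpace_iff (s := s₁) hf hU₁ hx₁ hσf (hσs x hx₁).2,
      hYx] at hcon
    exact hY₀0 (h.inf_curvatureSpace hf hcon hY₀)
  have hopen : IsOpen (V ∩ (fun y => B (dd σ y (Y y)) (dd σ y (Y y))) ⁻¹' Ioi 0) :=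
    hnn.continuousOn.isOpen_inter_preimage hV isOpen_Ioi
  have hg₁ := (hσV.dd_apply hV hE₁V).B hn
  have hg₂ := (hσV.dd_apply hV hE₂V).B hn
  refine ⟨_, fun y => B (dd σ y (E₂ y)) (dd σ y (Y y)) • E₁ y -
    B (dd σ y (E₁ y)) (dd σ y (Y y)) • E₂ y, hopen, ⟨hVx, hpos⟩,
    (hE₁V.comb hE₂V hg₂ hg₁).mono inter_subset_left, fun y hy => ?_⟩
  obtain ⟨hyV, hy⟩ := hy
  have hy : 0 < B (dd σ y (Y y)) (dd σ y (Y y)) := hy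
  have hi := LinearIndependent.pair_iff.1 (hind y hyV.2)
  -- `θ(Z) = (d_Z σ₁, d_Y σ₁)` kills the curvature space, since there `d_Z σ₁` lies in `f`. It is
  -- non-zero because `θ(Y) > 0`, so its kernel is a line, spanned by the smooth field `θ(E₂) E₁ -
  -- θ(E₁) E₂`.
  set θ : TangentSpace (𝓡 2) y → ℝ := fun Z => B (dd σ y Z) (dd σ y (Y y)) with hθ
  have hθadd : ∀ a b : ℝ, θ (a • E₁ y + b • E₂ y) = a * θ (E₁ y) + b * θ (E₂ y) := by
    intro a b
    simp only [hθ, map_add, map_smul, LinearMap.add_apply, LinearMap.smul_apply, smul_eq_mul]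
  change θ (E₂ y) • E₁ y - θ (E₁ y) • E₂ y ≠ 0 ∧
    curvatureSpace f s₁ y = Submodule.span ℝ {θ (E₂ y) • E₁ y - θ (E₁ y) • E₂ y}
  have hker : ∀ Z, θ Z = 0 →
      Z ∈ Submodule.span ℝ {θ (E₂ y) • E₁ y - θ (E₁ y) • E₂ y} := by
    intro Z hZ
    obtain ⟨a, b, rfl⟩ := eq_smul_add_smul_of_linearIndependent (hind y hyV.2) Z
    rw [hθadd] at hZ
    rw [Submodule.mem_span_singleton]
    by_cases h1 : θ (E₁ y) = 0
    · have h2 : θ (E₂ y) ≠ 0 := by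
        intro h2
        obtain ⟨a, b, hab⟩ := eq_smul_add_smul_of_linearIndependent (hind y hyV.2) (Y y)
        have := hθadd a b
        rw [← hab, h1, h2] at this
        have h3 : θ (Y y) = 0 := by simpa using this
        exact hy.ne' h3
      have hb : b = 0 := by simpa [h1, h2] using hZ
      refine ⟨a / θ (E₂ y), ?_⟩
      rw [h1, hb, zero_smul, sub_zero, smul_smul, div_mul_cancel₀ _ h2]; simp
    · refine ⟨-(b / θ (E₁ y)), ?_⟩
      have ha : a = -(b / θ (E₁ y)) * θ (E₂ y) := by
        field_simp
        linarith
      rw [smul_sub, smul_smul, smul_smul, ← ha]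
      have : -(b / θ (E₁ y)) * θ (E₁ y) = -b := by field_simp
      rw [this]; module
  have hle : curvatureSpace f s₁ y ≤ Submodule.span ℝ {θ (E₂ y) • E₁ y - θ (E₁ y) • E₂ y} := by
    intro Z hZ
    apply hker
    have h1 := hZ U₁ σ hU₁ hyV.1.1 hσf (hσ.2 y hyV.1.1)
    exact hf.contact y U₁ σ hU₁ hyV.1.1 hσf (Y y) _ h1
  obtain ⟨Z, hZ, hZ0⟩ := Submodule.exists_mem_ne_zero_of_ne_bot (h.fst.curvature y)
  obtain ⟨c, hc⟩ := Submodule.mem_span_singleton.1 (hle hZ)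
  have hc0 : c ≠ 0 := by rintro rfl; exact hZ0 (by rw [← hc, zero_smul])
  refine ⟨fun h0 => hZ0 (by rw [← hc, h0, smul_zero]), le_antisymm hle ?_⟩
  rw [Submodule.span_singleton_le_iff_mem]
  have := (curvatureSpace f s₁ y).smul_mem c⁻¹ hZ
  rwa [← hc, smul_smul, inv_mul_cancel₀ hc0, one_smul] at this

/-- Local generators of the curvature sphere congruences and of the curvature spaces. -/
structure IsCurvatureFrame (f s₁ s₂ : Family42 M) (U : Set M) (σ₁ σ₂ : M → R42)
    (X Y : ∀ y : M, TangentSpace (𝓡 2) y) : Prop where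
  isOpen : IsOpen U
  smooth₁ : SmoothOn σ₁ U
  smooth₂ : SmoothOn σ₂ U
  smoothX : SmoothField X U
  smoothY : SmoothField Y U
  ne₁ : ∀ y ∈ U, σ₁ y ≠ 0
  ne₂ : ∀ y ∈ U, σ₂ y ≠ 0
  eq₁ : ∀ y ∈ U, s₁ y = Submodule.span ℝ {σ₁ y}
  eq₂ : ∀ y ∈ U, s₂ y = Submodule.span ℝ {σ₂ y}
  neX : ∀ y ∈ U, X y ≠ 0
  neY : ∀ y ∈ U, Y y ≠ 0
  eqX : ∀ y ∈ U, curvatureSpace f s₁ y = Submodule.span ℝ {X y}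
  eqY : ∀ y ∈ U, curvatureSpace f s₂ y = Submodule.span ℝ {Y y}

theorem IsCurvatureFrame.swap {f s₁ s₂ : Family42 M} {U : Set M} {σ₁ σ₂ : M → R42}
    {X Y : ∀ y : M, TangentSpace (𝓡 2) y} (h : IsCurvatureFrame f s₁ s₂ U σ₁ σ₂ X Y) :
    IsCurvatureFrame f s₂ s₁ U σ₂ σ₁ Y X :=
  ⟨h.isOpen, h.smooth₂, h.smooth₁, h.smoothY, h.smoothX, h.ne₂, h.ne₁, h.eq₂, h.eq₁, h.neY, h.neX,
    h.eqY, h.eqX⟩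

theorem IsUmbilicFree.exists_curvatureFrame {f s₁ s₂ : Family42 M} (hf : IsLegendre f)
    (h : IsUmbilicFree f s₁ s₂) (x : M) : ∃ (U : Set M) (σ₁ σ₂ : M → R42)
      (X Y : ∀ y : M, TangentSpace (𝓡 2) y), x ∈ U ∧ IsCurvatureFrame f s₁ s₂ U σ₁ σ₂ X Y := by
  obtain ⟨U₁, hU₁, hx₁, σ₁, hσ₁, h₁⟩ := exists_section_span h.fst.subbundle x
  obtain ⟨U₂, hU₂, hx₂, σ₂, hσ₂, h₂⟩ := exists_section_span h.snd.subbundle x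
  obtain ⟨U₃, X, hU₃, hx₃, hX, h₃⟩ := h.exists_field hf x
  obtain ⟨U₄, Y, hU₄, hx₄, hY, h₄⟩ := h.swap.exists_field hf x
  refine ⟨(U₁ ∩ U₂) ∩ (U₃ ∩ U₄), σ₁, σ₂, X, Y, ⟨⟨hx₁, hx₂⟩, ⟨hx₃, hx₄⟩⟩,
    (hU₁.inter hU₂).inter (hU₃.inter hU₄), hσ₁.1.mono fun y hy => hy.1.1,
    hσ₂.1.mono fun y hy => hy.1.2, hX.mono fun y hy => hy.2.1, hY.mono fun y hy => hy.2.2,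
    fun y hy => (h₁ y hy.1.1).1, fun y hy => (h₂ y hy.1.2).1, fun y hy => (h₁ y hy.1.1).2,
    fun y hy => (h₂ y hy.1.2).2, fun y hy => (h₃ y hy.2.1).1, fun y hy => (h₄ y hy.2.2).1,
    fun y hy => (h₃ y hy.2.1).2, fun y hy => (h₄ y hy.2.2).2⟩

end

/-! ### First-order identities for curvature frames, and normals from spherical curvature lines -/

section

variable {M : Type*} [TopologicalSpace M] [ChartedSpace E2 M] [IsManifold (𝓡 2) ∞ M]

namespace IsCurvatureFrame

variable {f s₁ s₂ : Family42 M} {U : Set M} {σ₁ σ₂ : M → R42} {X Y : ∀ y : M, TangentSpace (𝓡 2) y}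
  (hF : IsCurvatureFrame f s₁ s₂ U σ₁ σ₂ X Y) (hf : IsLegendre f) (hu : IsUmbilicFree f s₁ s₂)

section
include hF hu

theorem section₁ : IsSection f U σ₁ :=
  ⟨hF.smooth₁, fun y hy => hu.fst.le y (by rw [hF.eq₁ y hy]; exact Submodule.mem_span_singleton_self _)⟩

theorem section₂ : IsSection f U σ₂ := hF.swap.section₁ hu.swap

end

section
include hF hf hu

theorem f_eq {y : M} (hy : y ∈ U) : f y = Submodule.span ℝ {σ₁ y, σ₂ y} := by
  rw [hu.eq_sup hf, hF.eq₁ y hy, hF.eq₂ y hy, Submodule.span_insert]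

theorem indep {y : M} (hy : y ∈ U) (s t : ℝ) (h : s • σ₁ y + t • σ₂ y = 0) : s = 0 ∧ t = 0 := by
  have h1 : s • σ₁ y ∈ s₁ y := by
    rw [hF.eq₁ y hy]; exact Submodule.smul_mem _ _ (Submodule.mem_span_singleton_self _)
  have h2 : s • σ₁ y ∈ s₂ y := by
    rw [eq_neg_of_add_eq_zero_left h, hF.eq₂ y hy]
    exact Submodule.neg_mem _ (Submodule.smul_mem _ _ (Submodule.mem_span_singleton_self _))
  have h3 : s • σ₁ y = 0 := by
    have : s • σ₁ y ∈ s₁ y ⊓ s₂ y := ⟨h1, h2⟩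
    rwa [hu.disjoint y, Submodule.mem_bot] at this
  rw [h3, zero_add] at h
  exact ⟨(smul_eq_zero.1 h3).resolve_right (hF.ne₁ y hy),
    (smul_eq_zero.1 h).resolve_right (hF.ne₂ y hy)⟩

theorem null {y : M} (hy : y ∈ U) :
    B (σ₁ y) (σ₁ y) = 0 ∧ B (σ₁ y) (σ₂ y) = 0 ∧ B (σ₂ y) (σ₂ y) = 0 :=
  have h1 := (hF.section₁ hu).2 y hy
  have h2 := (hF.section₂ hu).2 y hy
  ⟨hf.null y _ h1 _ h1, hf.null y _ h1 _ h2, hf.null y _ h2 _ h2⟩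

theorem mem_perp_iff {y : M} (hy : y ∈ U) {v : R42} :
    v ∈ perp (f y) ↔ B v (σ₁ y) = 0 ∧ B v (σ₂ y) = 0 := by
  rw [hF.f_eq hf hu hy, mem_perp_span_pair]

theorem contact₁ {y : M} (hy : y ∈ U) (Z : TangentSpace (𝓡 2) y) :
    B (dd σ₁ y Z) (σ₁ y) = 0 ∧ B (dd σ₁ y Z) (σ₂ y) = 0 :=
  (hF.mem_perp_iff hf hu hy).1 (hf.contact y U σ₁ hF.isOpen hy (hF.section₁ hu) Z)

theorem contact₂ {y : M} (hy : y ∈ U) (Z : TangentSpace (𝓡 2) y) :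
    B (dd σ₂ y Z) (σ₁ y) = 0 ∧ B (dd σ₂ y Z) (σ₂ y) = 0 :=
  (hF.mem_perp_iff hf hu hy).1 (hf.contact y U σ₂ hF.isOpen hy (hF.section₂ hu) Z)

theorem mem_X_iff {y : M} (hy : y ∈ U) (Z : TangentSpace (𝓡 2) y) :
    Z ∈ curvatureSpace f s₁ y ↔ dd σ₁ y Z ∈ f y :=
  IsCurvatureSphereCongruence.mem_curvatureSpace_iff hf hF.isOpen hy (hF.section₁ hu) (hF.eq₁ y hy) Z

theorem X_mem {y : M} (hy : y ∈ U) : X y ∈ curvatureSpace f s₁ y := by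
  rw [hF.eqX y hy]; exact Submodule.mem_span_singleton_self _

theorem Y_mem {y : M} (hy : y ∈ U) : Y y ∈ curvatureSpace f s₂ y := by
  rw [hF.eqY y hy]; exact Submodule.mem_span_singleton_self _

theorem Y_notMem {y : M} (hy : y ∈ U) : Y y ∉ curvatureSpace f s₁ y := fun h =>
  hF.neY y hy (hu.inf_curvatureSpace hf h (hF.Y_mem hf hu hy))

theorem exists_eq {y : M} (hy : y ∈ U) (Z : TangentSpace (𝓡 2) y) :
    ∃ a b : ℝ, Z = a • X y + b • Y y := by
  apply eq_smul_add_smul_of_linearIndependent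
  rw [LinearIndependent.pair_iff]
  intro s t h
  have hs : s • X y = 0 := by
    apply hu.inf_curvatureSpace hf (Submodule.smul_mem _ _ (hF.X_mem hf hu hy))
    rw [eq_neg_of_add_eq_zero_left h]
    exact Submodule.neg_mem _ (Submodule.smul_mem _ _ (hF.Y_mem hf hu hy))
  rw [hs, zero_add] at h
  exact ⟨(smul_eq_zero.1 hs).resolve_right (hF.neX y hy),
    (smul_eq_zero.1 h).resolve_right (hF.neY y hy)⟩

theorem dd_Y_pos {y : M} (hy : y ∈ U) : 0 < B (dd σ₁ y (Y y)) (dd σ₁ y (Y y)) := by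
  apply hf.pos (hf.contact y U σ₁ hF.isOpen hy (hF.section₁ hu) _)
  rw [← hF.mem_X_iff hf hu hy]
  exact hF.Y_notMem hf hu hy

/-- Since `(σ₁, dσ₂) = 0`, the pairing `(dσ₁, dσ₂)` is symmetric. Exchanging `X` and `Y` leaves a
vector of `f` paired with one of `f^⊥`. Together with `dd_Y_pos` this makes `d_Y σ₁`, `d_X σ₂` an
orthogonal basis of `f^⊥/f`. -/
theorem B_dd_dd {y : M} (hy : y ∈ U) : B (dd σ₁ y (Y y)) (dd σ₂ y (X y)) = 0 := by
  have h := bilin_dd_symm Bc hF.isOpen hF.smooth₁ hF.smooth₂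
    (fun z hz Z => by rw [Bc_apply, B_comm]; exact (hF.contact₂ hf hu hz Z).1) hy (Y y) (X y)
  rw [Bc_apply, Bc_apply] at h
  rw [h]
  have h1 := (hF.mem_X_iff hf hu hy (X y)).1 (hF.X_mem hf hu hy)
  exact hf.contact y U σ₂ hF.isOpen hy (hF.section₂ hu) _ _ h1

/-- This is where regularity enters: if `β = 0`, then `X` would differentiate every section of `s₁`
into `s₁`, against the immersion condition. -/
theorem dd_X_eq (hr : IsRegularPair s₁ s₂) {y : M} (hy : y ∈ U) :
    ∃ α β : ℝ, dd σ₁ y (X y) = α • σ₁ y + β • σ₂ y ∧ β ≠ 0 := by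
  have h1 := (hF.mem_X_iff hf hu hy (X y)).1 (hF.X_mem hf hu hy)
  rw [hF.f_eq hf hu hy, Submodule.mem_span_pair] at h1
  obtain ⟨α, β, h⟩ := h1
  refine ⟨α, β, h.symm, ?_⟩
  rintro rfl
  rw [zero_smul, add_zero] at h
  apply hF.neX y hy
  refine hr.1 y (X y) fun V τ hV hyV hτ => ?_
  have hne := hF.ne₁ y hy
  obtain ⟨i, hi⟩ : ∃ i, σ₁ y i ≠ 0 := by
    by_contra! hcon
    exact hne (funext hcon)
  let lam : R42 →L[ℝ] ℝ := ContinuousLinearMap.proj i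
  let L : ℝ →L[ℝ] R42 →L[ℝ] R42 := ContinuousLinearMap.lsmul ℝ ℝ
  have hW := hF.isOpen.inter hV
  have a1 := hF.smooth₁.mdifferentiableAt hF.isOpen hy
  have a2 := (SmoothOn.linear lam hF.smooth₁).mdifferentiableAt hF.isOpen hy
  have b1 := SmoothOn.mdifferentiableAt hτ.1 hV hyV
  have b2 := (SmoothOn.linear lam hτ.1).mdifferentiableAt hV hyV
  -- For sections of a line bundle `λ(σ₁) τ = λ(τ) σ₁`. The coordinate `λ` is chosen with `λ(σ₁) ≠
  -- 0` at the point, so differentiating this identity recovers `d_X τ`.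
  have e : (fun z => L (lam (σ₁ z)) (τ z)) =ᶠ[𝓝 y] fun z => L (lam (τ z)) (σ₁ z) := by
    filter_upwards [hW.mem_nhds ⟨hy, hyV⟩] with z hz
    have h2 := hτ.2 z hz.2
    rw [hF.eq₁ z hz.1, Submodule.mem_span_singleton] at h2
    obtain ⟨c, hc⟩ := h2
    simp only [L, lam, ← hc, ContinuousLinearMap.lsmul_apply, map_smul, smul_smul, smul_eq_mul]
  have e2 := congrArg (fun T : TangentSpace (𝓡 2) y →L[ℝ] R42 => T (X y)) (dd_congr e)
  rw [dd_bilin L a2 b1, dd_bilin L b2 a1, dd_linear lam a1, dd_linear lam b1, ← h] at e2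
  have hs : σ₁ y ∈ s₁ y := by rw [hF.eq₁ y hy]; exact Submodule.mem_span_singleton_self _
  have hmem : lam (σ₁ y) • dd τ y (X y) ∈ s₁ y := by
    have e3 : lam (σ₁ y) • dd τ y (X y) = (lam (τ y) * α) • σ₁ y + lam (dd τ y (X y)) • σ₁ y -
        (lam (α • σ₁ y)) • τ y := by
      rw [eq_sub_iff_add_eq, mul_smul]
      exact e2
    rw [e3]
    exact sub_mem (add_mem ((s₁ y).smul_mem _ hs) ((s₁ y).smul_mem _ hs))
      ((s₁ y).smul_mem _ (hτ.2 y hyV))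
  have := (s₁ y).smul_mem (lam (σ₁ y))⁻¹ hmem
  rwa [smul_smul, inv_mul_cancel₀ (show lam (σ₁ y) ≠ 0 from hi), one_smul] at this

/-- A vector field along `f`, orthogonal to `f` and constant along the curvature lines of the first
family, does not lie in `f` unless it vanishes. -/
theorem notMem_of_dd_eq_zero (hr : IsRegularPair s₁ s₂) {l : M → R42} (hl : SmoothOn l U)
    (hperp : ∀ y ∈ U, l y ∈ perp (f y)) (hX : ∀ y ∈ U, dd l y (X y) = 0) {x : M} (hx : x ∈ U)
    (hlx : l x ≠ 0) : l x ∉ f x := by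
  intro hmem
  have hU := hF.isOpen
  rw [hF.f_eq hf hu hx, Submodule.mem_span_pair] at hmem
  obtain ⟨a, a', ha⟩ := hmem
  have hw := hF.smooth₂.dd_apply hU hF.smoothX
  have hw' := hw.dd_apply hU hF.smoothX
  set w := fun y => dd σ₂ y (X y) with hw_def
  set w' := fun y => dd w y (X y) with hw'_def
  -- As `d_X l = 0`, orthogonality to `σ₂` passes to its successive `X`-derivatives. Those of order
  -- two and three pair with `σ₂` and `σ₁` in a triangular way, with entries `-(w, w)` and `β (w,
  -- w)`, so both coefficients of `l x` vanish.
  have l2 : ∀ y ∈ U, B (l y) (w y) = 0 := fun y hy => by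
    have := B_dd_eq hU hy hl hF.smooth₂ (c := 0)
      (fun z hz => ((hF.mem_perp_iff hf hu hz).1 (hperp z hz)).2) (X y)
    rw [hX y hy, map_zero, LinearMap.zero_apply] at this
    linarith
  have l3 : ∀ y ∈ U, B (l y) (w' y) = 0 := fun y hy => by
    have := B_dd_eq hU hy hl hw l2 (X y)
    rw [hX y hy, map_zero, LinearMap.zero_apply] at this
    linarith
  have l4 : B (l x) (dd w' x (X x)) = 0 := by
    have := B_dd_eq hU hx hl hw' l3 (X x)
    rw [hX x hx, map_zero, LinearMap.zero_apply] at this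
    linarith
  have s2 : ∀ y ∈ U, B (σ₁ y) (w y) = 0 ∧ B (σ₂ y) (w y) = 0 := fun y hy => by
    rw [B_comm, B_comm (σ₂ y)]; exact hF.contact₂ hf hu hy (X y)
  have s3 : ∀ y ∈ U, B (σ₁ y) (w' y) = 0 := fun y hy => by
    have h1 := B_dd_eq hU hy hF.smooth₁ hw (fun z hz => (s2 z hz).1) (X y)
    obtain ⟨α, β, h, -⟩ := hF.dd_X_eq hf hu hr hy
    rw [h] at h1
    simp only [map_add, map_smul, LinearMap.add_apply, LinearMap.smul_apply, smul_eq_mul, s2 y hy]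
      at h1
    have h2 : -B (σ₁ y) (w' y) = 0 := by
      refine Eq.trans h1.symm ?_
      ring
    exact neg_eq_zero.1 h2
  have t3 : B (σ₂ x) (w' x) = - B (w x) (w x) := by
    have h1 := B_dd_eq hU hx hF.smooth₂ hw (fun z hz => (s2 z hz).2) (X x)
    change B (w x) (w x) = -B (σ₂ x) (w' x) at h1
    linarith
  have hpos : 0 < B (w x) (w x) := hF.swap.dd_Y_pos hf hu.swap hx
  have ha'0 : a' = 0 := by
    have := l3 x hx
    rw [← ha] at this
    simp only [map_add, map_smul, LinearMap.add_apply, LinearMap.smul_apply, smul_eq_mul, s3 x hx, t3]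
      at this
    have h2 : a' * B (w x) (w x) = 0 := by linarith
    exact (mul_eq_zero.1 h2).resolve_right hpos.ne'
  have ha0 : a = 0 := by
    obtain ⟨α, β, h, hβ⟩ := hF.dd_X_eq hf hu hr hx
    have h1 := B_dd_eq hU hx hF.smooth₁ hw' s3 (X x)
    rw [h] at h1
    simp only [map_add, map_smul, LinearMap.add_apply, LinearMap.smul_apply, smul_eq_mul, s3 x hx, t3]
      at h1
    rw [← ha, ha'0] at l4
    simp only [map_add, map_smul, LinearMap.add_apply, LinearMap.smul_apply, smul_eq_mul, zero_mul,
      add_zero] at l4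
    have h2 : B (σ₁ x) (dd w' x (X x)) = β * B (w x) (w x) := by linarith
    rw [h2] at l4
    exact (mul_eq_zero.1 l4).resolve_right (mul_ne_zero hβ hpos.ne')
  apply hlx
  rw [← ha, ha0, ha'0]; simp

end

end IsCurvatureFrame

/-- The factor is `g = (l, l)^{-1/2}`. Wherever `dl` vanishes so does `d(l, l)`, and then `g² (l, l)
= 1` gives `dg = 0`; normalising thus preserves constancy. -/
theorem exists_unit_of_pos {l : M → R42} (hl : SmoothOn l univ) (hpos : ∀ x, 0 < B (l x) (l x)) :
    ∃ g : M → ℝ, SmoothOn (fun x => g x • l x) univ ∧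
      (∀ x, B (g x • l x) (g x • l x) = 1) ∧
      ∀ x Z, dd l x Z = 0 → dd (fun x => g x • l x) x Z = 0 := by
  let h : M → ℝ := fun x => B (l x) (l x)
  have hh : SmoothOn h univ := hl.B hl
  let g : M → ℝ := fun x => (Real.sqrt (h x))⁻¹
  have hc : ContDiffOn ℝ ∞ (fun t : ℝ => (Real.sqrt t)⁻¹) (Ioi 0) := by
    refine ContDiffOn.inv (fun t ht => ?_) (fun t ht => (Real.sqrt_pos.2 ht).ne')
    exact (Real.contDiffAt_sqrt (ne_of_gt ht)).contDiffWithinAt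
  have hg : SmoothOn g univ := hc.contMDiffOn.comp hh (fun x _ => hpos x)
  have hgh : ∀ x, g x * g x * h x = 1 := fun x => by
    have := Real.mul_self_sqrt (hpos x).le
    have h2 := (Real.sqrt_pos.2 (hpos x)).ne'
    simp only [g, h]
    rw [← mul_inv, this, inv_mul_cancel₀ (hpos x).ne']
  let L : ℝ →L[ℝ] R42 →L[ℝ] R42 := ContinuousLinearMap.lsmul ℝ ℝ
  refine ⟨g, hg.bilin L hl, fun x => ?_, fun x Z hZ => ?_⟩
  · rw [map_smul, map_smul, LinearMap.smul_apply, smul_eq_mul, smul_eq_mul, ← mul_assoc]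
    exact hgh x
  · have lx := hl.mdifferentiableAt isOpen_univ (mem_univ x)
    have gx := hg.mdifferentiableAt isOpen_univ (mem_univ x)
    have hx := hh.mdifferentiableAt isOpen_univ (mem_univ x)
    have e1 : dd h x Z = 0 := by
      rw [show dd h x Z = _ from dd_B lx lx Z, hZ]; simp
    let m : ℝ →L[ℝ] ℝ →L[ℝ] ℝ := ContinuousLinearMap.mul ℝ ℝ
    have hgg : SmoothOn (fun x => m (g x) (g x)) univ := hg.bilin m hg
    have e2 := dd_bilin m (hgg.mdifferentiableAt isOpen_univ (mem_univ x)) hx Z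
    rw [dd_congr (g := fun y => m (m (g y) (g y)) (h y)) (h := fun _ => (1 : ℝ))
      (Eventually.of_forall hgh), dd_const, e1,
      dd_bilin m gx gx Z] at e2
    have e3 : (0 : ℝ) = g x * g x * 0 + (g x * dd g x Z + dd g x Z * g x) * h x := e2
    have hgx : g x ≠ 0 := by
      intro h0
      have := hgh x
      rw [h0] at this
      simp at this
    have hhx : h x ≠ 0 := (hpos x).ne'
    have e4 : dd g x Z = 0 := by
      have : (g x * h x) * dd g x Z = 0 := by linarith
      exact (mul_eq_zero.1 this).resolve_left (mul_ne_zero hgx hhx)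
    rw [show dd (fun x => g x • l x) x Z = _ from dd_bilin L gx lx Z, hZ, e4]
    simp

/-- If the first family of curvature lines is spherical, then there is a unit normal field of `f`
which is constant along these curvature lines. -/
theorem HasSphericalCurvatureLines.exists_normal {f s₁ s₂ : Family42 M} (hf : IsLegendre f)
    (hu : IsUmbilicFree f s₁ s₂) (hr : IsRegularPair s₁ s₂)
    (hs : HasSphericalCurvatureLines f (curvatureSpace f s₁)) :
    ∃ l : M → R42, SmoothOn l univ ∧ (∀ x, l x ∈ perp (f x)) ∧ (∀ x, B (l x) (l x) = 1) ∧
      ∀ x, ∀ Z ∈ curvatureSpace f s₁ x, dd l x Z = 0 := by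
  obtain ⟨p, hp, ν, hν, hνnull, hνconst, hνp, hνf⟩ := hs
  have hline : ∀ x, ∀ u ∈ ν x, u ≠ 0 → ∀ v ∈ ν x, ∃ c : ℝ, c • u = v := by
    intro x u hu hu0 v hv
    obtain ⟨U, hU, hx, n, hn, hns⟩ := exists_section_span hν x
    rw [(hns x hx).2, Submodule.mem_span_singleton] at hu hv
    obtain ⟨a, rfl⟩ := hu
    obtain ⟨b, rfl⟩ := hv
    have ha : a ≠ 0 := by rintro rfl; exact hu0 (zero_smul _ _)
    exact ⟨b / a, by rw [smul_smul, div_mul_cancel₀ _ ha]⟩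
  -- Otherwise the point sphere map would be all of `f`, and `ν` would be orthogonal to `f`.
  have hpf : ∀ x, p ∉ perp (f x) := by
    intro x hpx
    obtain ⟨U, hU, hx, n, hn, hns⟩ := exists_section_span hν x
    have h1 : n x ∈ ν x ⊓ perp (f x) := by
      refine ⟨hn.2 x hx, fun v hv => ?_⟩
      rw [B_comm]
      refine hνp x ⟨hv, ?_⟩ _ (hn.2 x hx)
      exact mem_perp_span_singleton.2 (hpx v hv)
    rw [hνf x, Submodule.mem_bot] at h1
    exact (hns x hx).1 h1
  -- The functional `(n, ·)` on `f` vanishes on the kernel of `(p, ·)`, so it is a multiple of it,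
  -- non-zero by transversality. The displayed factor makes the two equal.
  have key : ∀ x, ∀ n ∈ ν x, n ≠ 0 → ∀ w ∈ f x, B p w ≠ 0 → B n w ≠ 0 ∧
      (B p w / B n w) • n - p ∈ perp (f x) := by
    intro x n hn hn0 w hw hpw
    have h1 : ∀ v ∈ f x, B n v = B p v / B p w * B n w := by
      intro v hv
      have h2 : v - (B p v / B p w) • w ∈ pointSphereMap f p x := by
        refine ⟨sub_mem hv ((f x).smul_mem _ hw), ?_⟩
        refine mem_perp_span_singleton.2 ?_
        rw [B_comm, map_sub, map_smul, smul_eq_mul, div_mul_cancel₀ _ hpw,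
          sub_self]
      have h3 := hνp x h2 n hn
      rw [map_sub, map_smul, smul_eq_mul] at h3
      linarith
    have h2 : B n w ≠ 0 := by
      intro h0
      have : n ∈ ν x ⊓ perp (f x) := ⟨hn, fun v hv => by rw [B_comm, h1 v hv, h0, mul_zero]⟩
      rw [hνf x, Submodule.mem_bot] at this
      exact hn0 this
    refine ⟨h2, fun v hv => ?_⟩
    rw [B_comm, map_sub, LinearMap.sub_apply, map_smul, LinearMap.smul_apply, smul_eq_mul, h1 v hv]
    field_simp
    ring
  have hlocal : ∀ x, ∃ V : Set M, IsOpen V ∧ x ∈ V ∧ ∃ t : M → R42, SmoothOn t V ∧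
      ∀ y ∈ V, t y ∈ ν y ∧ t y - p ∈ perp (f y) := by
    intro x
    obtain ⟨U, hU, hx, n, hn, hns⟩ := exists_section_span hν x
    obtain ⟨U', σ₁, σ₂, X, Y, hx', hF⟩ := hu.exists_curvatureFrame hf x
    obtain ⟨g, hg, hgx⟩ : ∃ g : M → R42, IsSection f U' g ∧ B p (g x) ≠ 0 := by
      by_contra! hcon
      exact hpf x ((hF.mem_perp_iff hf hu hx').2 ⟨hcon _ (hF.section₁ hu), hcon _ (hF.section₂ hu)⟩)
    have hW := hU.inter hF.isOpen
    have hsm : SmoothOn (fun y => B p (g y)) (U ∩ U') :=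
      (SmoothOn.linear (Bc p) hg.1).mono inter_subset_right
    have hsn : SmoothOn (fun y => B (n y) (g y)) (U ∩ U') :=
      SmoothOn.B (hn.1.mono inter_subset_left) (hg.1.mono inter_subset_right)
    have hopen : IsOpen ((U ∩ U') ∩ (fun y => B p (g y)) ⁻¹' {0}ᶜ) :=
      hsm.continuousOn.isOpen_inter_preimage hW isOpen_compl_singleton
    refine ⟨_, hopen, ⟨⟨hx, hx'⟩, hgx⟩, fun y => (B p (g y) / B (n y) (g y)) • n y, ?_, ?_⟩
    · refine SmoothOn.bilin (ContinuousLinearMap.lsmul ℝ ℝ) (u := fun y => B p (g y) / B (n y) (g y))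
        ?_ (hn.1.mono fun y hy => hy.1.1)
      exact ContMDiffOn.div₀ (hsm.mono inter_subset_left) (hsn.mono inter_subset_left)
        fun y hy => (key y (n y) (hn.2 y hy.1.1) (hns y hy.1.1).1 (g y) (hg.2 y hy.1.2) hy.2).1
    · intro y hy
      exact ⟨(ν y).smul_mem _ (hn.2 y hy.1.1),
        (key y (n y) (hn.2 y hy.1.1) (hns y hy.1.1).1 (g y) (hg.2 y hy.1.2) hy.2).2⟩
  have hex : ∀ x, ∃ t, t ∈ ν x ∧ t - p ∈ perp (f x) := fun x => by
    obtain ⟨V, hV, hx, t, ht, h⟩ := hlocal x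
    exact ⟨t x, h x hx⟩
  choose t htν htp using hex
  have ht : SmoothOn t univ := by
    intro x _
    obtain ⟨V, hV, hx, t', ht', h⟩ := hlocal x
    refine ((ht'.contMDiffAt (hV.mem_nhds hx)).congr_of_eventuallyEq ?_).contMDiffWithinAt
    filter_upwards [hV.mem_nhds hx] with y hy
    -- Transversality makes `t` unique, so the pointwise choice agrees with the smooth local ones.
    have h1 : t y - t' y ∈ ν y ⊓ perp (f y) := by
      refine ⟨sub_mem (htν y) (h y hy).1, ?_⟩
      have := sub_mem (htp y) (h y hy).2
      rwa [sub_sub_sub_cancel_right] at this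
    rw [hνf y, Submodule.mem_bot] at h1
    exact sub_eq_zero.1 h1
  have ht0 : ∀ x, t x ≠ 0 := by
    intro x h0
    have := htp x
    rw [h0, zero_sub] at this
    exact hpf x (by simpa using (perp (f x)).neg_mem this)
  have hl : SmoothOn (fun x => t x - p) univ := ContMDiffOn.sub ht contMDiffOn_const
  have hdl : ∀ x Z, dd (fun x => t x - p) x Z = dd t x Z := by
    intro x Z
    rw [dd_sub (ht.mdifferentiableAt isOpen_univ (mem_univ x)) mdifferentiableAt_const, dd_const]
    simp
  have hdt : ∀ x, ∀ Z ∈ curvatureSpace f s₁ x, dd t x Z = 0 := by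
    intro x Z hZ
    obtain ⟨U, σ₁, σ₂, X, Y, hx, hF⟩ := hu.exists_curvatureFrame hf x
    have hU := hF.isOpen
    suffices hX : dd t x (X x) = 0 by
      rw [hF.eqX x hx, Submodule.mem_span_singleton] at hZ
      obtain ⟨c, rfl⟩ := hZ
      rw [map_smul, hX, smul_zero]
    -- If `d_X t ≠ 0`, it spans `ν` nearby. As `(d_X t, σ₁) = -(l, d_X σ₁) = 0`, also `(t, σ₁) = 0`,
    -- and so `(p, σ₁) = 0` on an open set. Differentiating along `X` with `β ≠ 0` gives `(p, σ₂) =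
    -- 0`, contrary to `hpf`.
    by_contra hne
    have htU : SmoothOn t U := ht.mono (subset_univ U)
    have hs := htU.dd_apply hU hF.smoothX
    have hopen : IsOpen (U ∩ (fun y => dd t y (X y)) ⁻¹' {0}ᶜ) :=
      hs.continuousOn.isOpen_inter_preimage hU isOpen_compl_singleton
    have hp1 : ∀ y ∈ U ∩ (fun y => dd t y (X y)) ⁻¹' {0}ᶜ, B (σ₁ y) p = 0 := by
      rintro y ⟨hy, hy0⟩
      have h1 := B_dd_eq hU hy (hl.mono (subset_univ U)) hF.smooth₁ (c := 0)
        (fun z hz => ((hF.mem_perp_iff hf hu hz).1 (htp z)).1) (X y)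
      have hX1 := (hF.mem_X_iff hf hu hy (X y)).1 (hF.X_mem hf hu hy)
      rw [hdl, B_comm (t y - p), htp y _ hX1, neg_zero] at h1
      have h2 := hνconst y univ t isOpen_univ (mem_univ y) ⟨ht, fun z _ => htν z⟩ (X y)
        (hF.X_mem hf hu hy)
      obtain ⟨c, hc⟩ := hline y _ h2 hy0 (t y) (htν y)
      have h3 : B (t y) (σ₁ y) = 0 := by rw [← hc, map_smul, LinearMap.smul_apply, h1, smul_zero]
      have h4 := htp y (σ₁ y) ((hF.section₁ hu).2 y hy)
      rw [map_sub, B_comm, h3] at h4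
      linarith
    have h5 := B_dd_eq hopen ⟨hx, hne⟩ (hF.smooth₁.mono inter_subset_left)
      (contMDiffOn_const (c := p)) hp1 (X x)
    rw [dd_const] at h5
    obtain ⟨α, β, h, hβ⟩ := hF.dd_X_eq hf hu hr hx
    have h6 := hp1 x ⟨hx, hne⟩
    rw [h] at h5
    have h7 : β * B (σ₂ x) p = 0 := by simpa [h6] using h5
    apply hpf x
    rw [hF.mem_perp_iff hf hu hx, B_comm, B_comm p]
    exact ⟨h6, (mul_eq_zero.1 h7).resolve_left hβ⟩
  -- `t` is null and `p` is timelike.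
  have hlne : ∀ x, t x - p ≠ 0 := by
    intro x h0
    have h1 := hνnull x _ (htν x) _ (htν x)
    rw [sub_eq_zero.1 h0] at h1
    linarith
  have hpos : ∀ x, 0 < B (t x - p) (t x - p) := by
    intro x
    obtain ⟨U, σ₁, σ₂, X, Y, hx, hF⟩ := hu.exists_curvatureFrame hf x
    exact hf.pos (htp x) (hF.notMem_of_dd_eq_zero hf hu hr (hl.mono (subset_univ U))
      (fun y _ => htp y) (fun y hy => by rw [hdl]; exact hdt y _ (hF.X_mem hf hu hy)) hx (hlne x))
  obtain ⟨g, hg1, hg2, hg3⟩ := exists_unit_of_pos hl hpos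
  refine ⟨_, hg1, fun x => (perp (f x)).smul_mem _ (htp x), hg2, fun x Z hZ => hg3 x Z ?_⟩
  rw [hdl, hdt x Z hZ]

end

/-! ### Unit normals and the adapted frame -/

section

variable {M : Type*} [TopologicalSpace M] [ChartedSpace E2 M] [IsManifold (𝓡 2) ∞ M]

/-- Unit normal fields of `f` that are constant along the respective curvature lines. -/
structure IsNormalPair (f s₁ s₂ : Family42 M) (l₁ l₂ : M → R42) : Prop where
  smooth₁ : SmoothOn l₁ univ
  smooth₂ : SmoothOn l₂ univ
  perp₁ : ∀ x, l₁ x ∈ perp (f x)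
  perp₂ : ∀ x, l₂ x ∈ perp (f x)
  unit₁ : ∀ x, B (l₁ x) (l₁ x) = 1
  unit₂ : ∀ x, B (l₂ x) (l₂ x) = 1
  const₁ : ∀ x, ∀ Z ∈ curvatureSpace f s₁ x, dd l₁ x Z = 0
  const₂ : ∀ x, ∀ Z ∈ curvatureSpace f s₂ x, dd l₂ x Z = 0

theorem IsNormalPair.swap {f s₁ s₂ : Family42 M} {l₁ l₂ : M → R42}
    (h : IsNormalPair f s₁ s₂ l₁ l₂) : IsNormalPair f s₂ s₁ l₂ l₁ :=
  ⟨h.smooth₂, h.smooth₁, h.perp₂, h.perp₁, h.unit₂, h.unit₁, h.const₂, h.const₁⟩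

namespace IsCurvatureFrame

variable {f s₁ s₂ : Family42 M} {U : Set M} {σ₁ σ₂ : M → R42} {X Y : ∀ y : M, TangentSpace (𝓡 2) y}
  {l₁ l₂ : M → R42}
  (hF : IsCurvatureFrame f s₁ s₂ U σ₁ σ₂ X Y) (hf : IsLegendre f) (hu : IsUmbilicFree f s₁ s₂)
  (hl : IsNormalPair f s₁ s₂ l₁ l₂)
include hF hf hu hl

theorem normal_perp {y : M} (hy : y ∈ U) : B (l₁ y) (σ₁ y) = 0 ∧ B (l₁ y) (σ₂ y) = 0 :=
  (hF.mem_perp_iff hf hu hy).1 (hl.perp₁ y)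

theorem normal_const {y : M} (hy : y ∈ U) : dd l₁ y (X y) = 0 :=
  hl.const₁ y _ (hF.X_mem hf hu hy)

theorem normal_perp_dd {y : M} (hy : y ∈ U) : B (l₁ y) (dd σ₂ y (X y)) = 0 := by
  have h := B_dd_eq hF.isOpen hy (hl.smooth₁.mono (subset_univ U)) hF.smooth₂ (c := 0)
    (fun z hz => (hF.normal_perp hf hu hl hz).2) (X y)
  rw [hF.normal_const hf hu hl hy, map_zero, LinearMap.zero_apply] at h
  linarith

/-- In the orthogonal basis `d_Y σ₁`, `d_X σ₂` of `f^⊥/f`, the normal `l₁` is a multiple of the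
first vector because it is orthogonal to the second. By symmetry `l₂` is orthogonal to the first. -/
theorem normal_orthogonal {y : M} (hy : y ∈ U) : B (l₁ y) (l₂ y) = 0 := by
  obtain ⟨n1, n2, n3⟩ := hF.null hf hu hy
  have p1 := hF.dd_Y_pos hf hu hy
  have p2 := hF.swap.dd_Y_pos hf hu.swap hy
  have o := hF.B_dd_dd hf hu hy
  set w₁ := dd σ₁ y (Y y)
  set w₂ := dd σ₂ y (X y)
  have c1 : B w₁ (σ₁ y) = 0 ∧ B w₁ (σ₂ y) = 0 := hF.contact₁ hf hu hy (Y y)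
  have c2 : B w₂ (σ₁ y) = 0 ∧ B w₂ (σ₂ y) = 0 := hF.contact₂ hf hu hy (X y)
  have m1 := hF.normal_perp hf hu hl hy
  have m2 := hF.swap.normal_perp hf hu.swap hl.swap hy
  set c := B (l₁ y) w₁ / B w₁ w₁ with hc
  have hc' : c * B w₁ w₁ = B (l₁ y) w₁ := by rw [hc]; field_simp
  have hmem := mem_of_orthogonal_pair n1 n3 n2 (hF.indep hf hu hy) (l := w₁) (m := w₂)
    (v := l₁ y - c • w₁) c1.1 c1.2 c2.1 c2.2
    (by simp only [map_sub, map_smul, LinearMap.sub_apply, LinearMap.smul_apply, m1, c1]; simp)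
    (by simp only [map_sub, map_smul, LinearMap.sub_apply, LinearMap.smul_apply, m1, c1]; simp)
    p1 p2 o
    (by simp only [map_sub, map_smul, LinearMap.sub_apply, LinearMap.smul_apply, smul_eq_mul]
        rw [hc', sub_self])
    (by simp only [map_sub, map_smul, LinearMap.sub_apply, LinearMap.smul_apply, smul_eq_mul]
        rw [hF.normal_perp_dd hf hu hl hy, o]; simp)
  rw [← hF.f_eq hf hu hy] at hmem
  have h1 := hl.perp₂ y _ hmem
  have h2 := hF.swap.normal_perp_dd hf hu.swap hl.swap hy
  rw [map_sub, LinearMap.sub_apply, map_smul, LinearMap.smul_apply, B_comm w₁, h2] at h1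
  simpa using h1

/-- Otherwise `l₁` would be orthogonal to a basis of `f^⊥/f` and so lie in the null plane `f`. -/
theorem normal_dd_ne {y : M} (hy : y ∈ U) : B (l₁ y) (dd σ₁ y (Y y)) ≠ 0 := by
  intro h0
  obtain ⟨n1, n2, n3⟩ := hF.null hf hu hy
  have c1 := hF.contact₁ hf hu hy (Y y)
  have c2 := hF.contact₂ hf hu hy (X y)
  have m1 := hF.normal_perp hf hu hl hy
  have hmem := mem_of_orthogonal_pair n1 n3 n2 (hF.indep hf hu hy) c1.1 c1.2 c2.1 c2.2 m1.1 m1.2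
    (hF.dd_Y_pos hf hu hy) (hF.swap.dd_Y_pos hf hu.swap hy) (hF.B_dd_dd hf hu hy) h0
    (hF.normal_perp_dd hf hu hl hy)
  rw [← hF.f_eq hf hu hy] at hmem
  have := hf.null y _ hmem _ hmem
  rw [hl.unit₁ y] at this
  exact one_ne_zero this

/-- The derivative of the first normal field along the second family of curvature lines. -/
theorem dd_normal {y : M} (hy : y ∈ U) : B (dd l₁ y (Y y)) (σ₁ y) ≠ 0 ∧
    B (dd l₁ y (Y y)) (σ₂ y) = 0 ∧ B (dd l₁ y (Y y)) (l₁ y) = 0 ∧ B (dd l₁ y (Y y)) (l₂ y) = 0 ∧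
    B (dd l₁ y (Y y)) (dd l₂ y (X y)) = 0 := by
  have hU := hF.isOpen
  have s1 : SmoothOn l₁ U := hl.smooth₁.mono (subset_univ U)
  have s2 : SmoothOn l₂ U := hl.smooth₂.mono (subset_univ U)
  have hcon : ∀ z ∈ U, dd l₂ z (Y z) = 0 := fun z hz => hF.swap.normal_const hf hu.swap hl.swap hz
  -- Along `X` because `l₁` is constant; along `Y` because `l₁ ⊥ l₂` and `l₂` is constant. The
  -- identity in all directions is what the symmetry argument for the last claim needs.
  have h2 : ∀ z ∈ U, ∀ Z, B (dd l₁ z Z) (l₂ z) = 0 := by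
    intro z hz Z
    have h := B_dd_eq hU hz s1 s2 (c := 0) (fun w hw => hF.normal_orthogonal hf hu hl hw)
    obtain ⟨a, b, rfl⟩ := hF.exists_eq hf hu hz Z
    rw [map_add, map_smul, map_smul, hF.normal_const hf hu hl hz, smul_zero, zero_add, map_smul,
      LinearMap.smul_apply, h, hcon z hz]
    simp
  refine ⟨?_, ?_, ?_, h2 y hy _, ?_⟩
  · rw [B_dd_eq hU hy s1 hF.smooth₁ (fun z hz => (hF.normal_perp hf hu hl hz).1)]
    exact neg_ne_zero.2 (hF.normal_dd_ne hf hu hl hy)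
  · rw [B_dd_eq hU hy s1 hF.smooth₂ (fun z hz => (hF.normal_perp hf hu hl hz).2), B_comm,
      hl.perp₁ y _ ((hF.swap.mem_X_iff hf hu.swap hy _).1 (hF.Y_mem hf hu hy)), neg_zero]
  · have h := B_dd_eq hU hy s1 s1 (fun z _ => hl.unit₁ z) (Y y)
    rw [B_comm (l₁ y)] at h
    linarith
  · have h := bilin_dd_symm Bc hU s2 s1
      (fun z hz Z => by rw [Bc_apply, B_comm]; exact h2 z hz Z) hy (X y) (Y y)
    rw [B_comm]
    refine h.trans ?_
    rw [hcon y hy, map_zero, zero_apply]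

/-- The null vector dual to the first curvature sphere in the first Lie cyclide. -/
theorem exists_dual : ∃ b : M → R42, SmoothOn b U ∧ ∀ y ∈ U,
    ∃ c r : ℝ, c ≠ 0 ∧ b y = c⁻¹ • dd l₁ y (Y y) - r • σ₁ y ∧ B (b y) (σ₁ y) = 1 ∧ B (b y) (b y) = 0 := by
  have s1 : SmoothOn l₁ U := hl.smooth₁.mono (subset_univ U)
  have hm := s1.dd_apply hF.isOpen hF.smoothY
  have hc := hm.B hF.smooth₁
  have hmm := hm.B hm
  have hci : SmoothOn (fun y => (B (dd l₁ y (Y y)) (σ₁ y))⁻¹) U :=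
    ContMDiffOn.inv₀ hc fun y hy => (hF.dd_normal hf hu hl hy).1
  let m : ℝ →L[ℝ] ℝ →L[ℝ] ℝ := ContinuousLinearMap.mul ℝ ℝ
  let L : ℝ →L[ℝ] R42 →L[ℝ] R42 := ContinuousLinearMap.lsmul ℝ ℝ
  -- With `c = (d_Y l₁, σ₁)`, the multiple `½ c⁻² (d_Y l₁, d_Y l₁)` of `σ₁` is what has to be
  -- subtracted from `c⁻¹ d_Y l₁` to make it null.
  have hr := ((hci.bilin m hci).bilin m hmm).linear ((1 / 2 : ℝ) • ContinuousLinearMap.id ℝ ℝ)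
  refine ⟨_, ContMDiffOn.sub (hci.bilin L hm) (hr.bilin L hF.smooth₁), fun y hy => ?_⟩
  obtain ⟨h1, h2, -⟩ := hF.dd_normal hf hu hl hy
  refine ⟨B (dd l₁ y (Y y)) (σ₁ y), _, h1, rfl, ?_, ?_⟩
  · simp only [L, m, ContinuousLinearMap.lsmul_apply, map_sub, map_smul, LinearMap.sub_apply,
      LinearMap.smul_apply, smul_eq_mul, (hF.null hf hu hy).1, mul_zero, sub_zero]
    exact inv_mul_cancel₀ h1
  · simp only [L, m, ContinuousLinearMap.lsmul_apply, map_sub, map_smul, LinearMap.sub_apply,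
      LinearMap.smul_apply, smul_eq_mul, (hF.null hf hu hy).1, mul_zero, sub_zero,
      ContinuousLinearMap.mul_apply', smul_apply, ContinuousLinearMap.id_apply,
      B_comm (σ₁ y) (dd l₁ y (Y y))]
    field_simp
    ring

end IsCurvatureFrame

/-- A frame adapted to an umbilic-free Legendre map with spherical curvature lines, together with
its structure equations. -/
structure IsAdaptedFrame (f s₁ s₂ : Family42 M) (l₁ l₂ : M → R42) (U : Set M)
    (σ₁ σ₂ b₁ b₂ : M → R42) (X Y : ∀ y : M, TangentSpace (𝓡 2) y) : Prop
    extends IsCurvatureFrame f s₁ s₂ U σ₁ σ₂ X Y where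
  smooth_b₁ : SmoothOn b₁ U
  smooth_b₂ : SmoothOn b₂ U
  smooth_l₁ : SmoothOn l₁ U
  smooth_l₂ : SmoothOn l₂ U
  frame : ∀ y ∈ U, IsNullFrame (σ₁ y) (σ₂ y) (b₁ y) (b₂ y) (l₁ y) (l₂ y)
  f_eq' : ∀ y ∈ U, f y = Submodule.span ℝ {σ₁ y, σ₂ y}
  exists_eq' : ∀ y ∈ U, ∀ Z, ∃ a b : ℝ, Z = a • X y + b • Y y
  dl₁X : ∀ y ∈ U, dd l₁ y (X y) = 0
  dl₂Y : ∀ y ∈ U, dd l₂ y (Y y) = 0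
  dl₁Y : ∀ y ∈ U, ∃ r c : ℝ, dd l₁ y (Y y) = r • σ₁ y + c • b₁ y ∧ c ≠ 0
  dl₂X : ∀ y ∈ U, ∃ r c : ℝ, dd l₂ y (X y) = r • σ₂ y + c • b₂ y ∧ c ≠ 0
  dσ₁X : ∀ y ∈ U, ∃ α β : ℝ, dd σ₁ y (X y) = α • σ₁ y + β • σ₂ y ∧ β ≠ 0
  dσ₂Y : ∀ y ∈ U, ∃ α β : ℝ, dd σ₂ y (Y y) = α • σ₂ y + β • σ₁ y ∧ β ≠ 0
  dσ₁Y : ∀ y ∈ U, ∃ u k : ℝ, dd σ₁ y (Y y) = u • σ₁ y + k • l₁ y ∧ k ≠ 0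
  dσ₂X : ∀ y ∈ U, ∃ u k : ℝ, dd σ₂ y (X y) = u • σ₂ y + k • l₂ y ∧ k ≠ 0

theorem IsAdaptedFrame.swap {f s₁ s₂ : Family42 M} {l₁ l₂ : M → R42} {U : Set M}
    {σ₁ σ₂ b₁ b₂ : M → R42} {X Y : ∀ y : M, TangentSpace (𝓡 2) y}
    (h : IsAdaptedFrame f s₁ s₂ l₁ l₂ U σ₁ σ₂ b₁ b₂ X Y) :
    IsAdaptedFrame f s₂ s₁ l₂ l₁ U σ₂ σ₁ b₂ b₁ Y X where
  toIsCurvatureFrame := h.toIsCurvatureFrame.swap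
  smooth_b₁ := h.smooth_b₂
  smooth_b₂ := h.smooth_b₁
  smooth_l₁ := h.smooth_l₂
  smooth_l₂ := h.smooth_l₁
  frame := fun y hy => (h.frame y hy).swap
  f_eq' := fun y hy => by rw [h.f_eq' y hy, Set.pair_comm]
  exists_eq' := fun y hy Z => by
    obtain ⟨a, b, hab⟩ := h.exists_eq' y hy Z
    exact ⟨b, a, by rw [hab, add_comm]⟩
  dl₁X := h.dl₂Y
  dl₂Y := h.dl₁X
  dl₁Y := h.dl₂X
  dl₂X := h.dl₁Y
  dσ₁X := h.dσ₂Y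
  dσ₂Y := h.dσ₁X
  dσ₁Y := h.dσ₂X
  dσ₂X := h.dσ₁Y

section

variable {f s₁ s₂ : Family42 M} {U : Set M} {σ₁ σ₂ : M → R42} {X Y : ∀ y : M, TangentSpace (𝓡 2) y}
  {l₁ l₂ : M → R42}

/-- `d_Y l₁` is orthogonal to `σ₂`, `l₁`, `l₂` and to `d_X l₂`, hence to the dual vector `a₂` built
from `d_X l₂` and `σ₂`. Only the `σ₁` and `a₁` components survive. -/
theorem IsCurvatureFrame.dd_normal_eq (hF : IsCurvatureFrame f s₁ s₂ U σ₁ σ₂ X Y)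
    (hf : IsLegendre f) (hu : IsUmbilicFree f s₁ s₂) (hl : IsNormalPair f s₁ s₂ l₁ l₂)
    {y : M} (hy : y ∈ U) {a₁ a₂ : R42}
    (h : IsNullFrame (σ₁ y) (σ₂ y) a₁ a₂ (l₁ y) (l₂ y))
    (ha₂ : ∃ c r : ℝ, a₂ = c • dd l₂ y (X y) - r • σ₂ y) :
    ∃ r c : ℝ, dd l₁ y (Y y) = r • σ₁ y + c • a₁ ∧ c ≠ 0 := by
  obtain ⟨h1, h2, h3, h4, h5⟩ := hF.dd_normal hf hu hl hy
  obtain ⟨c, r, rfl⟩ := ha₂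
  have h6 : B (dd l₁ y (Y y)) (c • dd l₂ y (X y) - r • σ₂ y) = 0 := by
    rw [map_sub, map_smul, map_smul, h5, h2]; simp
  refine ⟨B (dd l₁ y (Y y)) a₁, B (dd l₁ y (Y y)) (σ₁ y), ?_, h1⟩
  conv_lhs => rw [h.expand (dd l₁ y (Y y)), h2, h3, h4, h6]
  simp

/-- The point is that `d_Y σ₁` has no `σ₂` component. As `(σ₁, dl₂) = 0`, symmetry gives `(d_Y σ₁,
d_X l₂) = (d_X σ₁, d_Y l₂) = 0`, and the dual vector `a₂` enters `d_X l₂` with non-zero coefficient.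
-/
theorem IsCurvatureFrame.dd_Y_eq (hF : IsCurvatureFrame f s₁ s₂ U σ₁ σ₂ X Y)
    (hf : IsLegendre f) (hu : IsUmbilicFree f s₁ s₂) (hl : IsNormalPair f s₁ s₂ l₁ l₂)
    {y : M} (hy : y ∈ U) {a₁ a₂ : R42}
    (h : IsNullFrame (σ₁ y) (σ₂ y) a₁ a₂ (l₁ y) (l₂ y))
    (h₂ : ∃ r c : ℝ, dd l₂ y (X y) = r • σ₂ y + c • a₂ ∧ c ≠ 0) :
    ∃ u k : ℝ, dd σ₁ y (Y y) = u • σ₁ y + k • l₁ y ∧ k ≠ 0 := by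
  have hU := hF.isOpen
  have s2 : SmoothOn l₂ U := hl.smooth₂.mono (subset_univ U)
  have e := fun z hz => hF.swap.normal_perp_dd hf hu.swap hl.swap (y := z) hz
  have hsymm : B (dd σ₁ y (Y y)) (dd l₂ y (X y)) = 0 := by
    have h := bilin_dd_symm Bc hU hF.smooth₁ s2 (fun z hz Z => by
      have h1 := B_dd_eq hU hz hF.smooth₁ s2 (c := 0)
        (fun w hw => by rw [B_comm]; exact (hF.swap.normal_perp hf hu.swap hl.swap hw).2) Z
      have h2 : B (dd σ₁ z Z) (l₂ z) = 0 := by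
        obtain ⟨a, b, rfl⟩ := hF.exists_eq hf hu hz Z
        have h3 := hl.perp₂ z _ ((hF.mem_X_iff hf hu hz (X z)).1 (hF.X_mem hf hu hz))
        rw [map_add, map_smul, map_smul, map_add, map_smul, map_smul, LinearMap.add_apply,
          LinearMap.smul_apply, LinearMap.smul_apply, h3, B_comm, e z hz]
        simp
      rw [Bc_apply]
      linarith) hy (Y y) (X y)
    refine h.trans ?_
    rw [hF.swap.normal_const hf hu.swap hl.swap hy, map_zero]
  obtain ⟨r, c, hrc, hc⟩ := h₂
  obtain ⟨c1, c2⟩ := hF.contact₁ hf hu hy (Y y)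
  rw [hrc, map_add, map_smul, map_smul, c2, smul_zero, zero_add, smul_eq_mul] at hsymm
  have h0 := (mul_eq_zero.1 hsymm).resolve_left hc
  have h6 := e y hy
  rw [B_comm] at h6
  refine ⟨B (dd σ₁ y (Y y)) a₁, B (dd σ₁ y (Y y)) (l₁ y), ?_,
    by rw [B_comm]; exact hF.normal_dd_ne hf hu hl hy⟩
  conv_lhs => rw [h.expand (dd σ₁ y (Y y)), c1, c2, h0, h6]
  simp

/-- The two families can be treated separately because the planes spanned by `σ₁`, `d_Y l₁` and by
`σ₂`, `d_X l₂` are orthogonal. The dual vectors lie in these planes, so they complete `σ_i`, `l_i`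
to a null frame. -/
theorem IsCurvatureFrame.exists_adaptedFrame (hF : IsCurvatureFrame f s₁ s₂ U σ₁ σ₂ X Y)
    (hf : IsLegendre f) (hu : IsUmbilicFree f s₁ s₂) (hr : IsRegularPair s₁ s₂)
    (hl : IsNormalPair f s₁ s₂ l₁ l₂) :
    ∃ b₁ b₂ : M → R42, IsAdaptedFrame f s₁ s₂ l₁ l₂ U σ₁ σ₂ b₁ b₂ X Y := by
  obtain ⟨b₁, hb₁, h₁⟩ := hF.exists_dual hf hu hl
  obtain ⟨b₂, hb₂, h₂⟩ := hF.swap.exists_dual hf hu.swap hl.swap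
  have frame : ∀ y ∈ U, IsNullFrame (σ₁ y) (σ₂ y) (b₁ y) (b₂ y) (l₁ y) (l₂ y) := by
    intro y hy
    obtain ⟨c₁, r₁, hc₁, e₁, p₁, q₁⟩ := h₁ y hy
    obtain ⟨c₂, r₂, hc₂, e₂, p₂, q₂⟩ := h₂ y hy
    obtain ⟨n1, n2, n3⟩ := hF.null hf hu hy
    obtain ⟨-, d2, d3, d4, d5⟩ := hF.dd_normal hf hu hl hy
    obtain ⟨-, d2', d3', d4', -⟩ := hF.swap.dd_normal hf hu.swap hl.swap hy
    obtain ⟨m1, m2⟩ := hF.normal_perp hf hu hl hy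
    obtain ⟨m1', m2'⟩ := hF.swap.normal_perp hf hu.swap hl.swap hy
    have n2' := n2
    rw [B_comm] at n2' m1 m2 m1' m2'
    have x1 : B (b₁ y) (σ₂ y) = 0 := by simp [e₁, d2, n2]
    have x2 : B (b₂ y) (σ₁ y) = 0 := by simp [e₂, d2', n2']
    have x3 : B (b₁ y) (b₂ y) = 0 := by
      rw [e₂, map_sub, map_smul, map_smul, x1, e₁, map_sub, map_smul, map_smul, LinearMap.sub_apply,
        LinearMap.smul_apply, LinearMap.smul_apply, d5, B_comm, d2']
      simp
    exact ⟨n1, n2, n3, q₁, x3, q₂, by rw [B_comm]; exact p₁, by rw [B_comm]; exact x2,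
      by rw [B_comm]; exact x1, by rw [B_comm]; exact p₂, m1, m2', m2, m1',
      by simp [e₁, d3, m1], by simp [e₁, d4, m2'], by simp [e₂, d4', m2], by simp [e₂, d3', m1'],
      hl.unit₁ y, hF.normal_orthogonal hf hu hl hy, hl.unit₂ y⟩
  have n₁ : ∀ y ∈ U, ∃ r c : ℝ, dd l₁ y (Y y) = r • σ₁ y + c • b₁ y ∧ c ≠ 0 := fun y hy => by
    obtain ⟨c₂, r₂, -, e₂, -⟩ := h₂ y hy
    exact hF.dd_normal_eq hf hu hl hy (frame y hy) ⟨_, _, e₂⟩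
  have n₂ : ∀ y ∈ U, ∃ r c : ℝ, dd l₂ y (X y) = r • σ₂ y + c • b₂ y ∧ c ≠ 0 := fun y hy => by
    obtain ⟨c₂, r₂, -, e₂, -⟩ := h₁ y hy
    exact hF.swap.dd_normal_eq hf hu.swap hl.swap hy (frame y hy).swap ⟨_, _, e₂⟩
  exact ⟨b₁, b₂, {
    toIsCurvatureFrame := hF
    smooth_b₁ := hb₁
    smooth_b₂ := hb₂
    smooth_l₁ := hl.smooth₁.mono (subset_univ U)
    smooth_l₂ := hl.smooth₂.mono (subset_univ U)
    frame := frame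
    f_eq' := fun y hy => hF.f_eq hf hu hy
    exists_eq' := fun y hy => hF.exists_eq hf hu hy
    dl₁X := fun y hy => hF.normal_const hf hu hl hy
    dl₂Y := fun y hy => hF.swap.normal_const hf hu.swap hl.swap hy
    dl₁Y := n₁
    dl₂X := n₂
    dσ₁X := fun y hy => hF.dd_X_eq hf hu hr hy
    dσ₂Y := fun y hy => hF.swap.dd_X_eq hf hu.swap hr.swap hy
    dσ₁Y := fun y hy => hF.dd_Y_eq hf hu hl hy (frame y hy) (n₂ y hy)
    dσ₂X := fun y hy => hF.swap.dd_Y_eq hf hu.swap hl.swap hy (frame y hy).swap (n₁ y hy) }⟩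

end

end

/-! ### Lie cyclides and osculating complexes -/

/-- The endomorphism `v ↦ (a, v) b` as a continuous bilinear function of `a` and `b`. -/
def dyadC : R42 →L[ℝ] R42 →L[ℝ] (R42 →L[ℝ] R42) :=
  LinearMap.toContinuousBilinearMap (LinearMap.mk₂ ℝ (fun a b => (Bc a).smulRight b)
    (fun a b c => by ext1 v; simp [add_smul])
    (fun t a b => by ext1 v; simp [mul_smul])
    (fun a b c => by ext1 v; simp [smul_add])
    (fun t a b => by ext1 v; simp [smul_comm t]))

namespace IsNullFrame

variable {a₁ a₂ b₁ b₂ l₁ l₂ : R42} (h : IsNullFrame a₁ a₂ b₁ b₂ l₁ l₂)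
include h

theorem mem_cyclide {v : R42} : v ∈ Submodule.span ℝ {a₁, l₁, b₁} ↔
    B v a₂ = 0 ∧ B v b₂ = 0 ∧ B v l₂ = 0 := by
  have t := h.table
  rw [Submodule.mem_span_triple]
  constructor
  · rintro ⟨c, d, e, rfl⟩
    simp [t]
  · rintro ⟨h1, h2, h3⟩
    refine ⟨B v b₁, B v l₁, B v a₁, ?_⟩
    conv_rhs => rw [h.expand v, h1, h2, h3]
    module

theorem mem_normal {v : R42} : v ∈ Submodule.span ℝ {l₁, l₂} ↔
    B v a₁ = 0 ∧ B v a₂ = 0 ∧ B v b₁ = 0 ∧ B v b₂ = 0 := by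
  have t := h.table
  rw [Submodule.mem_span_pair]
  constructor
  · rintro ⟨c, d, rfl⟩
    simp [t]
  · rintro ⟨h1, h2, h3, h4⟩
    refine ⟨B v l₁, B v l₂, ?_⟩
    conv_rhs => rw [h.expand v, h1, h2, h3, h4]
    module

theorem perp_normal : perp (Submodule.span ℝ {l₁, l₂}) =
    Submodule.span ℝ (Set.range ![a₁, a₂, b₁, b₂]) := by
  have t := h.table
  ext v
  rw [mem_perp_span_pair, Submodule.mem_span_range_iff_exists_fun]
  constructor
  · rintro ⟨h1, h2⟩
    refine ⟨![B v b₁, B v b₂, B v a₁, B v a₂], ?_⟩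
    conv_rhs => rw [h.expand v, h1, h2]
    simp [Fin.sum_univ_four]
  · rintro ⟨c, rfl⟩
    simp [Fin.sum_univ_four, t]

theorem perp_perp_normal : perp (perp (Submodule.span ℝ {l₁, l₂})) = Submodule.span ℝ {l₁, l₂} := by
  have t := h.table
  ext v
  rw [h.mem_normal, h.perp_normal, mem_perp]
  constructor
  · intro hv
    refine ⟨?_, ?_, ?_, ?_⟩ <;> rw [B_comm] <;> apply hv <;> apply Submodule.subset_span
    exacts [⟨0, rfl⟩, ⟨1, rfl⟩, ⟨2, rfl⟩, ⟨3, rfl⟩]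
  · rintro ⟨h1, h2, h3, h4⟩ w hw
    obtain ⟨c, rfl⟩ := (Submodule.mem_span_range_iff_exists_fun ℝ).1 hw
    rw [B_comm]
    simp [Fin.sum_univ_four, h1, h2, h3, h4]

theorem isPlane22 : IsPlane22 (perp (Submodule.span ℝ {l₁, l₂})) := by
  have t := h.table
  -- As `(a_i, b_i) = 1`, the vectors `a_i ± ½ b_i` have squares `±1`.
  refine ⟨![a₁ + (1 / 2 : ℝ) • b₁, a₂ + (1 / 2 : ℝ) • b₂, a₁ - (1 / 2 : ℝ) • b₁,
    a₂ - (1 / 2 : ℝ) • b₂], ?_, ?_⟩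
  · rw [h.perp_normal]
    apply le_antisymm
    · rw [Submodule.span_le]
      rintro _ ⟨i, rfl⟩
      rw [SetLike.mem_coe, Submodule.mem_span_range_iff_exists_fun]
      fin_cases i
      · refine ⟨![1 / 2, 0, 1 / 2, 0], ?_⟩
        simp [Fin.sum_univ_four]; module
      · refine ⟨![0, 1 / 2, 0, 1 / 2], ?_⟩
        simp [Fin.sum_univ_four]; module
      · refine ⟨![1, 0, -1, 0], ?_⟩
        simp [Fin.sum_univ_four]; module
      · refine ⟨![0, 1, 0, -1], ?_⟩
        simp [Fin.sum_univ_four]; module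
    · rw [Submodule.span_le]
      rintro _ ⟨i, rfl⟩
      rw [SetLike.mem_coe, Submodule.mem_span_range_iff_exists_fun]
      fin_cases i
      · refine ⟨![1, 0, 1 / 2, 0], ?_⟩
        simp [Fin.sum_univ_four]
      · refine ⟨![0, 1, 0, 1 / 2], ?_⟩
        simp [Fin.sum_univ_four]
      · refine ⟨![1, 0, -(1 / 2), 0], ?_⟩
        simp [Fin.sum_univ_four]; module
      · refine ⟨![0, 1, 0, -(1 / 2)], ?_⟩
        simp [Fin.sum_univ_four]; module
  · intro i j
    fin_cases i <;> fin_cases j <;> simp [t] <;> norm_num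

end IsNullFrame

section

variable {M : Type*} [TopologicalSpace M] [ChartedSpace E2 M]

theorem proj_eq {V V' : Family42 M} {x : M} {K : R42 →L[ℝ] R42} (h₁ : ∀ v, K v ∈ V x)
    (h₂ : ∀ v, v - K v ∈ V' x) (h : V x ⊓ V' x = ⊥) :
    proj V V' x = K ∧ proj V' V x = ContinuousLinearMap.id ℝ R42 - K := by
  have hc : IsCompl (V x) (V' x) := by
    refine ⟨disjoint_iff.2 h, codisjoint_iff.2 ?_⟩
    rw [eq_top_iff]
    intro v _
    exact Submodule.mem_sup.2 ⟨K v, h₁ v, v - K v, h₂ v, by simp⟩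
  constructor
  · unfold proj
    rw [dif_pos hc]
    ext1 v
    change (V x).projection (V' x) hc v = K v
    conv_lhs => rw [← add_sub_cancel (K v) v]
    rw [map_add, Submodule.projection_apply_of_mem_left hc (h₁ v),
      Submodule.projection_apply_of_mem_right hc (h₂ v), add_zero]
  · unfold proj
    rw [dif_pos hc.symm]
    ext1 v
    change (V' x).projection (V x) hc.symm v = v - K v
    conv_lhs => rw [← add_sub_cancel (K v) v]
    rw [map_add, Submodule.projection_apply_of_mem_right hc.symm (h₁ v),
      Submodule.projection_apply_of_mem_left hc.symm (h₂ v), zero_add]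

theorem normalForm_comm (V V' : Family42 M) (x : M) (Z : TangentSpace (𝓡 2) x) :
    normalForm V V' x Z = normalForm V' V x Z := by
  unfold normalForm
  rw [add_comm]

/-- The tensor `𝒩` in terms of the differential of the projection `K`. -/
theorem normalForm_eq {V V' : Family42 M} {U : Set M} (hU : IsOpen U) {K : M → R42 →L[ℝ] R42}
    (hK : SmoothOn K U) (h₁ : ∀ y ∈ U, ∀ v, K y v ∈ V y) (h₂ : ∀ y ∈ U, ∀ v, v - K y v ∈ V' y)
    (h : ∀ y ∈ U, V y ⊓ V' y = ⊥) {x : M} (hx : x ∈ U) (Z : TangentSpace (𝓡 2) x) (v : R42) :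
    normalForm V V' x Z v = dd K x Z v - (2 : ℝ) • K x (dd K x Z v) := by
  have hKx := hK.mdifferentiableAt hU hx
  have e₁ : proj V V' =ᶠ[𝓝 x] K := by
    filter_upwards [hU.mem_nhds hx] with y hy
    exact (proj_eq (h₁ y hy) (h₂ y hy) (h y hy)).1
  have e₂ : proj V' V =ᶠ[𝓝 x] fun y => ContinuousLinearMap.id ℝ R42 - K y := by
    filter_upwards [hU.mem_nhds hx] with y hy
    exact (proj_eq (h₁ y hy) (h₂ y hy) (h y hy)).2
  -- The complementary projection is `1 - K`, so `-(K dK + (1 - K) d(1 - K)) = dK - 2 K dK`.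
  unfold normalForm
  rw [dd_congr e₁, dd_congr e₂, e₁.self_of_nhds, e₂.self_of_nhds,
    dd_sub mdifferentiableAt_const hKx, dd_const]
  change -(K x (dd K x Z v) + ((0 - dd K x Z) v - K x ((0 - dd K x Z) v))) = _
  simp only [zero_sub, neg_apply, map_neg]
  module

theorem dd_dyadC {u w : M → R42} {U : Set M} (hU : IsOpen U) {x : M} (hx : x ∈ U)
    (hu : SmoothOn u U) (hw : SmoothOn w U) (Z : TangentSpace (𝓡 2) x) (v : R42) :
    dd (fun y => dyadC (u y) (w y)) x Z v = B (u x) v • dd w x Z + B (dd u x Z) v • w x := by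
  rw [dd_bilin dyadC (hu.mdifferentiableAt hU hx) (hw.mdifferentiableAt hU hx)]
  rfl

variable [IsManifold (𝓡 2) ∞ M]

namespace IsAdaptedFrame

variable {f s₁ s₂ : Family42 M} {l₁ l₂ : M → R42} {U : Set M} {σ₁ σ₂ b₁ b₂ : M → R42}
  {X Y : ∀ y : M, TangentSpace (𝓡 2) y} (h : IsAdaptedFrame f s₁ s₂ l₁ l₂ U σ₁ σ₂ b₁ b₂ X Y)
include h

theorem mono {V : Set M} (hV : IsOpen V) (hVU : V ⊆ U) :
    IsAdaptedFrame f s₁ s₂ l₁ l₂ V σ₁ σ₂ b₁ b₂ X Y where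
  isOpen := hV
  smooth₁ := h.smooth₁.mono hVU
  smooth₂ := h.smooth₂.mono hVU
  smoothX := h.smoothX.mono hVU
  smoothY := h.smoothY.mono hVU
  ne₁ := fun y hy => h.ne₁ y (hVU hy)
  ne₂ := fun y hy => h.ne₂ y (hVU hy)
  eq₁ := fun y hy => h.eq₁ y (hVU hy)
  eq₂ := fun y hy => h.eq₂ y (hVU hy)
  neX := fun y hy => h.neX y (hVU hy)
  neY := fun y hy => h.neY y (hVU hy)
  eqX := fun y hy => h.eqX y (hVU hy)
  eqY := fun y hy => h.eqY y (hVU hy)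
  smooth_b₁ := h.smooth_b₁.mono hVU
  smooth_b₂ := h.smooth_b₂.mono hVU
  smooth_l₁ := h.smooth_l₁.mono hVU
  smooth_l₂ := h.smooth_l₂.mono hVU
  frame := fun y hy => h.frame y (hVU hy)
  f_eq' := fun y hy => h.f_eq' y (hVU hy)
  exists_eq' := fun y hy => h.exists_eq' y (hVU hy)
  dl₁X := fun y hy => h.dl₁X y (hVU hy)
  dl₂Y := fun y hy => h.dl₂Y y (hVU hy)
  dl₁Y := fun y hy => h.dl₁Y y (hVU hy)
  dl₂X := fun y hy => h.dl₂X y (hVU hy)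
  dσ₁X := fun y hy => h.dσ₁X y (hVU hy)
  dσ₂Y := fun y hy => h.dσ₂Y y (hVU hy)
  dσ₁Y := fun y hy => h.dσ₁Y y (hVU hy)
  dσ₂X := fun y hy => h.dσ₂X y (hVU hy)

/-- Derivatives along the second curvature lines of fields in `⟨σ₁, l₁⟩` lie in the Lie cyclide. -/
theorem dd_mem_cyclide {g : M → R42} (hg : SmoothOn g U)
    (hmem : ∀ y ∈ U, g y ∈ Submodule.span ℝ {σ₁ y, l₁ y}) {y : M} (hy : y ∈ U) :
    dd g y (Y y) ∈ Submodule.span ℝ {σ₁ y, l₁ y, b₁ y} := by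
  have hU := h.isOpen
  rw [(h.frame y hy).mem_cyclide]
  have hz : ∀ z ∈ U, B (g z) (σ₁ z) = 0 ∧ B (g z) (σ₂ z) = 0 ∧ B (g z) (b₂ z) = 0 ∧
      B (g z) (l₂ z) = 0 := by
    intro z hz
    obtain ⟨c, d, hcd⟩ := Submodule.mem_span_pair.1 (hmem z hz)
    have t := (h.frame z hz).table
    simp [← hcd, t]
  obtain ⟨α, β, hαβ, -⟩ := h.dσ₂Y y hy
  refine ⟨?_, ?_, ?_⟩
  · rw [B_dd_eq hU hy hg h.smooth₂ (fun z hz' => (hz z hz').2.1), hαβ]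
    simp [hz y hy]
  · rw [B_dd_eq hU hy hg h.smooth_b₂ (fun z hz' => (hz z hz').2.2.1)]
    obtain ⟨c, d, hcd⟩ := Submodule.mem_span_pair.1 (hmem y hy)
    obtain ⟨u, k, huk, -⟩ := h.dσ₁Y y hy
    obtain ⟨r, c', hrc, -⟩ := h.dl₁Y y hy
    have t := (h.frame y hy).table
    -- `d_Y b₂` is needed only paired with `σ₁` and `l₁`. These pairings are minus the `σ₂`
    -- components of `d_Y σ₁` and `d_Y l₁`, which vanish.
    have e1 := B_dd_eq hU hy h.smooth₁ h.smooth_b₂ (fun z hz => (h.frame z hz).a₁b₂) (Y y)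
    have e2 := B_dd_eq hU hy h.smooth_l₁ h.smooth_b₂
      (fun z hz => (B_comm _ _).trans (h.frame z hz).b₂l₁) (Y y)
    rw [huk] at e1
    rw [hrc] at e2
    simp only [map_add, map_smul, LinearMap.add_apply, LinearMap.smul_apply, t, smul_zero,
      add_zero] at e1 e2
    rw [← hcd]
    simp only [map_add, map_smul, LinearMap.add_apply, LinearMap.smul_apply, smul_eq_mul]
    rw [neg_eq_zero.1 e1.symm, neg_eq_zero.1 e2.symm]
    simp
  · rw [B_dd_eq hU hy hg h.smooth_l₂ (fun z hz' => (hz z hz').2.2.2), h.dl₂Y y hy]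
    simp

/-- First `Y`-derivatives of sections of `s₁` stay in `⟨σ₁, l₁⟩` and second ones in `⟨σ₁, l₁, b₁⟩`.
Conversely `d_Y σ₁` has a non-zero component `k` along `l₁`, and `d_Y d_Y σ₁` has component `-k²`
along `b₁`. -/
theorem lieCyclide_eq {x : M} (hx : x ∈ U) :
    lieCyclide f s₁ s₂ x = Submodule.span ℝ {σ₁ x, l₁ x, b₁ x} := by
  have hU := h.isOpen
  apply le_antisymm
  · refine Submodule.span_le.2 ?_
    rintro w ⟨U', σ, Y', hU', hxU', hσ, hY', hw⟩
    have hV := hU.inter hU'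
    have hA := h.mono hV inter_subset_left
    have hxV : x ∈ U ∩ U' := ⟨hx, hxU'⟩
    have hσV : SmoothOn σ (U ∩ U') := hσ.1.mono inter_subset_right
    have hYV : SmoothField Y' (U ∩ U') := hY'.1.mono inter_subset_right
    have hσs : ∀ y ∈ U ∩ U', ∃ c : ℝ, c • σ₁ y = σ y := by
      intro y hy
      have := hσ.2 y hy.2
      rwa [h.eq₁ y hy.1, Submodule.mem_span_singleton] at this
    have hYs : ∀ y ∈ U ∩ U', ∃ c : ℝ, c • Y y = Y' y := by
      intro y hy
      have := hY'.2 y hy.2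
      rwa [h.eqY y hy.1, Submodule.mem_span_singleton] at this
    have hd := hσV.dd_apply hV hYV
    have h1 : ∀ y ∈ U ∩ U', dd σ y (Y' y) ∈ Submodule.span ℝ {σ₁ y, l₁ y} := by
      intro y hy
      obtain ⟨c, hc⟩ := hYs y hy
      rw [← hc, map_smul]
      refine Submodule.smul_mem _ _ ?_
      have m1 := hA.dd_mem_cyclide hσV (fun z hz => by
        obtain ⟨c, hc⟩ := hσs z hz
        rw [← hc]
        exact Submodule.smul_mem _ _ (Submodule.subset_span (by simp))) hy
      have t := (h.frame y hy.1).table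
      have m2 : B (dd σ y (Y y)) (σ₁ y) = 0 := by
        rw [B_dd_eq hV hy hσV hA.smooth₁ (c := 0) (fun z hz => by
          obtain ⟨c, hc⟩ := hσs z hz
          rw [← hc, map_smul, LinearMap.smul_apply, (h.frame z hz.1).a₁a₁, smul_zero])]
        obtain ⟨c, hc⟩ := hσs y hy
        obtain ⟨u, k, huk, -⟩ := h.dσ₁Y y hy.1
        rw [← hc, huk]
        simp [t]
      obtain ⟨p, q, r, hpqr⟩ := Submodule.mem_span_triple.1 m1
      rw [← hpqr] at m2 ⊢
      have hr : r = 0 := by simpa [t] using m2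
      rw [hr]
      exact Submodule.mem_span_pair.2 ⟨p, q, by simp⟩
    rcases hw with rfl | rfl | rfl
    · obtain ⟨c, hc⟩ := hσs x hxV
      rw [← hc]
      exact Submodule.smul_mem _ _ (Submodule.subset_span (by simp))
    · exact Submodule.span_mono (by grind) (h1 x hxV)
    · obtain ⟨c, hc⟩ := hYs x hxV
      conv in dd (fun y => dd σ y (Y' y)) x (Y' x) => rw [← hc]
      rw [map_smul]
      exact Submodule.smul_mem _ _ (hA.dd_mem_cyclide hd h1 hxV)
  · have hsec : IsSection s₁ U σ₁ :=
      ⟨h.smooth₁, fun y hy => by rw [h.eq₁ y hy]; exact Submodule.mem_span_singleton_self _⟩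
    have hY : IsVectorFieldIn (curvatureSpace f s₂) U Y :=
      ⟨h.smoothY, fun y hy => by rw [h.eqY y hy]; exact Submodule.mem_span_singleton_self _⟩
    have g1 : σ₁ x ∈ lieCyclide f s₁ s₂ x :=
      Submodule.subset_span ⟨U, σ₁, Y, hU, hx, hsec, hY, Or.inl rfl⟩
    have g2 : dd σ₁ x (Y x) ∈ lieCyclide f s₁ s₂ x :=
      Submodule.subset_span ⟨U, σ₁, Y, hU, hx, hsec, hY, Or.inr (Or.inl rfl)⟩
    have g3 : dd (fun y => dd σ₁ y (Y y)) x (Y x) ∈ lieCyclide f s₁ s₂ x :=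
      Submodule.subset_span ⟨U, σ₁, Y, hU, hx, hsec, hY, Or.inr (Or.inr rfl)⟩
    obtain ⟨u, k, huk, hk⟩ := h.dσ₁Y x hx
    have t := (h.frame x hx).table
    have g4 : l₁ x ∈ lieCyclide f s₁ s₂ x := by
      have := Submodule.smul_mem _ k⁻¹ (Submodule.sub_mem _ g2 (Submodule.smul_mem _ u g1))
      rwa [huk, add_sub_cancel_left, smul_smul, inv_mul_cancel₀ hk, one_smul] at this
    have hd := h.smooth₁.dd_apply hU h.smoothY
    have m1 := h.dd_mem_cyclide hd (fun y hy => by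
      obtain ⟨u, k, huk, hk⟩ := h.dσ₁Y y hy
      exact Submodule.mem_span_pair.2 ⟨u, k, huk.symm⟩) hx
    have m2 := B_dd_eq hU hx hd h.smooth₁ (c := 0) (fun y hy => by
      obtain ⟨u, k, huk, hk⟩ := h.dσ₁Y y hy
      have t := (h.frame y hy).table
      simp [huk, t]) (Y x)
    obtain ⟨p, q, r, hpqr⟩ := Submodule.mem_span_triple.1 m1
    rw [← hpqr, huk] at m2
    rw [← hpqr] at g3
    have hr : r = -(k * k) := by simpa [t] using m2
    have g5 : b₁ x ∈ lieCyclide f s₁ s₂ x := by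
      have := Submodule.smul_mem _ r⁻¹ (Submodule.sub_mem _ (Submodule.sub_mem _ g3
        (Submodule.smul_mem _ p g1)) (Submodule.smul_mem _ q g4))
      have hr0 : r ≠ 0 := by rw [hr]; exact neg_ne_zero.2 (mul_ne_zero hk hk)
      have e : p • σ₁ x + q • l₁ x + r • b₁ x - p • σ₁ x - q • l₁ x = r • b₁ x := by module
      rwa [e, smul_smul, inv_mul_cancel₀ hr0, one_smul] at this
    rw [Submodule.span_le]
    rintro w (rfl | rfl | rfl)
    exacts [g1, g4, g5]

/-- `S₁ ∩ f^⊥ = ⟨σ₁, l₁⟩`. Here `𝒩(X)` kills `l₁`, which is constant along `X`, and sends `σ₁` to `β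
σ₂`, which is non-zero by regularity. -/
theorem osculatingComplex_eq {x : M} (hx : x ∈ U) :
    osculatingComplex f s₁ s₂ x = Submodule.span ℝ {l₁ x} := by
  have hU := h.isOpen
  -- The orthogonal projection onto `S₁`; its kernel is `S₂`, since the two Lie cyclides are
  -- orthogonal complements.
  let K : M → R42 →L[ℝ] R42 := fun y => dyadC (b₁ y) (σ₁ y) + dyadC (σ₁ y) (b₁ y) +
    dyadC (l₁ y) (l₁ y)
  have k1 := h.smooth_b₁.bilin dyadC h.smooth₁
  have k2 := h.smooth₁.bilin dyadC h.smooth_b₁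
  have k3 := h.smooth_l₁.bilin dyadC h.smooth_l₁
  have hK : SmoothOn K U := ContMDiffOn.add (ContMDiffOn.add k1 k2) k3
  have hKv : ∀ y v, K y v = B (b₁ y) v • σ₁ y + B (σ₁ y) v • b₁ y + B (l₁ y) v • l₁ y :=
    fun y v => rfl
  have hdK : ∀ Z v, dd K x Z v = (B (b₁ x) v • dd σ₁ x Z + B (dd b₁ x Z) v • σ₁ x) +
      (B (σ₁ x) v • dd b₁ x Z + B (dd σ₁ x Z) v • b₁ x) +
      (B (l₁ x) v • dd l₁ x Z + B (dd l₁ x Z) v • l₁ x) := by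
    intro Z v
    have d1 := k1.mdifferentiableAt hU hx
    have d2 := k2.mdifferentiableAt hU hx
    have d3 := k3.mdifferentiableAt hU hx
    rw [show dd K x Z = _ from dd_add (d1.add d2) d3 Z,
      show dd (_ + _) x Z = _ from dd_add d1 d2 Z, add_apply, add_apply,
      dd_dyadC hU hx h.smooth_b₁ h.smooth₁, dd_dyadC hU hx h.smooth₁ h.smooth_b₁,
      dd_dyadC hU hx h.smooth_l₁ h.smooth_l₁]
  have hN := fun Z v => normalForm_eq (V := lieCyclide f s₁ s₂) (V' := lieCyclide f s₂ s₁) hU hK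
    (fun y hy v => by
      rw [h.lieCyclide_eq hy, hKv, Submodule.mem_span_triple]
      exact ⟨B (b₁ y) v, B (l₁ y) v, B (σ₁ y) v, by module⟩)
    (fun y hy v => by
      rw [h.swap.lieCyclide_eq hy, hKv, Submodule.mem_span_triple]
      refine ⟨B (b₂ y) v, B (l₂ y) v, B (σ₂ y) v, ?_⟩
      conv_rhs => enter [1]; rw [(h.frame y hy).expand v]
      simp only [B_comm _ v]
      module)
    (fun y hy => by
      rw [eq_bot_iff]
      rintro v ⟨h1, h2⟩
      rw [SetLike.mem_coe, h.lieCyclide_eq hy, (h.frame y hy).mem_cyclide] at h1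
      rw [SetLike.mem_coe, h.swap.lieCyclide_eq hy, (h.frame y hy).swap.mem_cyclide] at h2
      rw [Submodule.mem_bot, (h.frame y hy).expand v]
      simp [h1, h2]) hx Z v
  have t := (h.frame x hx).table
  have hf : ∀ v, v ∈ perp (f x) ↔ B v (σ₁ x) = 0 ∧ B v (σ₂ x) = 0 := fun v => by
    rw [h.f_eq' x hx, mem_perp_span_pair]
  obtain ⟨α, β, hαβ, hβ⟩ := h.dσ₁X x hx
  have e1 := B_dd_eq hU hx h.smooth_b₁ h.smooth_l₁ (fun z hz => (h.frame z hz).b₁l₁) (X x)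
  have e2 := B_dd_eq hU hx h.smooth_b₁ h.smooth₁
    (fun z hz => (B_comm _ _).trans (h.frame z hz).a₁b₁) (X x)
  rw [h.dl₁X x hx, map_zero, neg_zero] at e1
  rw [hαβ] at e2
  simp only [map_add, map_smul, t, smul_eq_mul, mul_one, mul_zero, add_zero] at e2
  have N1 : normalForm (lieCyclide f s₁ s₂) (lieCyclide f s₂ s₁) x (X x) (l₁ x) = 0 := by
    rw [hN, hdK, hαβ, h.dl₁X x hx, e1]
    simp [t]
  have N2 : normalForm (lieCyclide f s₁ s₂) (lieCyclide f s₂ s₁) x (X x) (σ₁ x) = β • σ₂ x := by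
    have : dd K x (X x) (σ₁ x) = β • σ₂ x := by
      rw [hdK, hαβ, h.dl₁X x hx, e2]
      simp [t]
    rw [hN, this, hKv]
    simp [t]
  have hmem : ∀ v, v ∈ osculatingComplex f s₁ s₂ x ↔
      (v ∈ Submodule.span ℝ {σ₁ x, l₁ x, b₁ x} ∧ (B v (σ₁ x) = 0 ∧ B v (σ₂ x) = 0)) ∧
      normalForm (lieCyclide f s₁ s₂) (lieCyclide f s₂ s₁) x (X x) v = 0 := by
    intro v
    unfold osculatingComplex
    rw [Submodule.mem_inf, Submodule.mem_inf, hf, h.lieCyclide_eq hx, Submodule.mem_iInf]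
    refine and_congr_right fun _ => ?_
    simp only [Submodule.mem_iInf, LinearMap.mem_ker]
    constructor
    · intro hv
      exact hv (X x) (by rw [h.eqX x hx]; exact Submodule.mem_span_singleton_self _)
    · intro hv Z hZ
      rw [h.eqX x hx, Submodule.mem_span_singleton] at hZ
      obtain ⟨c, rfl⟩ := hZ
      change normalForm (lieCyclide f s₁ s₂) (lieCyclide f s₂ s₁) x (c • X x) v = 0
      rw [hN] at hv ⊢
      rw [map_smul, smul_apply, map_smul, smul_comm, ← smul_sub, hv, smul_zero]
  ext v
  rw [hmem, Submodule.mem_span_singleton]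
  constructor
  · rintro ⟨⟨h1, h2, h3⟩, h4⟩
    obtain ⟨p, q, r, rfl⟩ := Submodule.mem_span_triple.1 h1
    have hr : r = 0 := by simpa [t] using h2
    rw [hr, zero_smul, add_zero, map_add, map_smul, map_smul, N1, N2, smul_zero, add_zero,
      smul_smul] at h4
    have hp : p = 0 := by simpa [hβ, h.ne₂ x hx] using h4
    exact ⟨q, by rw [hr, hp]; simp⟩
  · rintro ⟨c, rfl⟩
    refine ⟨⟨Submodule.mem_span_triple.2 ⟨0, c, 0, by simp⟩, by simp [t], by simp [t]⟩, ?_⟩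
    rw [map_smul, N1, smul_zero]

end IsAdaptedFrame

end

/-! ### The curved flat -/

section

variable {M : Type*} [TopologicalSpace M] [ChartedSpace E2 M] [IsManifold (𝓡 2) ∞ M]

/-- For every tangent vector, the derivatives of the normal fields are multiples of fixed vectors. -/
theorem IsAdaptedFrame.dd_normal_eq_smul {f s₁ s₂ : Family42 M} {l₁ l₂ : M → R42} {U : Set M}
    {σ₁ σ₂ b₁ b₂ : M → R42} {X Y : ∀ y : M, TangentSpace (𝓡 2) y}
    (h : IsAdaptedFrame f s₁ s₂ l₁ l₂ U σ₁ σ₂ b₁ b₂ X Y) {x : M} (hx : x ∈ U)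
    (Z : TangentSpace (𝓡 2) x) :
    ∃ c d : ℝ, dd l₁ x Z = c • dd l₁ x (Y x) ∧ dd l₂ x Z = d • dd l₂ x (X x) := by
  obtain ⟨a, b, rfl⟩ := h.exists_eq' x hx Z
  refine ⟨b, a, ?_, ?_⟩
  · rw [map_add, map_smul, map_smul, h.dl₁X x hx]; simp
  · rw [map_add, map_smul, map_smul, h.dl₂Y x hx]; simp

/-- Here `W^⊥ = ⟨l₁, l₂⟩` and `𝒩^W(Z) = l₁ ∧ d_Z l₁ + l₂ ∧ d_Z l₂`. By `dd_normal_eq_smul` all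
values are combinations of `l₁ ∧ d_Y l₁` and `l₂ ∧ d_X l₂`, which commute because their planes are
orthogonal. -/
theorem isCurvedFlat22_of_adaptedFrame {f s₁ s₂ : Family42 M} {l₁ l₂ : M → R42}
    (hex : ∀ x, ∃ (U : Set M) (σ₁ σ₂ b₁ b₂ : M → R42) (X Y : ∀ y : M, TangentSpace (𝓡 2) y),
      x ∈ U ∧ IsAdaptedFrame f s₁ s₂ l₁ l₂ U σ₁ σ₂ b₁ b₂ X Y) :
    IsCurvedFlat22 (fun x => perp (osculatingComplex f s₁ s₂ x ⊔ osculatingComplex f s₂ s₁ x)) := by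
  have hW : (fun x => perp (osculatingComplex f s₁ s₂ x ⊔ osculatingComplex f s₂ s₁ x)) =
      fun x => perp (Submodule.span ℝ {l₁ x, l₂ x}) := by
    funext x
    obtain ⟨U, σ₁, σ₂, b₁, b₂, X, Y, hx, h⟩ := hex x
    rw [h.osculatingComplex_eq hx, h.swap.osculatingComplex_eq hx, ← Submodule.span_insert]
  rw [hW]
  refine ⟨fun x => ?_, fun x => ?_, fun x Z Z' => ?_⟩
  · obtain ⟨U, σ₁, σ₂, b₁, b₂, X, Y, hx, h⟩ := hex x
    refine ⟨U, h.isOpen, hx, ![σ₁, σ₂, b₁, b₂], ?_, fun y hy => ?_⟩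
    · have hm : ∀ (i : Fin 4), ∀ y ∈ U, (![σ₁, σ₂, b₁, b₂] i) y = ![σ₁ y, σ₂ y, b₁ y, b₂ y] i := by
        intro i y _
        fin_cases i <;> rfl
      intro i
      refine ⟨?_, fun y hy => ?_⟩
      · fin_cases i
        exacts [h.smooth₁, h.smooth₂, h.smooth_b₁, h.smooth_b₂]
      · change _ ∈ perp _
        rw [(h.frame y hy).perp_normal, hm i y hy]
        exact Submodule.subset_span ⟨i, rfl⟩
    · have e : (fun i => ![σ₁, σ₂, b₁, b₂] i y) = ![σ₁ y, σ₂ y, b₁ y, b₂ y] := by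
        funext i
        fin_cases i <;> rfl
      rw [e]
      refine ⟨?_, (h.frame y hy).perp_normal⟩
      have := (h.frame y hy).linearIndependent.comp (Fin.castLE (by norm_num : 4 ≤ 6))
        (Fin.castLE_injective _)
      convert! this using 1
      funext i
      fin_cases i <;> rfl
  · obtain ⟨U, σ₁, σ₂, b₁, b₂, X, Y, hx, h⟩ := hex x
    exact (h.frame x hx).isPlane22
  · obtain ⟨U, σ₁, σ₂, b₁, b₂, X, Y, hx, h⟩ := hex x
    have hU := h.isOpen
    let K : M → R42 →L[ℝ] R42 := fun y => dyadC (l₁ y) (l₁ y) + dyadC (l₂ y) (l₂ y)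
    have k1 := h.smooth_l₁.bilin dyadC h.smooth_l₁
    have k2 := h.smooth_l₂.bilin dyadC h.smooth_l₂
    have hK : SmoothOn K U := ContMDiffOn.add k1 k2
    have hKv : ∀ y v, K y v = B (l₁ y) v • l₁ y + B (l₂ y) v • l₂ y := fun y v => rfl
    have hdK : ∀ Z v, dd K x Z v = (B (l₁ x) v • dd l₁ x Z + B (dd l₁ x Z) v • l₁ x) +
        (B (l₂ x) v • dd l₂ x Z + B (dd l₂ x Z) v • l₂ x) := by
      intro Z v
      rw [show dd K x Z = _ from dd_add (k1.mdifferentiableAt hU hx) (k2.mdifferentiableAt hU hx) Z,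
        add_apply, dd_dyadC hU hx h.smooth_l₁ h.smooth_l₁, dd_dyadC hU hx h.smooth_l₂ h.smooth_l₂]
    have t := (h.frame x hx).table
    obtain ⟨r₁, c₁, e₁, -⟩ := h.dl₁Y x hx
    obtain ⟨r₂, c₂, e₂, -⟩ := h.dl₂X x hx
    have hN : ∀ Z v, normalForm (fun x => perp (Submodule.span ℝ {l₁ x, l₂ x}))
        (fun y => perp (perp (Submodule.span ℝ {l₁ y, l₂ y}))) x Z v =
        (B (l₁ x) v • dd l₁ x Z - B (dd l₁ x Z) v • l₁ x) +
        (B (l₂ x) v • dd l₂ x Z - B (dd l₂ x Z) v • l₂ x) := by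
      intro Z v
      rw [normalForm_comm, normalForm_eq hU hK]
      · obtain ⟨a, b, ha, hb⟩ := h.dd_normal_eq_smul hx Z
        rw [hdK, hKv, ha, hb, e₁, e₂]
        simp only [map_add, map_smul, LinearMap.add_apply, LinearMap.smul_apply, t, smul_eq_mul]
        module
      · intro y hy v
        rw [(h.frame y hy).perp_perp_normal, hKv]
        exact Submodule.mem_span_pair.2 ⟨_, _, rfl⟩
      · intro y hy v
        have t := (h.frame y hy).table
        rw [hKv, mem_perp_span_pair]
        simp [t, B_comm v]
      · intro y hy
        rw [eq_bot_iff]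
        rintro v ⟨h1, h2⟩
        rw [SetLike.mem_coe, (h.frame y hy).perp_perp_normal, (h.frame y hy).mem_normal] at h1
        rw [SetLike.mem_coe, mem_perp_span_pair] at h2
        rw [Submodule.mem_bot, (h.frame y hy).expand v]
        simp [h1, h2]
      · exact hx
    ext1 v
    obtain ⟨a, b, ha, hb⟩ := h.dd_normal_eq_smul hx Z
    obtain ⟨a', b', ha', hb'⟩ := h.dd_normal_eq_smul hx Z'
    change normalForm _ _ x Z (normalForm _ _ x Z' v) = normalForm _ _ x Z' (normalForm _ _ x Z v)
    simp only [hN, ha, hb, ha', hb', e₁, e₂]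
    simp only [map_add, map_sub, map_smul, LinearMap.add_apply, LinearMap.smul_apply, t, smul_eq_mul]
    module

end

/-! ### Quadratic differentials -/

theorem apply_of_mem_wedgeSpace {F : Submodule ℝ R42} (hF : ∀ a ∈ F, ∀ b ∈ F, B a b = 0)
    {A : R42 →L[ℝ] R42} (hA : A ∈ wedgeSpace F (perp F)) :
    (∀ v ∈ F, A v = 0) ∧ ∀ v ∈ perp F, A v ∈ F := by
  refine Submodule.span_induction ?_ ?_ ?_ ?_ hA
  · rintro _ ⟨a, ha, b, hb, rfl⟩
    refine ⟨fun v hv => ?_, fun v hv => ?_⟩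
    · rw [wedge_apply, hF a ha v hv, B_comm, hb v hv]; simp
    · rw [wedge_apply, hv a ha, zero_smul, zero_sub]
      exact F.neg_mem (F.smul_mem _ ha)
  · exact ⟨fun v _ => rfl, fun v _ => F.zero_mem⟩
  · rintro A A' - - ⟨h1, h2⟩ ⟨h3, h4⟩
    exact ⟨fun v hv => by rw [add_apply, h1 v hv, h3 v hv, add_zero],
      fun v hv => by rw [add_apply]; exact F.add_mem (h2 v hv) (h4 v hv)⟩
  · rintro c A - ⟨h1, h2⟩
    exact ⟨fun v hv => by rw [smul_apply, h1 v hv, smul_zero],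
      fun v hv => by rw [smul_apply]; exact F.smul_mem _ (h2 v hv)⟩

section

variable {M : Type*} [TopologicalSpace M] [ChartedSpace E2 M] [IsManifold (𝓡 2) ∞ M]

/-- The quadratic differential of a form with values in `f ∧ f^⊥`, in terms of an adapted frame. -/
theorem IsAdaptedFrame.exists_trace {f s₁ s₂ : Family42 M} {l₁ l₂ : M → R42} {U : Set M}
    {σ₁ σ₂ b₁ b₂ : M → R42} {X Y : ∀ y : M, TangentSpace (𝓡 2) y}
    (h : IsAdaptedFrame f s₁ s₂ l₁ l₂ U σ₁ σ₂ b₁ b₂ X Y) (hf : IsLegendre f)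
    {x : M} (hx : x ∈ U) {T : R42 →L[ℝ] R42} (hT : T ∈ wedgeSpace (f x) (perp (f x)))
    (W : TangentSpace (𝓡 2) x) : ∃ A : f x →ₗ[ℝ] f x,
    (∀ (U : Set M) (σ : M → R42), IsOpen U → x ∈ U → IsSection f U σ →
      ∀ h : σ x ∈ f x, (A ⟨σ x, h⟩ : R42) = T (dd σ x W)) ∧
    LinearMap.trace ℝ (f x) A = B (T (dd σ₁ x W)) (b₁ x) + B (T (dd σ₂ x W)) (b₂ x) := by
  have hU := h.isOpen
  obtain ⟨hT1, hT2⟩ := apply_of_mem_wedgeSpace (hf.null x) hT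
  have sec₁ : IsSection f U σ₁ := ⟨h.smooth₁, fun y hy => by
    rw [h.f_eq' y hy]; exact Submodule.subset_span (by simp)⟩
  have sec₂ : IsSection f U σ₂ := ⟨h.smooth₂, fun y hy => by
    rw [h.f_eq' y hy]; exact Submodule.subset_span (by simp)⟩
  have c₁ := hf.contact x U σ₁ hU hx sec₁ W
  have c₂ := hf.contact x U σ₂ hU hx sec₂ W
  let A : f x →ₗ[ℝ] f x :=
    ((B.flip (b₁ x)).comp (f x).subtype).smulRight ⟨T (dd σ₁ x W), hT2 _ c₁⟩ +
    ((B.flip (b₂ x)).comp (f x).subtype).smulRight ⟨T (dd σ₂ x W), hT2 _ c₂⟩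
  refine ⟨A, fun V σ hV hxV hσ hmem => ?_, ?_⟩
  · have hW := hU.inter hV
    have hxW : x ∈ U ∩ V := ⟨hx, hxV⟩
    have hσW : SmoothOn σ (U ∩ V) := hσ.1.mono inter_subset_right
    change B (σ x) (b₁ x) • T (dd σ₁ x W) + B (σ x) (b₂ x) • T (dd σ₂ x W) = _
    -- `T` kills `f`, so it suffices that `dσ` agrees modulo `f` with the combination of `dσ₁`,
    -- `dσ₂` having the coefficients of `σ x`. The difference is orthogonal to `f`, `l₁` and `l₂`,
    -- which characterises `f`.
    suffices hm : dd σ x W - (B (σ x) (b₁ x) • dd σ₁ x W + B (σ x) (b₂ x) • dd σ₂ x W) ∈ f x by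
      have e := hT1 _ hm
      rw [map_sub, map_add, T.map_smul, T.map_smul, sub_eq_zero] at e
      exact e.symm
    have hs := fun y (hy : y ∈ U ∩ V) => (h.frame y hy.1).mem_plane.1
      (by rw [← h.f_eq' y hy.1]; exact hσ.2 y hy.2 : σ y ∈ Submodule.span ℝ {σ₁ y, σ₂ y})
    have p : ∀ D ∈ perp (f x), B D (σ₁ x) = 0 ∧ B D (σ₂ x) = 0 := fun D hD => by
      rwa [h.f_eq' x hx, mem_perp_span_pair] at hD
    have c := hf.contact x V σ hV hxV hσ W
    have t := (h.frame x hx).table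
    have hD := p _ (sub_mem c (add_mem ((perp (f x)).smul_mem (B (σ x) (b₁ x)) c₁)
      ((perp (f x)).smul_mem (B (σ x) (b₂ x)) c₂)))
    have hσx : σ x = B (σ x) (b₁ x) • σ₁ x + B (σ x) (b₂ x) • σ₂ x := by
      conv_lhs => rw [(h.frame x hx).expand (σ x)]
      simp [hs x hxW]
    rw [h.f_eq' x hx, (h.frame x hx).mem_plane]
    have hl : ∀ l : M → R42, SmoothOn l U →
        (∀ y ∈ U, B (σ₁ y) (l y) = 0) → (∀ y ∈ U, B (σ₂ y) (l y) = 0) →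
        (∀ y ∈ U ∩ V, B (σ y) (l y) = 0) →
        B (dd σ x W - (B (σ x) (b₁ x) • dd σ₁ x W + B (σ x) (b₂ x) • dd σ₂ x W)) (l x) = 0 := by
      intro l hl h1 h2 h3
      have e1 := B_dd_eq hU hx h.smooth₁ hl h1 W
      have e2 := B_dd_eq hU hx h.smooth₂ hl h2 W
      have e3 := B_dd_eq hW hxW hσW (hl.mono inter_subset_left) h3 W
      rw [hσx] at e3
      simp only [map_add, map_smul, map_sub, LinearMap.add_apply, LinearMap.smul_apply,
        LinearMap.sub_apply, smul_eq_mul, e1, e2] at e3 ⊢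
      linarith
    exact ⟨hD.1, hD.2, hl l₁ h.smooth_l₁ (fun y hy => (h.frame y hy).a₁l₁)
      (fun y hy => (h.frame y hy).a₂l₁) (fun y hy => (hs y hy).2.2.1),
      hl l₂ h.smooth_l₂ (fun y hy => (h.frame y hy).a₁l₂) (fun y hy => (h.frame y hy).a₂l₂)
      (fun y hy => (hs y hy).2.2.2)⟩
  · rw [map_add, LinearMap.trace_smulRight, LinearMap.trace_smulRight]
    rfl

/-- The endomorphism is determined by its values on `σ₁` and `σ₂`, so any choice of it has the trace
computed in the adapted frame. -/
theorem exists_isQuadDiff {f s₁ s₂ : Family42 M} {l₁ l₂ : M → R42} (hf : IsLegendre f)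
    (hex : ∀ x, ∃ (U : Set M) (σ₁ σ₂ b₁ b₂ : M → R42) (X Y : ∀ y : M, TangentSpace (𝓡 2) y),
      x ∈ U ∧ IsAdaptedFrame f s₁ s₂ l₁ l₂ U σ₁ σ₂ b₁ b₂ X Y)
    {η : OneForm M (R42 →L[ℝ] R42)} (hη : ∀ x X, η x X ∈ wedgeSpace (f x) (perp (f x)))
    {x₀ : M} {U : Set M} {σ₁ σ₂ b₁ b₂ : M → R42} {X Y : ∀ y : M, TangentSpace (𝓡 2) y}
    (hx₀ : x₀ ∈ U) (h : IsAdaptedFrame f s₁ s₂ l₁ l₂ U σ₁ σ₂ b₁ b₂ X Y)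
    (Z W : TangentSpace (𝓡 2) x₀)
    (hne : B (η x₀ Z (dd σ₁ x₀ W)) (b₁ x₀) + B (η x₀ Z (dd σ₂ x₀ W)) (b₂ x₀) ≠ 0) :
    ∃ q, IsQuadDiff f η q ∧ ∃ x X Y, q x X Y ≠ 0 := by
  have hA : ∀ (x : M) (X Y : TangentSpace (𝓡 2) x), ∃ A : f x →ₗ[ℝ] f x,
      ∀ (U : Set M) (σ : M → R42), IsOpen U → x ∈ U → IsSection f U σ →
      ∀ h : σ x ∈ f x, (A ⟨σ x, h⟩ : R42) = η x X (dd σ x Y) := by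
    intro x X Y
    obtain ⟨U, σ₁, σ₂, b₁, b₂, X', Y', hx, h⟩ := hex x
    obtain ⟨A, hA, -⟩ := h.exists_trace hf hx (hη x X) Y
    exact ⟨A, hA⟩
  choose A hA using hA
  refine ⟨fun x X Y => LinearMap.trace ℝ (f x) (A x X Y), fun x X Y => ⟨A x X Y, hA x X Y, rfl⟩,
    x₀, Z, W, ?_⟩
  obtain ⟨A', hA', htr⟩ := h.exists_trace hf hx₀ (hη x₀ Z) W
  have hAA : A x₀ Z W = A' := by
    have sec₁ : IsSection f U σ₁ := ⟨h.smooth₁, fun y hy => by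
      rw [h.f_eq' y hy]; exact Submodule.subset_span (by simp)⟩
    have sec₂ : IsSection f U σ₂ := ⟨h.smooth₂, fun y hy => by
      rw [h.f_eq' y hy]; exact Submodule.subset_span (by simp)⟩
    ext1 ⟨v, hv⟩
    have hv' := hv
    rw [h.f_eq' x₀ hx₀, Submodule.mem_span_pair] at hv'
    obtain ⟨c, d, hcd⟩ := hv'
    have e : (⟨v, hv⟩ : f x₀) = c • ⟨σ₁ x₀, sec₁.2 x₀ hx₀⟩ + d • ⟨σ₂ x₀, sec₂.2 x₀ hx₀⟩ :=
      Subtype.ext hcd.symm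
    have e₁ : A x₀ Z W ⟨σ₁ x₀, sec₁.2 x₀ hx₀⟩ = A' ⟨σ₁ x₀, sec₁.2 x₀ hx₀⟩ := Subtype.ext
      ((hA x₀ Z W U σ₁ h.isOpen hx₀ sec₁ _).trans (hA' U σ₁ h.isOpen hx₀ sec₁ _).symm)
    have e₂ : A x₀ Z W ⟨σ₂ x₀, sec₂.2 x₀ hx₀⟩ = A' ⟨σ₂ x₀, sec₂.2 x₀ hx₀⟩ := Subtype.ext
      ((hA x₀ Z W U σ₂ h.isOpen hx₀ sec₂ _).trans (hA' U σ₂ h.isOpen hx₀ sec₂ _).symm)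
    rw [e, map_add, map_add, map_smul, map_smul, map_smul, map_smul, e₁, e₂]
  simp only [hAA, htr]
  exact hne

end

/-! ### The structure equations -/

section

variable {M : Type*} [TopologicalSpace M] [ChartedSpace E2 M] [IsManifold (𝓡 2) ∞ M]

namespace IsAdaptedFrame

variable {f s₁ s₂ : Family42 M} {l₁ l₂ : M → R42} {U : Set M}
    {σ₁ σ₂ b₁ b₂ : M → R42} {X Y : ∀ y : M, TangentSpace (𝓡 2) y}

theorem dl₁_eq (h : IsAdaptedFrame f s₁ s₂ l₁ l₂ U σ₁ σ₂ b₁ b₂ X Y) {x : M} (hx : x ∈ U)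
    (Z : TangentSpace (𝓡 2) x) :
    dd l₁ x Z = B (dd l₁ x Z) (b₁ x) • σ₁ x + B (dd l₁ x Z) (σ₁ x) • b₁ x := by
  have t := (h.frame x hx).table
  obtain ⟨c, -, hc, -⟩ := h.dd_normal_eq_smul hx Z
  obtain ⟨r, k, e, -⟩ := h.dl₁Y x hx
  rw [hc, e]
  simp [t, smul_smul]

theorem contact₁ (h : IsAdaptedFrame f s₁ s₂ l₁ l₂ U σ₁ σ₂ b₁ b₂ X Y) {x : M} (hx : x ∈ U)
    (Z : TangentSpace (𝓡 2) x) :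
    B (dd σ₁ x Z) (σ₁ x) = 0 ∧ B (dd σ₁ x Z) (σ₂ x) = 0 ∧ B (dd σ₁ x Z) (l₂ x) = 0 := by
  have t := (h.frame x hx).table
  obtain ⟨a, b, rfl⟩ := h.exists_eq' x hx Z
  obtain ⟨α, β, e, -⟩ := h.dσ₁X x hx
  obtain ⟨u, k, e', -⟩ := h.dσ₁Y x hx
  rw [map_add, map_smul, map_smul, e, e']
  simp [t]

theorem dσ₁_eq (h : IsAdaptedFrame f s₁ s₂ l₁ l₂ U σ₁ σ₂ b₁ b₂ X Y) {x : M} (hx : x ∈ U)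
    (Z : TangentSpace (𝓡 2) x) :
    dd σ₁ x Z = B (dd σ₁ x Z) (b₁ x) • σ₁ x + B (dd σ₁ x Z) (b₂ x) • σ₂ x -
      B (dd l₁ x Z) (σ₁ x) • l₁ x := by
  obtain ⟨c1, c2, c3⟩ := h.contact₁ hx Z
  have e := B_dd_eq h.isOpen hx h.smooth₁ h.smooth_l₁ (fun y hy => (h.frame y hy).a₁l₁) Z
  conv_lhs => rw [(h.frame x hx).expand (dd σ₁ x Z)]
  rw [c1, c2, c3, e, B_comm (σ₁ x)]
  module

theorem db₁_eq (h : IsAdaptedFrame f s₁ s₂ l₁ l₂ U σ₁ σ₂ b₁ b₂ X Y) {x : M} (hx : x ∈ U)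
    (Z : TangentSpace (𝓡 2) x) :
    dd b₁ x Z = B (dd b₁ x Z) (b₂ x) • σ₂ x - B (dd σ₁ x Z) (b₁ x) • b₁ x -
      B (dd σ₂ x Z) (b₁ x) • b₂ x - B (dd l₁ x Z) (b₁ x) • l₁ x := by
  have t := (h.frame x hx).table
  have e1 := B_dd_eq h.isOpen hx h.smooth_b₁ h.smooth_b₁ (fun y hy => (h.frame y hy).b₁b₁) Z
  have e2 := B_dd_eq h.isOpen hx h.smooth_b₁ h.smooth₁
    (fun y hy => (B_comm _ _).trans (h.frame y hy).a₁b₁) Z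
  have e3 := B_dd_eq h.isOpen hx h.smooth_b₁ h.smooth₂
    (fun y hy => (B_comm _ _).trans (h.frame y hy).a₂b₁) Z
  have e4 := B_dd_eq h.isOpen hx h.smooth_b₁ h.smooth_l₁ (fun y hy => (h.frame y hy).b₁l₁) Z
  have e5 := B_dd_eq h.isOpen hx h.smooth_b₁ h.smooth_l₂ (fun y hy => (h.frame y hy).b₁l₂) Z
  have e1' : B (dd b₁ x Z) (b₁ x) = 0 := by rw [B_comm (b₁ x)] at e1; linarith
  have e6 : B (b₁ x) (dd l₂ x Z) = 0 := by rw [h.swap.dl₁_eq hx Z]; simp [t]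
  conv_lhs => rw [(h.frame x hx).expand (dd b₁ x Z)]
  rw [e1', e2, e3, e4, e5, e6, B_comm (b₁ x), B_comm (b₁ x), B_comm (b₁ x)]
  module

/-- The structure equations of an adapted frame. -/
theorem structure_equations (h : IsAdaptedFrame f s₁ s₂ l₁ l₂ U σ₁ σ₂ b₁ b₂ X Y) {x : M} (hx : x ∈ U)
    (Z : TangentSpace (𝓡 2) x) :
    ∃ p₁₁ p₁₂ p₂₁ p₂₂ : ℝ,
      dd σ₁ x Z = p₁₁ • σ₁ x + p₁₂ • σ₂ x - B (dd l₁ x Z) (σ₁ x) • l₁ x ∧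
      dd σ₂ x Z = p₂₁ • σ₁ x + p₂₂ • σ₂ x - B (dd l₂ x Z) (σ₂ x) • l₂ x ∧
      dd b₁ x Z = B (dd b₁ x Z) (b₂ x) • σ₂ x - p₁₁ • b₁ x - p₂₁ • b₂ x -
        B (dd l₁ x Z) (b₁ x) • l₁ x ∧
      dd b₂ x Z = -B (dd b₁ x Z) (b₂ x) • σ₁ x - p₁₂ • b₁ x - p₂₂ • b₂ x -
        B (dd l₂ x Z) (b₂ x) • l₂ x := by
  have e := B_dd_eq h.isOpen hx h.smooth_b₂ h.smooth_b₁
    (fun y hy => (B_comm _ _).trans (h.frame y hy).b₁b₂) Z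
  rw [B_comm (b₂ x)] at e
  refine ⟨_, _, _, B (dd σ₂ x Z) (b₂ x), h.dσ₁_eq hx Z, ?_, h.db₁_eq hx Z, ?_⟩
  · conv_lhs => rw [h.swap.dσ₁_eq hx Z]
    module
  · conv_lhs => rw [h.swap.db₁_eq hx Z, e]
    module

/-- Adapted frames differ by scaling. -/
theorem exists_smul_eq (h : IsAdaptedFrame f s₁ s₂ l₁ l₂ U σ₁ σ₂ b₁ b₂ X Y) {U' : Set M}
    {σ₁' σ₂' b₁' b₂' : M → R42} {X' Y' : ∀ y : M, TangentSpace (𝓡 2) y}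
    (h' : IsAdaptedFrame f s₁ s₂ l₁ l₂ U' σ₁' σ₂' b₁' b₂' X' Y') {x : M} (hx : x ∈ U) (hx' : x ∈ U') :
    ∃ t : ℝ, t ≠ 0 ∧ σ₁' x = t • σ₁ x ∧ b₁' x = t⁻¹ • b₁ x := by
  have T := (h.frame x hx).table
  have T' := (h'.frame x hx').table
  have hσ : σ₁' x ∈ Submodule.span ℝ {σ₁ x} := by
    rw [← h.eq₁ x hx, h'.eq₁ x hx']; exact Submodule.mem_span_singleton_self _
  have hY : Y' x ∈ Submodule.span ℝ {Y x} := by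
    rw [← h.eqY x hx, h'.eqY x hx']; exact Submodule.mem_span_singleton_self _
  obtain ⟨t, ht⟩ := Submodule.mem_span_singleton.1 hσ
  obtain ⟨m, hm⟩ := Submodule.mem_span_singleton.1 hY
  obtain ⟨r, c, e, hc⟩ := h.dl₁Y x hx
  obtain ⟨r', c', e', hc'⟩ := h'.dl₁Y x hx'
  rw [← hm, map_smul, e, ← ht] at e'
  -- Both duals lie in the plane of `σ₁` and `d_Y l₁`. Nullity then removes the `σ₁` component, and
  -- the normalisation `(σ₁', b₁') = 1` fixes the factor `t⁻¹`.
  have hb : b₁' x = (c'⁻¹ * (m * r - r' * t)) • σ₁ x + (c'⁻¹ * (m * c)) • b₁ x := by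
    have : c' • b₁' x = (m * r - r' * t) • σ₁ x + (m * c) • b₁ x := by
      rw [← sub_eq_iff_eq_add'.2 e']; module
    rw [← inv_smul_smul₀ hc' (b₁' x), this]; module
  set D := c'⁻¹ * (m * r - r' * t)
  set A := c'⁻¹ * (m * c)
  have h1 : t * A = 1 := by
    have := T'.2.2.2.2.2.2.1
    rw [hb, ← ht] at this
    simpa [T] using this
  have h2 : A * D = 0 := by
    have := T'.2.2.2.1
    rw [hb] at this
    simp [T] at this
    have h3 : A * D + A * D = 0 := by simpa [mul_comm] using this
    linarith
  have hA : A ≠ 0 := right_ne_zero_of_mul_eq_one h1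
  have hD : D = 0 := (mul_eq_zero.1 h2).resolve_left hA
  refine ⟨t, left_ne_zero_of_mul_eq_one h1, ht.symm, ?_⟩
  rw [hb, hD, eq_inv_of_mul_eq_one_right h1]
  simp

end IsAdaptedFrame

/-- Expressions that are bilinear in the dual null vectors of an adapted frame are globally
defined. -/
theorem exists_global {E : Type*} [NormedAddCommGroup E] [NormedSpace ℝ E]
    (Λ : R42 →L[ℝ] R42 →L[ℝ] E) {f s₁ s₂ : Family42 M} {l₁ l₂ : M → R42}
    (hex : ∀ x, ∃ (U : Set M) (σ₁ σ₂ b₁ b₂ : M → R42) (X Y : ∀ y : M, TangentSpace (𝓡 2) y),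
      x ∈ U ∧ IsAdaptedFrame f s₁ s₂ l₁ l₂ U σ₁ σ₂ b₁ b₂ X Y) :
    ∃ τ : M → E, SmoothOn τ univ ∧
      ∀ (U : Set M) (σ₁ σ₂ b₁ b₂ : M → R42) (X Y : ∀ y : M, TangentSpace (𝓡 2) y),
      IsAdaptedFrame f s₁ s₂ l₁ l₂ U σ₁ σ₂ b₁ b₂ X Y →
      ∀ x ∈ U, τ x = Λ (b₁ x) (σ₁ x) + Λ (b₂ x) (σ₂ x) ∧
        ∀ Z, dd τ x Z = (Λ (b₁ x) (dd σ₁ x Z) + Λ (dd b₁ x Z) (σ₁ x)) +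
          (Λ (b₂ x) (dd σ₂ x Z) + Λ (dd b₂ x Z) (σ₂ x)) := by
  have key : ∀ x, ∃ w : E, ∀ (U : Set M) (σ₁ σ₂ b₁ b₂ : M → R42)
      (X Y : ∀ y : M, TangentSpace (𝓡 2) y), IsAdaptedFrame f s₁ s₂ l₁ l₂ U σ₁ σ₂ b₁ b₂ X Y →
      x ∈ U → w = Λ (b₁ x) (σ₁ x) + Λ (b₂ x) (σ₂ x) := by
    intro x
    obtain ⟨U, σ₁, σ₂, b₁, b₂, X, Y, hx, h⟩ := hex x
    refine ⟨Λ (b₁ x) (σ₁ x) + Λ (b₂ x) (σ₂ x), fun U' σ₁' σ₂' b₁' b₂' X' Y' h' hx' => ?_⟩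
    -- The factors `t` and `t⁻¹` cancel in `Λ(b₁, σ₁)`, and likewise for the second pair.
    obtain ⟨t, ht, e1, e2⟩ := h.exists_smul_eq h' hx hx'
    obtain ⟨u, hu, e3, e4⟩ := h.swap.exists_smul_eq h'.swap hx hx'
    rw [e1, e2, e3, e4]
    simp [smul_smul, ht, hu]
  choose τ hτ using key
  refine ⟨τ, fun x _ => ?_, fun U σ₁ σ₂ b₁ b₂ X Y h x hx =>
    ⟨hτ x U σ₁ σ₂ b₁ b₂ X Y h hx, fun Z => ?_⟩⟩
  · obtain ⟨U, σ₁, σ₂, b₁, b₂, X, Y, hx, h⟩ := hex x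
    have e1 : SmoothOn (fun x => Λ (b₁ x) (σ₁ x)) U := h.smooth_b₁.bilin Λ h.smooth₁
    have e2 : SmoothOn (fun x => Λ (b₂ x) (σ₂ x)) U := h.smooth_b₂.bilin Λ h.smooth₂
    have e3 : SmoothOn τ U :=
      ContMDiffOn.congr (ContMDiffOn.add e1 e2) fun y hy => hτ y U σ₁ σ₂ b₁ b₂ X Y h hy
    exact (e3.contMDiffAt (h.isOpen.mem_nhds hx)).contMDiffWithinAt
  · have t1 : SmoothOn (fun x => Λ (b₁ x) (σ₁ x)) U := h.smooth_b₁.bilin Λ h.smooth₁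
    have t2 : SmoothOn (fun x => Λ (b₂ x) (σ₂ x)) U := h.smooth_b₂.bilin Λ h.smooth₂
    have e : τ =ᶠ[𝓝 x] fun x => Λ (b₁ x) (σ₁ x) + Λ (b₂ x) (σ₂ x) := by
      filter_upwards [h.isOpen.mem_nhds hx] with y hy using hτ y U σ₁ σ₂ b₁ b₂ X Y h hy
    rw [dd_congr e,
      dd_add (t1.mdifferentiableAt h.isOpen hx) (t2.mdifferentiableAt h.isOpen hx),
      dd_bilin Λ (h.smooth_b₁.mdifferentiableAt h.isOpen hx)
        (h.smooth₁.mdifferentiableAt h.isOpen hx),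
      dd_bilin Λ (h.smooth_b₂.mdifferentiableAt h.isOpen hx)
        (h.smooth₂.mdifferentiableAt h.isOpen hx)]

end

/-! ### Gauge potentials -/

section

variable {M : Type*} [TopologicalSpace M] [ChartedSpace E2 M] [IsManifold (𝓡 2) ∞ M]

/-- Gauge potential in the case that the derivative of a normal field is not everywhere null. -/
theorem isLieApplicable_of_ne {f s₁ s₂ : Family42 M} {l₁ l₂ : M → R42} (hf : IsLegendre f)
    (hl₁ : SmoothOn l₁ univ) (hl₂ : SmoothOn l₂ univ)
    (hex : ∀ x, ∃ (U : Set M) (σ₁ σ₂ b₁ b₂ : M → R42) (X Y : ∀ y : M, TangentSpace (𝓡 2) y),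
      x ∈ U ∧ IsAdaptedFrame f s₁ s₂ l₁ l₂ U σ₁ σ₂ b₁ b₂ X Y)
    {x₀ : M} {U₀ : Set M} {σ₁₀ σ₂₀ b₁₀ b₂₀ : M → R42} {X₀ Y₀ : ∀ y : M, TangentSpace (𝓡 2) y}
    (hx₀ : x₀ ∈ U₀) (h₀ : IsAdaptedFrame f s₁ s₂ l₁ l₂ U₀ σ₁₀ σ₂₀ b₁₀ b₂₀ X₀ Y₀)
    (hne : B (dd l₁ x₀ (Y₀ x₀)) (b₁₀ x₀) ≠ 0) : IsLieApplicable f := by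
  obtain ⟨τ, hτg, hτ⟩ := exists_global wedgeC hex
  -- With `b = (l₁, l₂, τ)`, `Ψ(b) db` is `½ (l₁ ∧ dl₁ + l₂ ∧ dl₂)`, and the projection `π` supplies
  -- `dτ`. This presents `η` as `Φ(db)` with global smooth `Φ` and `b`.
  let Ψ : R42 × R42 × (R42 →L[ℝ] R42) →L[ℝ]
      R42 × R42 × (R42 →L[ℝ] R42) →L[ℝ] (R42 →L[ℝ] R42) :=
    (1 / 2 : ℝ) •
    (wedgeC.bilinearComp (ContinuousLinearMap.fst ℝ _ _) (ContinuousLinearMap.fst ℝ _ _) +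
    wedgeC.bilinearComp ((ContinuousLinearMap.fst ℝ _ _).comp (ContinuousLinearMap.snd ℝ _ _))
      ((ContinuousLinearMap.fst ℝ _ _).comp (ContinuousLinearMap.snd ℝ _ _)))
  let π : R42 × R42 × (R42 →L[ℝ] R42) →L[ℝ] (R42 →L[ℝ] R42) :=
    (ContinuousLinearMap.snd ℝ _ _).comp (ContinuousLinearMap.snd ℝ _ _)
  let b : M → R42 × R42 × (R42 →L[ℝ] R42) := fun x => (l₁ x, l₂ x, τ x)
  let η : OneForm M (R42 →L[ℝ] R42) := fun x => (Ψ (b x) - (1 / 2 : ℝ) • π).comp (dd b x)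
  have hb : SmoothOn b univ := hl₁.prodMk_space (hl₂.prodMk_space hτg)
  have hdb : ∀ x Z, dd b x Z = (dd l₁ x Z, dd l₂ x Z, dd τ x Z) := by
    intro x Z
    have hbx := hb.mdifferentiableAt isOpen_univ (mem_univ x)
    refine Prod.ext ?_ (Prod.ext ?_ ?_)
    · exact (dd_linear (ContinuousLinearMap.fst ℝ _ _) hbx Z).symm
    · exact (dd_linear ((ContinuousLinearMap.fst ℝ _ _).comp (ContinuousLinearMap.snd ℝ _ _)) hbx Z).symm
    · exact (dd_linear π hbx Z).symm
  have hη : ∀ x Z, η x Z = (1 / 2 : ℝ) • (wedge (l₁ x) (dd l₁ x Z) + wedge (l₂ x) (dd l₂ x Z)) -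
      (1 / 2 : ℝ) • dd τ x Z := by
    intro x Z
    change Ψ (b x) (dd b x Z) - (1 / 2 : ℝ) • π (dd b x Z) = _
    rw [hdb]
    rfl
  -- `dτ` contains `c_i l_i ∧ b_i` exactly as `l_i ∧ dl_i` does, and the coefficients `p` cancel.
  -- What is left lies in `f ∧ f^⊥`.
  have hval : ∀ (U : Set M) (σ₁ σ₂ b₁ b₂ : M → R42) (X Y : ∀ y : M, TangentSpace (𝓡 2) y),
      IsAdaptedFrame f s₁ s₂ l₁ l₂ U σ₁ σ₂ b₁ b₂ X Y → ∀ x ∈ U, ∀ Z,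
      η x Z = B (dd l₁ x Z) (b₁ x) • wedge (l₁ x) (σ₁ x) +
        B (dd l₂ x Z) (b₂ x) • wedge (l₂ x) (σ₂ x) +
        B (dd b₁ x Z) (b₂ x) • wedge (σ₁ x) (σ₂ x) := by
    intro U σ₁ σ₂ b₁ b₂ X Y h x hx Z
    obtain ⟨p₁₁, p₁₂, p₂₁, p₂₂, e1, e2, e3, e4⟩ := h.structure_equations hx Z
    have hdτ : dd τ x Z = (wedge (b₁ x) (dd σ₁ x Z) + wedge (dd b₁ x Z) (σ₁ x)) +
        (wedge (b₂ x) (dd σ₂ x Z) + wedge (dd b₂ x Z) (σ₂ x)) :=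
      (hτ U σ₁ σ₂ b₁ b₂ X Y h x hx).2 Z
    have f1 := h.dl₁_eq hx Z
    have f2 := h.swap.dl₁_eq hx Z
    set r₁ := B (dd l₁ x Z) (b₁ x)
    set r₂ := B (dd l₂ x Z) (b₂ x)
    set c₁ := B (dd l₁ x Z) (σ₁ x)
    set c₂ := B (dd l₂ x Z) (σ₂ x)
    set φ := B (dd b₁ x Z) (b₂ x)
    rw [hη, hdτ, f1, f2, e1, e2, e3, e4]
    ext1 v
    simp only [smul_apply, add_apply, sub_apply, wedge_apply, map_add, map_sub, map_smul,
      LinearMap.add_apply, LinearMap.sub_apply, LinearMap.smul_apply, smul_eq_mul]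
    module
  have hmem : ∀ x Z, η x Z ∈ wedgeSpace (f x) (perp (f x)) := by
    intro x Z
    obtain ⟨U, σ₁, σ₂, b₁, b₂, X, Y, hx, h⟩ := hex x
    have hs₁ : σ₁ x ∈ f x := by rw [h.f_eq' x hx]; exact Submodule.subset_span (by simp)
    have hs₂ : σ₂ x ∈ f x := by rw [h.f_eq' x hx]; exact Submodule.subset_span (by simp)
    have t := (h.frame x hx).table
    have hp : ∀ v, B v (σ₁ x) = 0 → B v (σ₂ x) = 0 → v ∈ perp (f x) := fun v h1 h2 => by
      rw [h.f_eq' x hx, mem_perp_span_pair]; exact ⟨h1, h2⟩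
    have anti : ∀ v w : R42, wedge v w = -wedge w v := fun v w => by
      ext1 u
      simp [wedge_apply]
    rw [hval U σ₁ σ₂ b₁ b₂ X Y h x hx Z, anti (l₁ x), anti (l₂ x)]
    refine add_mem (add_mem (Submodule.smul_mem _ _ (neg_mem ?_))
      (Submodule.smul_mem _ _ (neg_mem ?_))) (Submodule.smul_mem _ _ ?_)
    · exact Submodule.subset_span ⟨_, hs₁, _, hp (l₁ x) (by simp [t]) (by simp [t]), rfl⟩
    · exact Submodule.subset_span ⟨_, hs₂, _, hp (l₂ x) (by simp [t]) (by simp [t]), rfl⟩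
    · exact Submodule.subset_span ⟨_, hs₁, _, hp (σ₂ x) (by simp [t]) (by simp [t]), rfl⟩
  have hsc := OneForm.isSmooth_isClosed_of_local η (by
    intro p
    have hs : SmoothOn (fun x => Ψ (b x)) univ := 
      SmoothOn.linear (G := R42 × R42 × (R42 →L[ℝ] R42) →L[ℝ] (R42 →L[ℝ] R42)) Ψ hb
    have hc : SmoothOn (fun _ : M => (1 / 2 : ℝ) • π) univ := contMDiffOn_const
    refine ⟨univ, isOpen_univ, mem_univ p, _, b, ContMDiffOn.sub hs hc, hb, fun x _ Z => rfl,
      fun x _ Z W => ?_⟩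
    have hd : ∀ Z, dd (fun x => Ψ (b x) - (1 / 2 : ℝ) • π) x Z = Ψ (dd b x Z) := by
      intro Z
      rw [dd_sub (hs.mdifferentiableAt isOpen_univ (mem_univ x))
          (hc.mdifferentiableAt isOpen_univ (mem_univ x)), dd_const,
        dd_linear (G := R42 × R42 × (R42 →L[ℝ] R42) →L[ℝ] (R42 →L[ℝ] R42)) Ψ
          (hb.mdifferentiableAt isOpen_univ (mem_univ x))]
      exact sub_zero (Ψ (dd b x Z))
    have hz : ∀ (c c' : ℝ) (u : R42), wedge (c • u) (c' • u) = 0 := by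
      intro c c' u
      ext1 v
      simp only [wedge_apply, map_smul, LinearMap.smul_apply, smul_eq_mul, zero_apply]
      module
    -- `d(l_i ∧ dl_i)` is built from `d_Z l_i ∧ d_W l_i`, which vanishes because `dl_i` has rank
    -- one.
    have hzz : ∀ Z W, Ψ (dd b x Z) (dd b x W) = 0 := by
      intro Z W
      obtain ⟨U, σ₁, σ₂, b₁, b₂, X, Y, hx, h⟩ := hex x
      obtain ⟨c, d, e1, e2⟩ := h.dd_normal_eq_smul hx Z
      obtain ⟨c', d', e3, e4⟩ := h.dd_normal_eq_smul hx W
      rw [hdb, hdb, e1, e2, e3, e4]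
      refine (congrArg ((1 / 2 : ℝ) • ·) (congrArg₂ (· + ·) (hz c c' _) (hz d d' _))).trans ?_
      simp
    refine (congrArg (fun T => T (dd b x W)) (hd Z)).trans ((hzz Z W).trans ?_)
    exact ((congrArg (fun T => T (dd b x Z)) (hd W)).trans (hzz W Z)).symm)
  refine ⟨hf, η, hsc.1, hmem, hsc.2, fun x Z W => ?_, ?_⟩
  · obtain ⟨U, σ₁, σ₂, b₁, b₂, X, Y, hx, h⟩ := hex x
    have t := (h.frame x hx).table
    rw [hval U σ₁ σ₂ b₁ b₂ X Y h x hx Z, hval U σ₁ σ₂ b₁ b₂ X Y h x hx W, sub_eq_zero]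
    ext1 v
    simp only [ContinuousLinearMap.comp_apply, add_apply, smul_apply, wedge_apply, map_add, map_sub,
      map_smul, t]
    module
  -- Along `Y` only the `l₁ ∧ σ₁` term contributes, and the trace is `-r c`, where `r` and `c` are
  -- the products of `d_Y l₁` with `b₁` and `σ₁`.
  · refine exists_isQuadDiff hf hex hmem hx₀ h₀ (Y₀ x₀) (Y₀ x₀) ?_
    have t := (h₀.frame x₀ hx₀).table
    obtain ⟨p₁₁, p₁₂, p₂₁, p₂₂, e1, e2, -, -⟩ := h₀.structure_equations hx₀ (Y₀ x₀)
    obtain ⟨r, c, e3, hc⟩ := h₀.dl₁Y x₀ hx₀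
    have hc₁ : B (dd l₁ x₀ (Y₀ x₀)) (σ₁₀ x₀) = c := by rw [e3]; simp [t]
    rw [hc₁] at e1
    rw [h₀.dl₂Y x₀ hx₀] at e2
    rw [hval _ _ _ _ _ _ _ h₀ x₀ hx₀, e1, e2, h₀.dl₂Y x₀ hx₀]
    simp [wedge_apply, t, hc, hne]

end

/-! ### The gauge potential when both normals have null derivatives -/

section

variable {M : Type*} [TopologicalSpace M] [ChartedSpace E2 M] [IsManifold (𝓡 2) ∞ M]

section

variable {E F G : Type*} [NormedAddCommGroup E] [NormedSpace ℝ E] [NormedAddCommGroup F]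
  [NormedSpace ℝ F] [NormedAddCommGroup G] [NormedSpace ℝ G]

theorem SmoothOn.comp_clm {A : M → F →L[ℝ] G} {R : M → E →L[ℝ] F} {U : Set M} (hA : SmoothOn A U)
    (hR : SmoothOn R U) : SmoothOn (fun x => (A x).comp (R x)) U :=
  hA.bilin (ContinuousLinearMap.compL ℝ E F G) hR

theorem dd_comp_clm {A : M → F →L[ℝ] G} {R : M → E →L[ℝ] F} {U : Set M} (hU : IsOpen U)
    (hA : SmoothOn A U) (hR : SmoothOn R U) {x : M} (hx : x ∈ U) (Z : TangentSpace (𝓡 2) x) :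
    dd (fun x => (A x).comp (R x)) x Z = (A x).comp (dd R x Z) + (dd A x Z).comp (R x) :=
  dd_bilin (ContinuousLinearMap.compL ℝ E F G) (hA.mdifferentiableAt hU hx)
    (hR.mdifferentiableAt hU hx) Z

end

/-- If the derivative of `l₁` is null, then the connection coefficient `(db₁, b₂)` vanishes along the
curvature direction on which `l₁` is constant. -/
theorem IsAdaptedFrame.db₁X_eq_zero {f s₁ s₂ : Family42 M} {l₁ l₂ : M → R42} {U : Set M}
    {σ₁ σ₂ b₁ b₂ : M → R42} {X Y : ∀ y : M, TangentSpace (𝓡 2) y}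
    (h : IsAdaptedFrame f s₁ s₂ l₁ l₂ U σ₁ σ₂ b₁ b₂ X Y)
    (hr : ∀ y ∈ U, B (dd l₁ y (Y y)) (b₁ y) = 0) {x : M} (hx : x ∈ U) :
    B (dd b₁ x (X x)) (b₂ x) = 0 := by
  -- `(b₂, dl₁) = 0` makes `(db₂, dl₁)` symmetric, so `(d_X b₂, d_Y l₁) = (d_Y b₂, d_X l₁) = 0`.
  -- Under the hypothesis `d_Y l₁` is a non-zero multiple of `b₁`.
  have key := bilin_dd_symm Bc h.isOpen h.smooth_b₂ h.smooth_l₁ (fun y hy Z => by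
    have t := (h.frame y hy).table
    rw [h.dl₁_eq hy Z, Bc_apply]
    simp [t]) hx (X x) (Y x)
  obtain ⟨r, c, e, hc⟩ := h.dl₁Y x hx
  have hr' := hr x hx
  have t := (h.frame x hx).table
  rw [e] at hr'
  have hr0 : r = 0 := by simpa [t] using hr'
  have e' := B_dd_eq h.isOpen hx h.smooth_b₁ h.smooth_b₂ (fun y hy => (h.frame y hy).b₁b₂) (X x)
  rw [B_comm (b₁ x)] at e'
  rw [Bc_apply, Bc_apply, h.dl₁X x hx, e, hr0] at key
  have k2 : c * B (dd b₂ x (X x)) (b₁ x) = 0 := by simpa using key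
  rw [e', (mul_eq_zero.1 k2).resolve_left hc, neg_zero]

/-- Gauge potential in the case that the derivatives of both normal fields are null. -/
theorem isLieApplicable_of_eq_zero [Nonempty M] {f s₁ s₂ : Family42 M} {l₁ l₂ : M → R42}
    (hf : IsLegendre f) (hl₁ : SmoothOn l₁ univ)
    (hex : ∀ x, ∃ (U : Set M) (σ₁ σ₂ b₁ b₂ : M → R42) (X Y : ∀ y : M, TangentSpace (𝓡 2) y),
      x ∈ U ∧ IsAdaptedFrame f s₁ s₂ l₁ l₂ U σ₁ σ₂ b₁ b₂ X Y)
    (hzero : ∀ (U : Set M) (σ₁ σ₂ b₁ b₂ : M → R42) (X Y : ∀ y : M, TangentSpace (𝓡 2) y),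
      IsAdaptedFrame f s₁ s₂ l₁ l₂ U σ₁ σ₂ b₁ b₂ X Y → ∀ y ∈ U,
      B (dd l₁ y (Y y)) (b₁ y) = 0 ∧ B (dd l₂ y (X y)) (b₂ y) = 0) : IsLieApplicable f := by
  obtain ⟨x₀⟩ := ‹Nonempty M›
  obtain ⟨U₀, σ₁₀, σ₂₀, b₁₀, b₂₀, X₀, Y₀, hx₀, h₀⟩ := hex x₀
  -- With this `v` the section `e` equals `σ₂` at `x₀`, where the quadratic differential will be
  -- evaluated.
  set v := σ₂₀ x₀ with hv
  let Λ : R42 →L[ℝ] R42 →L[ℝ] R42 := (Bc.flip v).smulRight (ContinuousLinearMap.id ℝ R42)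
  have hΛ : ∀ a w, Λ a w = B a v • w := fun a w => rfl
  obtain ⟨e, hes, he⟩ := exists_global Λ hex
  -- The reflection in `l₁^⊥`. It changes the sign of the `l₁` component of `de`, which makes the
  -- two terms of `de ∧ R de` cancel, since the `l₁` and `l₂` components of `de` live in different
  -- directions.
  let R : M → R42 →L[ℝ] R42 := fun x => ContinuousLinearMap.id ℝ R42 - (2 : ℝ) • dyadC (l₁ x) (l₁ x)
  have hRv : ∀ x w, R x w = w - (2 : ℝ) • (B (l₁ x) w • l₁ x) := fun x w => rfl
  let η : OneForm M (R42 →L[ℝ] R42) := fun x => ((wedgeC (e x)).comp (R x)).comp (dd e x)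
  have hη : ∀ x Z, η x Z = wedge (e x) (R x (dd e x Z)) := fun x Z => rfl
  have hde : ∀ (U : Set M) (σ₁ σ₂ b₁ b₂ : M → R42) (X Y : ∀ y : M, TangentSpace (𝓡 2) y),
      IsAdaptedFrame f s₁ s₂ l₁ l₂ U σ₁ σ₂ b₁ b₂ X Y → ∀ x ∈ U, ∀ Z,
      dd e x Z = -(B (dd l₁ x Z) (σ₁ x) * B (b₁ x) v) • l₁ x -
        (B (dd l₂ x Z) (σ₂ x) * B (b₂ x) v) • l₂ x := by
    intro U σ₁ σ₂ b₁ b₂ X Y h x hx Z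
    have hz := hzero U σ₁ σ₂ b₁ b₂ X Y h
    obtain ⟨p₁₁, p₁₂, p₂₁, p₂₂, e1, e2, e3, e4⟩ := h.structure_equations hx Z
    have hφ : B (dd b₁ x Z) (b₂ x) = 0 := by
      have h1 := h.db₁X_eq_zero (fun y hy => (hz y hy).1) hx
      have h2 := h.swap.db₁X_eq_zero (fun y hy => (hz y hy).2) hx
      have h3 := B_dd_eq h.isOpen hx h.smooth_b₁ h.smooth_b₂ (fun y hy => (h.frame y hy).b₁b₂) (Y x)
      rw [B_comm (b₁ x), h2, neg_zero] at h3
      obtain ⟨a, b, rfl⟩ := h.exists_eq' x hx Z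
      rw [map_add, map_smul, map_smul, map_add, map_smul, map_smul, LinearMap.add_apply,
        LinearMap.smul_apply, LinearMap.smul_apply, h1, h3]
      simp
    have hr : B (dd l₁ x Z) (b₁ x) = 0 ∧ B (dd l₂ x Z) (b₂ x) = 0 := by
      obtain ⟨c, d, e5, e6⟩ := h.dd_normal_eq_smul hx Z
      rw [e5, e6, map_smul, map_smul, LinearMap.smul_apply, LinearMap.smul_apply, (hz x hx).1,
        (hz x hx).2]
      simp
    rw [hφ, hr.1] at e3
    rw [hφ, hr.2] at e4
    rw [(he U σ₁ σ₂ b₁ b₂ X Y h x hx).2 Z, hΛ, hΛ, hΛ, hΛ, e1, e2, e3, e4]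
    simp only [map_sub, map_smul, LinearMap.sub_apply, LinearMap.smul_apply, smul_eq_mul]
    module
  have hval : ∀ (U : Set M) (σ₁ σ₂ b₁ b₂ : M → R42) (X Y : ∀ y : M, TangentSpace (𝓡 2) y),
      IsAdaptedFrame f s₁ s₂ l₁ l₂ U σ₁ σ₂ b₁ b₂ X Y → ∀ x ∈ U, ∀ Z,
      η x Z = wedge (B (b₁ x) v • σ₁ x + B (b₂ x) v • σ₂ x)
        ((B (dd l₁ x Z) (σ₁ x) * B (b₁ x) v) • l₁ x -
          (B (dd l₂ x Z) (σ₂ x) * B (b₂ x) v) • l₂ x) := by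
    intro U σ₁ σ₂ b₁ b₂ X Y h x hx Z
    have t := (h.frame x hx).table
    rw [hη, hRv, hde U σ₁ σ₂ b₁ b₂ X Y h x hx Z, (he U σ₁ σ₂ b₁ b₂ X Y h x hx).1, hΛ, hΛ]
    congr 1
    simp only [map_sub, map_smul, t, smul_eq_mul]
    module
  have hmem : ∀ x Z, η x Z ∈ wedgeSpace (f x) (perp (f x)) := by
    intro x Z
    obtain ⟨U, σ₁, σ₂, b₁, b₂, X, Y, hx, h⟩ := hex x
    have t := (h.frame x hx).table
    rw [hval U σ₁ σ₂ b₁ b₂ X Y h x hx Z, h.f_eq' x hx]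
    refine Submodule.subset_span ⟨_, Submodule.mem_span_pair.2 ⟨_, _, rfl⟩, _, ?_, rfl⟩
    rw [mem_perp_span_pair]
    simp [t]
  have hsc := OneForm.isSmooth_isClosed_of_local η (by
    intro p
    have hd : SmoothOn (fun x => dyadC (l₁ x) (l₁ x)) univ := hl₁.bilin dyadC hl₁
    have hd2 : SmoothOn (fun x => (2 : ℝ) • dyadC (l₁ x) (l₁ x)) univ :=
      SmoothOn.linear ((2 : ℝ) • ContinuousLinearMap.id ℝ (R42 →L[ℝ] R42)) hd
    have hc : SmoothOn (fun _ : M => ContinuousLinearMap.id ℝ R42) univ := contMDiffOn_const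
    have hR : SmoothOn R univ := ContMDiffOn.sub hc hd2
    have hw : SmoothOn (fun x => wedgeC (e x)) univ :=
      SmoothOn.linear (G := R42 →L[ℝ] (R42 →L[ℝ] R42)) wedgeC hes
    refine ⟨univ, isOpen_univ, mem_univ p, _, e, hw.comp_clm hR, hes, fun x _ Z => rfl,
      fun x hx Z W => ?_⟩
    have hdR : ∀ Z w, dd R x Z w = -(2 : ℝ) • (B (l₁ x) w • dd l₁ x Z + B (dd l₁ x Z) w • l₁ x) := by
      intro Z w
      rw [show dd R x Z = _ from dd_sub (hc.mdifferentiableAt isOpen_univ hx)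
        (hd2.mdifferentiableAt isOpen_univ hx) Z, dd_const,
        show dd (fun x => (2 : ℝ) • dyadC (l₁ x) (l₁ x)) x Z = _ from
          dd_linear ((2 : ℝ) • ContinuousLinearMap.id ℝ (R42 →L[ℝ] R42))
          (hd.mdifferentiableAt isOpen_univ hx) Z]
      change (0 : R42) - (2 : ℝ) • dd (fun x => dyadC (l₁ x) (l₁ x)) x Z w = _
      rw [dd_dyadC isOpen_univ hx hl₁ hl₁]
      module
    have hdΦ : ∀ Z w, dd (fun x => (wedgeC (e x)).comp (R x)) x Z w =
        wedge (e x) (dd R x Z w) + wedge (dd e x Z) (R x w) := by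
      intro Z w
      rw [dd_comp_clm isOpen_univ hw hR hx,
        dd_linear (G := R42 →L[ℝ] (R42 →L[ℝ] R42)) wedgeC (hes.mdifferentiableAt isOpen_univ hx)]
      rfl
    obtain ⟨U, σ₁, σ₂, b₁, b₂, X, Y, hxU, h⟩ := hex x
    have t := (h.frame x hxU).table
    have hz := (hzero U σ₁ σ₂ b₁ b₂ X Y h x hxU).1
    have hl : ∀ Z, ∃ c : ℝ, dd l₁ x Z = c • b₁ x := by
      intro Z
      obtain ⟨c, d, e5, -⟩ := h.dd_normal_eq_smul hxU Z
      obtain ⟨r, k, e6, -⟩ := h.dl₁Y x hxU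
      rw [e6] at hz e5
      have hr : r = 0 := by simpa [t] using hz
      exact ⟨c * k, by rw [e5, hr]; module⟩
    obtain ⟨c, hcZ⟩ := hl Z
    obtain ⟨c', hcW⟩ := hl W
    have dZ := hde U σ₁ σ₂ b₁ b₂ X Y h x hxU Z
    have dW := hde U σ₁ σ₂ b₁ b₂ X Y h x hxU W
    rw [hcZ] at dZ
    rw [hcW] at dW
    refine (hdΦ Z _).trans (Eq.trans ?_ (hdΦ W _).symm)
    -- The derivative of `R` contributes a symmetric term too: `dl₁` is proportional to `b₁`, which
    -- is orthogonal to `l₁` and `l₂`, so only the product of `dl₁` with the `l₁` component of `de`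
    -- remains, and both are supported along `Y`.
    rw [hdR, hdR, hRv, hRv, hcZ, hcW, dZ, dW]
    ext1 u
    simp only [add_apply, wedge_apply, map_add, map_sub, map_smul, LinearMap.add_apply,
      LinearMap.sub_apply, LinearMap.smul_apply, smul_eq_mul, t]
    module)
  refine ⟨hf, η, hsc.1, hmem, hsc.2, fun x Z W => ?_, ?_⟩
  · obtain ⟨U, σ₁, σ₂, b₁, b₂, X, Y, hx, h⟩ := hex x
    have t := (h.frame x hx).table
    rw [hval U σ₁ σ₂ b₁ b₂ X Y h x hx Z, hval U σ₁ σ₂ b₁ b₂ X Y h x hx W, sub_eq_zero]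
    ext1 u
    simp only [ContinuousLinearMap.comp_apply, wedge_apply, map_add, map_sub,
      map_smul, LinearMap.add_apply, LinearMap.sub_apply, LinearMap.smul_apply, smul_eq_mul, t]
    module
  -- At `x₀` one has `η(X) = -c σ₂ ∧ l₂`, and `d_X σ₂` has `l₂` component `-c`; the trace is `-c²`.
  · refine exists_isQuadDiff hf hex hmem hx₀ h₀ (X₀ x₀) (X₀ x₀) ?_
    have t := (h₀.frame x₀ hx₀).table
    obtain ⟨p₁₁, p₁₂, p₂₁, p₂₂, e1, e2, -, -⟩ := h₀.structure_equations hx₀ (X₀ x₀)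
    obtain ⟨r, c, e3, hc⟩ := h₀.dl₂X x₀ hx₀
    have hc₂ : B (dd l₂ x₀ (X₀ x₀)) (σ₂₀ x₀) = c := by rw [e3]; simp [t]
    rw [hc₂] at e2
    rw [h₀.dl₁X x₀ hx₀] at e1
    rw [hval _ _ _ _ _ _ _ h₀ x₀ hx₀, e1, e2, h₀.dl₁X x₀ hx₀, hc₂, hv]
    simp [wedge_apply, t, hc]

end

end LieSphere

end

theorem mainTheorem10 {M : Type*} [TopologicalSpace M] [T2Space M] [SecondCountableTopology M]
    [ChartedSpace E2 M] [IsManifold (𝓡 2) ∞ M] [SimplyConnectedSpace M]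
    (f s₁ s₂ : Family42 M) (hf : IsLegendre f) (humb : IsUmbilicFree f s₁ s₂)
    (hreg : IsRegularPair s₁ s₂)
    (hsph₁ : HasSphericalCurvatureLines f (curvatureSpace f s₁))
    (hsph₂ : HasSphericalCurvatureLines f (curvatureSpace f s₂)) :
    IsCurvedFlat22 (fun x => perp (osculatingComplex f s₁ s₂ x ⊔ osculatingComplex f s₂ s₁ x)) ∧
      IsLieApplicable f := by
  obtain ⟨l₁, a1, a2, a3, a4⟩ := hsph₁.exists_normal hf humb hreg
  obtain ⟨l₂, b1, b2, b3, b4⟩ := hsph₂.exists_normal hf humb.swap hreg.swap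
  have hl : IsNormalPair f s₁ s₂ l₁ l₂ := ⟨a1, b1, a2, b2, a3, b3, a4, b4⟩
  have hex : ∀ x, ∃ (U : Set M) (σ₁ σ₂ b₁ b₂ : M → R42) (X Y : ∀ y : M, TangentSpace (𝓡 2) y),
      x ∈ U ∧ IsAdaptedFrame f s₁ s₂ l₁ l₂ U σ₁ σ₂ b₁ b₂ X Y := by
    intro x
    obtain ⟨U, σ₁, σ₂, X, Y, hx, hF⟩ := humb.exists_curvatureFrame hf x
    obtain ⟨b₁, b₂, h⟩ := hF.exists_adaptedFrame hf humb hreg hl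
    exact ⟨U, σ₁, σ₂, b₁, b₂, X, Y, hx, h⟩
  refine ⟨isCurvedFlat22_of_adaptedFrame hex, ?_⟩
  -- Either some `dl_i` is non-null somewhere, and the first potential applies (after exchanging the
  -- families if `i = 2`), or both are null everywhere, and the second one does.
  by_contra hnot
  have : Nonempty M := inferInstance
  refine hnot (isLieApplicable_of_eq_zero hf hl.smooth₁ hex
    fun U σ₁ σ₂ b₁ b₂ X Y h y hy => ⟨?_, ?_⟩)
  · by_contra hne
    exact hnot (isLieApplicable_of_ne hf hl.smooth₁ hl.smooth₂ hex hy h hne)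
  · by_contra hne
    have hex' : ∀ x, ∃ (U : Set M) (σ₁ σ₂ b₁ b₂ : M → R42) (X Y : ∀ y : M, TangentSpace (𝓡 2) y),
        x ∈ U ∧ IsAdaptedFrame f s₂ s₁ l₂ l₁ U σ₁ σ₂ b₁ b₂ X Y := by
      intro x
      obtain ⟨U, σ₁, σ₂, b₁, b₂, X, Y, hx, h⟩ := hex x
      exact ⟨U, σ₂, σ₁, b₂, b₁, Y, X, hx, h.swap⟩
    exact hnot (isLieApplicable_of_ne hf hl.smooth₂ hl.smooth₁ hex' hy h.swap hne)
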